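/- **Setting.** Let $F$ be a distribution function on $\mathbb R$ with quantile function $F^\leftarrow(u)=\inf\{x:F(x)\ge u\}$ and tail quantile function $U(t)=F^\leftarrow(1-1/t)$, $t>1$. Let $\gamma<1$, $\gamma_+=\max(\gamma,0)$, and read $\frac{x^\gamma-1}{\gamma}$ as $\log x$ when $\gamma=0$. Assume $F\in D(G_\gamma)$, i.e. $F^n(a_n x+b_n)\to G_\gamma(x)$ for some $a_n>0$, $b_n\in\mathbb R$, where $G_\gamma(x)=\exp(-(1+\gamma x)^{-1/\gamma})$ for $1+\gamma x>0$ ($G_0(x)=\exp(-e^{-x})$), and let $a$ be a measurable function, positive on $(1,\infty)$, with $$\lim_{t\to\infty}\frac{U(tx)-U(t)}{a(t)}=\frac{x^\gamma-1}{\gamma},\qquad x>0.$$ The *second order condition* with parameter $\rho\le 0$ and function $A$ means: $A$ is (measurable and) regularly varying at infinity with index $\rho$, eventually positive or eventually negative, $A(t)\to0$ as $t\to\infty$, and $$\lim_{t\to\infty}\frac{\frac{U(tx)-U(t)}{a(t)}-\frac{x^\gamma-1}{\gamma}}{A(t)}=\Psi_{\gamma,\rho}(x):=\int_1^x s^{\gamma-1}\int_1^s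 u^{\rho-1}\,du\,ds,\qquad x>0.$$ Let $H_\gamma$ be the Generalized Pareto distribution on $[0,\infty)$, with $H_\gamma(x)=1-(1+\gamma x)^{-1/\gamma}$ for $x\ge0$, $1+\gamma x>0$ ($H_0(x)=1-e^{-x}$). Let $p\in[1,1/\gamma_+)$ (with $1/0=\infty$). For probability measures on $[0,\infty)$, $W_p(P,Q)=\inf\|X-Y\|_{L^p}$ over couplings $X\sim P$, $Y\sim Q$; for laws $\mathcal P,\mathcal Q$ of random probability measures on $[0,\infty)$, $W^{(2)}_p(\mathcal P,\mathcal Q)=\inf\|W_p(\Pi_1,\Pi_2)\|_{L^p}$ over couplings $\Pi_1\sim\mathcal P$, $\Pi_2\sim\mathcal Q$. Put, for $t>1$, $$A_p'(t)=\Big(\int_1^\infty\Big|\frac{U(zt)-U(t)}{a(t)}-\frac{z^\gamma-1}{\gamma}\Big|^p\frac{dz}{z^2}\Big)^{1/p},\qquad c_p'(\gamma,\rho)=\Big(\int_1^\infty\Psi_{\gamma,\rho}(x)^p\,\frac{dx}{x^2}\Big)^{1/p}.$$ Let $Z,Z_1,Z_2,\dots$ be i.i.d. standard unit Pareto variables,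 $X=U(Z)$, $X_i=U(Z_i)$ (so the $X_i$ are i.i.d. with distribution $F$), with order statistics $Z_{1,n}\le\dots\le Z_{n,n}$ and $X_{1,n}\le\dots\le X_{n,n}$. For $1\le k<n$ let $$\Pi_{n,k}=\frac1k\sum_{i=1}^k\varepsilon_{(X_{n+1-i,n}-X_{n-k,n})/a(Z_{n-k,n})},\qquad \Pi_k^*=\frac1k\sum_{i=1}^k\varepsilon_{X_i^*},$$ where $\varepsilon_x$ is the Dirac mass at $x$ and $X_1^*,X_2^*,\dots$ are i.i.d. with distribution $H_\gamma$. (If $F$ is continuous, $a(Z_{n-k,n})=f(X_{n-k,n})$ almost surely with $f(u)=a(1/(1-F(u)))$.) An intermediate sequence is a sequence of positive integers $k=k(n)$ with $k(n)\to\infty$ and $k(n)/n\to0$. **Theorem.** i) In the Wasserstein space $\mathcal W_p([0,\infty))$ (all laws involved have finite $p$-th moment), $$W_p\big(P_{(X-U(t))/a(t)\mid Z>t},H_\gamma\big)=A_p'(t)<\infty\ \ (t>1),\qquad A_p'(t)\to0\ \ (t\to\infty).$$ Under the second order condition, $0<c'_p(\gamma,\rho)<\infty$ and $A_p'(t)\sim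 c_p'(\gamma,\rho)\,|A(t)|$ as $t\to\infty$. ii) For all $1\le k<n$, in the second order Wasserstein space $\mathcal W_p(\mathcal W_p([0,\infty)))$, $$W_p^{(2)}\big(P_{\Pi_{n,k}\mid Z_{n-k,n}=t},P_{\Pi_k^*}\big)=A_p'(t);$$ more precisely, there is a regular version of the conditional law of $\Pi_{n,k}$ given $Z_{n-k,n}$ for which this holds for every $t>1$, and for any version it holds for almost every $t$ with respect to the law of $Z_{n-k,n}$. If $k=k(n)$ is an intermediate sequence and the second order condition holds, then, for any versions of the conditional laws, $$W_p^{(2)}\big(P_{\Pi_{n,k}\mid Z_{n-k,n}},P_{\Pi_k^*}\big)=c_p'(\gamma,\rho)\,|A(n/k)|\,(1+o_P(1)),\qquad n\to\infty.$$ -/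

import Mathlib

open MeasureTheory ProbabilityTheory Filter Set Topology
open scoped ENNReal

namespace PoT

noncomputable section

/-! ### Wasserstein distances -/

/-- Minimal `L^p` norm of a cost `c (s₁, s₂)` over all couplings of `P` and `Q`, a coupling being
given by its joint law `π` on the product space. -/
def minCouplingCost {S : Type*} [MeasurableSpace S] (c : S → S → ℝ≥0∞) (p : ℝ)
    (P Q : Measure S) : ℝ≥0∞ :=
  ⨅ (π : Measure (S × S)) (_ : π.map Prod.fst = P ∧ π.map Prod.snd = Q),
    (∫⁻ s, c s.1 s.2 ^ p ∂π) ^ (1 / p)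

/-- Wasserstein distance of order `p` between probability measures on the real line. Measures
carried by `[0, ∞)` have the same distance in `[0, ∞)` and in `ℝ`, since all their couplings are
carried by `[0, ∞) × [0, ∞)`. -/
def wasserstein (p : ℝ) (P Q : Measure ℝ) : ℝ≥0∞ :=
  minCouplingCost (fun x y : ℝ => edist x y) p P Q

/-- Second order Wasserstein distance of order `p` between laws of random measures on the real
line: the minimal `L^p` norm of the random distance `W_p (Π₁, Π₂)`. The space of measures
carries the `σ`-algebra generated by the evaluations `m ↦ m B`; on the Wasserstein space of
order `p` it induces the Borel `σ`-algebra of `W_p`. -/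
def wasserstein₂ (p : ℝ) (P Q : Measure (Measure ℝ)) : ℝ≥0∞ :=
  minCouplingCost (fun m₁ m₂ : Measure ℝ => wasserstein p m₁ m₂) p P Q

/-- `P` is a point of the Wasserstein space of order `p` over `[0, ∞)`. -/
structure MemWasserstein (p : ℝ) (P : Measure ℝ) : Prop where
  isProbability : IsProbabilityMeasure P
  nonneg : P (Iio 0) = 0
  moment : ∫⁻ x, ‖x‖ₑ ^ p ∂P < ∞

/-- `P` is a point of the second order Wasserstein space of order `p` over `[0, ∞)`. -/
structure MemWasserstein₂ (p : ℝ) (P : Measure (Measure ℝ)) : Prop where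
  isProbability : IsProbabilityMeasure P
  ae_mem : ∀ᵐ m ∂P, MemWasserstein p m
  moment : ∫⁻ m, ∫⁻ x, ‖x‖ₑ ^ p ∂m ∂P < ∞

/-! ### Extreme value theory -/

/-- The generalized inverse `F^←` of a distribution function `F`. -/
def quantile (F : ℝ → ℝ) (u : ℝ) : ℝ := sInf {x | u ≤ F x}

/-- The tail quantile function `U t = F^← (1 - 1 / t)`, `t > 1`, of the distribution `μ`. -/
def tailQuantile (μ : Measure ℝ) (t : ℝ) : ℝ := quantile (cdf μ) (1 - 1 / t)

/-- `(x ^ γ - 1) / γ`, read as `log x` if `γ = 0`. -/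
def boxCox (γ x : ℝ) : ℝ := if γ = 0 then Real.log x else (x ^ γ - 1) / γ

/-- The distribution function of the extreme value distribution `G_γ`. -/
def gevCDF (γ x : ℝ) : ℝ :=
  if γ = 0 then Real.exp (-Real.exp (-x))
  else if 0 < 1 + γ * x then Real.exp (-(1 + γ * x) ^ (-1 / γ))
  else if 0 < γ then 0 else 1

/-- `μ` belongs to the max-domain of attraction `D(G_γ)`. As `G_γ` is continuous, convergence in
distribution is convergence of the distribution functions at every point. -/
def InMaxDomain (μ : Measure ℝ) (γ : ℝ) : Prop :=
  ∃ a b : ℕ → ℝ, (∀ n, 0 < a n) ∧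
    ∀ x, Tendsto (fun n : ℕ => cdf μ (a n * x + b n) ^ n) atTop (𝓝 (gevCDF γ x))

/-- First order condition on the tail quantile function `U`, with normalizing function `a`. -/
def FirstOrder (U a : ℝ → ℝ) (γ : ℝ) : Prop :=
  ∀ x, 0 < x → Tendsto (fun t => (U (t * x) - U t) / a t) atTop (𝓝 (boxCox γ x))

/-- `A` is regularly varying at infinity with index `ρ`, eventually positive or eventually
negative. -/
structure RegularlyVarying (A : ℝ → ℝ) (ρ : ℝ) : Prop where
  measurable : Measurable A
  sign : (∀ᶠ t in atTop, 0 < A t) ∨ (∀ᶠ t in atTop, A t < 0)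
  tendsto : ∀ x, 0 < x → Tendsto (fun t => A (t * x) / A t) atTop (𝓝 (x ^ ρ))

/-- `Ψ_{γ,ρ} (x) = ∫_1^x s^(γ-1) ∫_1^s u^(ρ-1) du ds`. -/
def psi (γ ρ x : ℝ) : ℝ :=
  ∫ s in (1 : ℝ)..x, s ^ (γ - 1) * ∫ u in (1 : ℝ)..s, u ^ (ρ - 1)

/-- Second order condition with normalizing functions `a`, `A` and second order
parameter `ρ ≤ 0`. -/
structure SecondOrder (U a A : ℝ → ℝ) (γ ρ : ℝ) : Prop where
  nonpos : ρ ≤ 0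
  regularlyVarying : RegularlyVarying A ρ
  tendsto_zero : Tendsto A atTop (𝓝 0)
  tendsto : ∀ x, 0 < x →
    Tendsto (fun t => ((U (t * x) - U t) / a t - boxCox γ x) / A t) atTop (𝓝 (psi γ ρ x))

/-- `A'_p (t) = (∫_1^∞ |(U (z t) - U t) / a t - (z^γ - 1) / γ|^p dz / z^2)^(1/p)`. -/
def APrime (U a : ℝ → ℝ) (γ p t : ℝ) : ℝ≥0∞ :=
  (∫⁻ z in Ioi (1 : ℝ),
    ENNReal.ofReal (|(U (z * t) - U t) / a t - boxCox γ z| ^ p / z ^ 2)) ^ (1 / p)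

/-- `c'_p (γ, ρ) = (∫_1^∞ Ψ_{γ,ρ}(x)^p x^(-2) dx)^(1/p)`. -/
def cPrime (γ ρ p : ℝ) : ℝ :=
  (∫ x in Ioi (1 : ℝ), psi γ ρ x ^ p / x ^ 2) ^ (1 / p)

/-! ### The Generalized Pareto distribution -/

/-- The distribution function of the Generalized Pareto distribution `H_γ`:
`1 - (1 + γ x)^(-1/γ)` for `x ≥ 0` and `1 + γ x > 0` (and `1 - exp (-x)` if `γ = 0`); it is `0` to
the left and `1` to the right of this interval. -/
def gpdCDF (γ x : ℝ) : ℝ :=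
  if x < 0 then 0
  else if γ = 0 then 1 - Real.exp (-x)
  else 1 - (max (1 + γ * x) 0) ^ (-1 / γ)

/-- The survival function of `H_γ` at `x ≥ 0`. -/
def gpdTail (γ x : ℝ) : ℝ :=
  if γ = 0 then Real.exp (-x) else (max (1 + γ * x) 0) ^ (-1 / γ)

theorem gpdCDF_eq (γ : ℝ) : gpdCDF γ = fun x => 1 - gpdTail γ (max x 0) := by
  funext x
  unfold gpdCDF gpdTail
  by_cases hx : x < 0
  · rw [if_pos hx, max_eq_right hx.le]
    simp
  · rw [if_neg hx, max_eq_left (not_lt.mp hx)]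
    split_ifs <;> rfl

theorem gpdTail_antitoneOn (γ : ℝ) : AntitoneOn (gpdTail γ) (Ici 0) := by
  intro x hx y hy hxy
  simp only [mem_Ici] at hx hy
  unfold gpdTail
  by_cases h0 : γ = 0
  · simp only [if_pos h0]
    exact Real.exp_le_exp.mpr (neg_le_neg hxy)
  simp only [if_neg h0]
  rcases lt_or_gt_of_ne h0 with hneg | hpos
  · apply Real.rpow_le_rpow (le_max_right _ _)
    · exact max_le_max (by nlinarith) le_rfl
    · exact (div_pos_of_neg_of_neg (by norm_num) hneg).le
  · have h1 : 0 < 1 + γ * x := by positivity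
    have h2 : 0 < 1 + γ * y := by positivity
    rw [max_eq_left h1.le, max_eq_left h2.le]
    apply Real.rpow_le_rpow_of_nonpos h1
    · nlinarith
    · exact (div_neg_of_neg_of_pos (by norm_num) hpos).le

theorem gpdTail_continuousOn (γ : ℝ) : ContinuousOn (gpdTail γ) (Ici 0) := by
  unfold gpdTail
  by_cases h0 : γ = 0
  · simp only [if_pos h0]
    fun_prop
  simp only [if_neg h0]
  intro x hx
  simp only [mem_Ici] at hx
  refine ContinuousWithinAt.rpow_const (by fun_prop) ?_
  rcases lt_or_gt_of_ne h0 with hneg | hpos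
  · exact Or.inr (div_pos_of_neg_of_neg (by norm_num) hneg).le
  · left
    have h1 : 0 < 1 + γ * x := by positivity
    rw [max_eq_left h1.le]
    exact h1.ne'

theorem gpdCDF_monotone (γ : ℝ) : Monotone (gpdCDF γ) := by
  rw [gpdCDF_eq]
  intro x y hxy
  exact sub_le_sub_left (gpdTail_antitoneOn γ (le_max_right x 0) (le_max_right y 0)
    (max_le_max hxy le_rfl)) 1

theorem gpdCDF_continuous (γ : ℝ) : Continuous (gpdCDF γ) := by
  rw [gpdCDF_eq]
  exact continuous_const.sub ((gpdTail_continuousOn γ).comp_continuous (by fun_prop)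
    (fun x => le_max_right x 0))

theorem gpdCDF_tendsto_atBot (γ : ℝ) : Tendsto (gpdCDF γ) atBot (𝓝 0) := by
  refine tendsto_const_nhds.congr' ?_
  filter_upwards [eventually_lt_atBot (0 : ℝ)] with x hx
  simp [gpdCDF, hx]

theorem gpdCDF_tendsto_atTop (γ : ℝ) : Tendsto (gpdCDF γ) atTop (𝓝 1) := by
  have key : Tendsto (gpdTail γ) atTop (𝓝 0) := by
    unfold gpdTail
    by_cases h0 : γ = 0
    · simp only [if_pos h0]
      exact Real.tendsto_exp_neg_atTop_nhds_zero
    simp only [if_neg h0]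
    rcases lt_or_gt_of_ne h0 with hneg | hpos
    · refine tendsto_const_nhds.congr' ?_
      filter_upwards [eventually_ge_atTop (-1 / γ)] with x hx
      have h1 : 1 + γ * x ≤ 0 := by
        have h2 := mul_le_mul_of_nonpos_left hx hneg.le
        have h3 : γ * (-1 / γ) = -1 := by field_simp
        linarith
      rw [max_eq_right h1, Real.zero_rpow]
      exact (div_pos_of_neg_of_neg (by norm_num) hneg).ne'
    · have h1 : Tendsto (fun x : ℝ => max (1 + γ * x) 0) atTop atTop := by
        refine tendsto_atTop_mono (fun x => le_max_left _ _) ?_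
        exact tendsto_atTop_add_const_left _ _ (tendsto_id.const_mul_atTop hpos)
      have h2 := (tendsto_rpow_neg_atTop (y := 1 / γ) (by positivity)).comp h1
      refine h2.congr (fun _ => ?_)
      simp [neg_div]
  have h : Tendsto (fun x => 1 - gpdTail γ x) atTop (𝓝 (1 - 0)) := key.const_sub 1
  rw [sub_zero] at h
  refine h.congr' ?_
  filter_upwards [eventually_ge_atTop (0 : ℝ)] with x hx
  rw [gpdCDF_eq]
  simp [max_eq_left hx]

/-- The Generalized Pareto distribution `H_γ`. -/
def gpd (γ : ℝ) : Measure ℝ :=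
  StieltjesFunction.measure
    { toFun := gpdCDF γ
      mono' := gpdCDF_monotone γ
      right_continuous' := fun _ => (gpdCDF_continuous γ).continuousWithinAt }

instance (γ : ℝ) : IsProbabilityMeasure (gpd γ) :=
  StieltjesFunction.isProbabilityMeasure _ (gpdCDF_tendsto_atBot γ) (gpdCDF_tendsto_atTop γ)

theorem cdf_gpd (γ x : ℝ) : cdf (gpd γ) x = gpdCDF γ x := by
  unfold gpd
  rw [cdf_measure_stieltjesFunction _ (gpdCDF_tendsto_atBot γ) (gpdCDF_tendsto_atTop γ)]

/-! ### Samples, order statistics and empirical measures -/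

/-- The order statistic `v_{j,n}`, `1 ≤ j ≤ n`: the `j`-th smallest among the first `n` terms
of `v`. -/
def orderStat (n : ℕ) (v : ℕ → ℝ) (j : ℕ) : ℝ :=
  if h : 1 ≤ j ∧ j ≤ n then
    v (Tuple.sort (fun i : Fin n => v i) ⟨j - 1, by omega⟩)
  else 0

/-- The empirical measure of `x 1, …, x k`. -/
def empiricalMeasure (k : ℕ) (x : ℕ → ℝ) : Measure ℝ :=
  (k : ℝ≥0∞)⁻¹ • ∑ i ∈ Finset.Icc 1 k, Measure.dirac (x i)

/-- The empirical measure `Π_{n,k}` of the `k` normalized exceedances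
`(X_{n+1-i,n} - X_{n-k,n}) / a (Z_{n-k,n})`, where the observations are `X = U (Z)` and `z` is the
realization of the sample of the `Z`'s. -/
def exceedanceMeasure (U a : ℝ → ℝ) (n k : ℕ) (z : ℕ → ℝ) : Measure ℝ :=
  empiricalMeasure k fun i =>
    (orderStat n (fun j => U (z j)) (n + 1 - i) - orderStat n (fun j => U (z j)) (n - k))
      / a (orderStat n z (n - k))

/-- For continuous `F`, the scale `a t` at the threshold `u = U t` is `f u`, with
`f u = a (1 / (1 - F u))`. -/
theorem scale_eq (μ : Measure ℝ) (a : ℝ → ℝ) (hF : Continuous (cdf μ)) {t : ℝ} (ht : 1 < t) :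
    a (1 / (1 - cdf μ (tailQuantile μ t))) = a t := by
  have h0 : 0 < 1 - 1 / t := by
    rw [sub_pos, div_lt_one (by linarith)]; exact ht
  have h1 : 1 - 1 / t < 1 := by
    have : 0 < 1 / t := by positivity
    linarith
  have hne : {x | 1 - 1 / t ≤ cdf μ x}.Nonempty := by
    obtain ⟨x, hx⟩ := ((tendsto_cdf_atTop μ).eventually (lt_mem_nhds h1)).exists
    exact ⟨x, le_of_lt hx⟩
  obtain ⟨b, hb⟩ := ((tendsto_cdf_atBot μ).eventually (gt_mem_nhds h0)).exists
  have hbdd : BddBelow {x | 1 - 1 / t ≤ cdf μ x} :=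
    ⟨b, fun x hx => le_of_lt ((monotone_cdf μ).reflect_lt (lt_of_lt_of_le hb hx))⟩
  have hmem : 1 - 1 / t ≤ cdf μ (tailQuantile μ t) :=
    (isClosed_le continuous_const hF).csInf_mem hne hbdd
  have hle : cdf μ (tailQuantile μ t) ≤ 1 - 1 / t := by
    have hlim : Tendsto (cdf μ) (𝓝[<] (tailQuantile μ t)) (𝓝 (cdf μ (tailQuantile μ t))) :=
      hF.continuousAt.tendsto.mono_left nhdsWithin_le_nhds
    refine le_of_tendsto hlim ?_
    filter_upwards [self_mem_nhdsWithin] with x hx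
    by_contra hcon
    exact absurd (csInf_le hbdd (le_of_lt (not_le.mp hcon))) (not_le.mpr hx)
  have : cdf μ (tailQuantile μ t) = 1 - 1 / t := le_antisymm hle hmem
  rw [this]
  simp

/-- `κ` is a regular version of the conditional law of `Y` given the real random variable `T`:
`κ t` is the law of `Y` given `T = t`. -/
structure IsCondLaw {Ω E : Type*} [MeasurableSpace Ω] [MeasurableSpace E] (P : Measure Ω)
    (T : Ω → ℝ) (Y : Ω → E) (κ : Kernel ℝ E) : Prop where
  isMarkov : IsMarkovKernel κ
  map_eq : P.map (fun ω => (T ω, Y ω)) = P.map T ⊗ₘ κ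

end

end PoT

open PoT

namespace PoT

/-! ### Optimality of the monotone coupling on the line -/

/-- The measure `ν` on `[0, ∞)` for which `|d| ^ p = ∫ (|d| - c)⁺ dν(c)`. -/
noncomputable def powMix (p : ℝ) : Measure ℝ :=
  if p = 1 then Measure.dirac 0
  else (volume.restrict (Ioi 0)).withDensity fun c => ENNReal.ofReal (p * (p - 1) * c ^ (p - 2))

instance (p : ℝ) : SFinite (powMix p) := by
  unfold powMix
  split_ifs <;> infer_instance

theorem ae_powMix_nonneg (p : ℝ) : ∀ᵐ c ∂powMix p, 0 ≤ c := by
  unfold powMix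
  split_ifs
  · simp
  · refine (withDensity_absolutelyContinuous _ _).ae_le ?_
    filter_upwards [ae_restrict_mem measurableSet_Ioi] with c hc using le_of_lt hc

theorem integral_powMix_density {p d : ℝ} (hp : 1 < p) (hd : 0 ≤ d) :
    ∫ c in (0 : ℝ)..d, p * (p - 1) * c ^ (p - 2) * (d - c) = d ^ p := by
  have h1 : ∀ c ∈ uIcc 0 d, p * (p - 1) * c ^ (p - 2) * (d - c)
      = p * (p - 1) * d * c ^ (p - 2) - p * (p - 1) * c ^ (p - 1) := by
    intro c hc
    rw [uIcc_of_le hd] at hc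
    rcases eq_or_lt_of_le hc.1 with h | h
    · rw [← h, Real.zero_rpow (by linarith : p - 1 ≠ 0)]
      ring
    · have : c ^ (p - 1) = c ^ (p - 2) * c := by
        rw [← Real.rpow_add_one h.ne']; congr 1; ring
      rw [this]; ring
  rw [intervalIntegral.integral_congr h1, intervalIntegral.integral_sub,
    intervalIntegral.integral_const_mul, intervalIntegral.integral_const_mul,
    integral_rpow (Or.inl (by linarith)), integral_rpow (Or.inl (by linarith))]
  · have e1 : p - 2 + 1 = p - 1 := by ring
    have e2 : p - 1 + 1 = p := by ring
    rw [e1, e2, Real.zero_rpow (by linarith), Real.zero_rpow (by linarith)]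
    have h3 : p - 1 ≠ 0 := by linarith
    have h4 : p ≠ 0 := by linarith
    rcases eq_or_lt_of_le hd with h | h
    · rw [← h, Real.zero_rpow h3, Real.zero_rpow h4]; simp
    · have : d ^ p = d ^ (p - 1) * d := by
        rw [← Real.rpow_add_one h.ne']; congr 1; ring
      rw [this]; field_simp; ring
  · exact (intervalIntegral.intervalIntegrable_rpow' (by linarith)).const_mul _
  · exact (intervalIntegral.intervalIntegrable_rpow' (by linarith)).const_mul _

theorem lintegral_powMix {p d : ℝ} (hp : 1 ≤ p) (hd : 0 ≤ d) :
    ∫⁻ c, ENNReal.ofReal (d - c) ∂powMix p = ENNReal.ofReal d ^ p := by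
  unfold powMix
  split_ifs with h1
  · subst h1
    rw [lintegral_dirac' _ (by fun_prop)]
    simp
  · have hp1 : 1 < p := lt_of_le_of_ne hp (Ne.symm h1)
    have hm : Measurable fun c : ℝ => c ^ (p - 2) := by fun_prop
    rw [lintegral_withDensity_eq_lintegral_mul _ (by fun_prop) (by fun_prop),
      ENNReal.ofReal_rpow_of_nonneg hd (by linarith), ← integral_powMix_density hp1 hd,
      intervalIntegral.integral_of_le hd, ofReal_integral_eq_lintegral_ofReal]
    · have hs : Ioi (0 : ℝ) = Ioc 0 d ∪ Ioi d := (Ioc_union_Ioi_eq_Ioi hd).symm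
      rw [hs, lintegral_union measurableSet_Ioi]
      · have hz : ∫⁻ c in Ioi d, ((fun c => ENNReal.ofReal (p * (p - 1) * c ^ (p - 2))) *
            fun c => ENNReal.ofReal (d - c)) c = 0 := by
          rw [setLIntegral_congr_fun (g := fun _ => 0) measurableSet_Ioi, lintegral_zero]
          intro c hc
          simp only [Pi.mul_apply]
          rw [ENNReal.ofReal_of_nonpos (sub_nonpos.mpr (le_of_lt hc)), mul_zero]
        rw [hz, add_zero]
        refine setLIntegral_congr_fun measurableSet_Ioc fun c hc => ?_
        simp only [Pi.mul_apply]
        rw [← ENNReal.ofReal_mul]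
        exact mul_nonneg (mul_nonneg (by linarith) (by linarith)) (Real.rpow_nonneg hc.1.le _)
      · rw [Set.disjoint_left]
        intro c h1 h2
        exact absurd h1.2 (not_le.mpr h2)
    · have h2 : IntervalIntegrable (fun c : ℝ => p * (p - 1) * c ^ (p - 2) * (d - c)) volume 0 d :=
        ((intervalIntegral.intervalIntegrable_rpow' (by linarith)).const_mul _).mul_continuousOn
          (by fun_prop)
      exact (intervalIntegrable_iff_integrableOn_Ioc_of_le hd).mp h2
    · filter_upwards [ae_restrict_mem measurableSet_Ioc] with c hc
      have := Real.rpow_nonneg hc.1.le (p - 2)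
      have h3 : 0 ≤ p - 1 := by linarith
      have h4 : 0 ≤ d - c := by linarith [hc.2]
      simp only [Pi.zero_apply]
      positivity

/-- The set of `(c, s)` with `y ≤ s - c` and `s < x`. -/
def gapSet (x y : ℝ) : Set (ℝ × ℝ) := {z | y ≤ z.2 - z.1 ∧ z.2 < x}

theorem measurableSet_gapSet (x y : ℝ) : MeasurableSet (gapSet x y) := by
  have h1 : MeasurableSet {z : ℝ × ℝ | y ≤ z.2 - z.1} := measurableSet_le (by fun_prop) (by fun_prop)
  have h2 : MeasurableSet {z : ℝ × ℝ | z.2 < x} := measurableSet_lt (by fun_prop) (by fun_prop)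
  exact h1.inter h2

theorem prod_gapSet (p x y : ℝ) : ((powMix p).prod volume) (gapSet x y)
    = ∫⁻ c, ENNReal.ofReal (x - y - c) ∂powMix p := by
  rw [Measure.prod_apply (measurableSet_gapSet x y)]
  refine lintegral_congr fun c => ?_
  have : Prod.mk c ⁻¹' gapSet x y = Ico (y + c) x := by
    ext s
    simp only [gapSet, mem_preimage, mem_ofPred_eq, mem_Ico]
    constructor
    · rintro ⟨h1, h2⟩; exact ⟨by linarith, h2⟩
    · rintro ⟨h1, h2⟩; exact ⟨by linarith, h2⟩
  rw [this, Real.volume_Ico]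
  congr 1; ring

theorem edist_rpow_eq {p : ℝ} (hp : 1 ≤ p) (x y : ℝ) :
    edist x y ^ p = ((powMix p).prod volume) (gapSet x y)
      + ((powMix p).prod volume) (gapSet y x) := by
  rw [prod_gapSet, prod_gapSet, ← lintegral_add_left (by fun_prop), edist_dist,
    Real.dist_eq, ← lintegral_powMix hp (abs_nonneg _)]
  refine lintegral_congr_ae ?_
  filter_upwards [ae_powMix_nonneg p] with c hc
  rcases le_total x y with h | h
  · rw [abs_of_nonpos (by linarith), ENNReal.ofReal_of_nonpos (by linarith : x - y - c ≤ 0),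
      zero_add]
    congr 1; ring
  · rw [abs_of_nonneg (by linarith), ENNReal.ofReal_of_nonpos (by linarith : y - x - c ≤ 0),
      add_zero]

theorem lintegral_edist_rpow {Ω : Type*} [MeasurableSpace Ω] (π : Measure Ω) [SFinite π]
    {X Y : Ω → ℝ} (hX : Measurable X) (hY : Measurable Y) {p : ℝ} (hp : 1 ≤ p) :
    ∫⁻ ω, edist (X ω) (Y ω) ^ p ∂π
      = ∫⁻ z, π ({ω | Y ω ≤ z.2 - z.1} \ {ω | X ω ≤ z.2})
          + π ({ω | X ω ≤ z.2 - z.1} \ {ω | Y ω ≤ z.2}) ∂((powMix p).prod volume) := by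
  have key : ∀ {X Y : Ω → ℝ}, Measurable X → Measurable Y →
      MeasurableSet {q : Ω × ℝ × ℝ | Y q.1 ≤ q.2.2 - q.2.1 ∧ q.2.2 < X q.1} := by
    intro X Y hX hY
    have h1 : MeasurableSet {q : Ω × ℝ × ℝ | Y q.1 ≤ q.2.2 - q.2.1} :=
      measurableSet_le (by fun_prop) (by fun_prop)
    have h2 : MeasurableSet {q : Ω × ℝ × ℝ | q.2.2 < X q.1} :=
      measurableSet_lt (by fun_prop) (by fun_prop)
    exact h1.inter h2
  have swap : ∀ {X Y : Ω → ℝ}, Measurable X → Measurable Y →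
      ∫⁻ ω, ((powMix p).prod volume) (gapSet (X ω) (Y ω)) ∂π
        = ∫⁻ z, π ({ω | Y ω ≤ z.2 - z.1} \ {ω | X ω ≤ z.2}) ∂((powMix p).prod volume) := by
    intro X Y hX hY
    have h1 := Measure.prod_apply (μ := π) (ν := (powMix p).prod volume) (key hX hY)
    have h2 := Measure.prod_apply_symm (μ := π) (ν := (powMix p).prod volume) (key hX hY)
    refine h1.symm.trans (h2.trans (lintegral_congr fun z => congrArg π ?_))
    ext ω
    simp
  have hd : ∀ z : ℝ × ℝ, π ({ω | Y ω ≤ z.2 - z.1} \ {ω | X ω ≤ z.2})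
      = π ((fun ω => (ω, z)) ⁻¹' {q : Ω × ℝ × ℝ | Y q.1 ≤ q.2.2 - q.2.1 ∧ q.2.2 < X q.1}) := by
    intro z
    congr 1
    ext ω
    simp
  simp_rw [edist_rpow_eq hp]
  rw [lintegral_add_left, lintegral_add_left, swap hX hY, swap hY hX]
  · simp_rw [hd]
    exact measurable_measure_prodMk_right (key hX hY)
  · exact measurable_measure_prodMk_left (key hX hY)

/-- The minimal value of `E |X - Y| ^ p`, written in terms of the distribution functions of
the two marginals. -/
noncomputable def cdfGap (p : ℝ) (m₁ m₂ : Measure ℝ) : ℝ≥0∞ :=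
  ∫⁻ z, (m₂ (Iic (z.2 - z.1)) - m₁ (Iic z.2)) + (m₁ (Iic (z.2 - z.1)) - m₂ (Iic z.2))
    ∂((powMix p).prod volume)

theorem cdfGap_le_lintegral {Ω : Type*} [MeasurableSpace Ω] (π : Measure Ω) [SFinite π]
    {X Y : Ω → ℝ} (hX : Measurable X) (hY : Measurable Y) {p : ℝ} (hp : 1 ≤ p) :
    cdfGap p (π.map X) (π.map Y) ≤ ∫⁻ ω, edist (X ω) (Y ω) ^ p ∂π := by
  rw [lintegral_edist_rpow π hX hY hp]
  refine lintegral_mono fun z => ?_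
  rw [Measure.map_apply hX measurableSet_Iic, Measure.map_apply hY measurableSet_Iic,
    Measure.map_apply hX measurableSet_Iic, Measure.map_apply hY measurableSet_Iic]
  exact add_le_add le_measure_sdiff le_measure_sdiff

theorem measure_diff_eq_tsub_of_lowerSets (ρ : Measure ℝ) [IsFiniteMeasure ρ] {f g : ℝ → ℝ}
    (hf : Monotone f) (hg : Monotone g) (u v : ℝ) :
    ρ ({ω | g ω ≤ u} \ {ω | f ω ≤ v}) = ρ {ω | g ω ≤ u} - ρ {ω | f ω ≤ v} := by
  have hmf : MeasurableSet {ω | f ω ≤ v} := measurableSet_le hf.measurable measurable_const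
  have h : {ω | g ω ≤ u} ⊆ {ω | f ω ≤ v} ∨ {ω | f ω ≤ v} ⊆ {ω | g ω ≤ u} := by
    by_contra! hcon
    obtain ⟨a, ha, ha'⟩ := Set.not_subset.mp hcon.1
    obtain ⟨b, hb, hb'⟩ := Set.not_subset.mp hcon.2
    simp only [mem_ofPred_eq, not_le] at ha ha' hb hb'
    rcases le_total a b with hab | hab
    · exact absurd (hf hab) (by linarith)
    · exact absurd (hg hab) (by linarith)
  rcases h with h | h
  · rw [sdiff_eq_empty.mpr h, measure_empty, tsub_eq_zero_of_le (measure_mono h)]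
  · exact measure_sdiff h hmf.nullMeasurableSet (measure_ne_top _ _)

theorem lintegral_edist_monotone (ρ : Measure ℝ) [IsFiniteMeasure ρ] {f g : ℝ → ℝ}
    (hf : Monotone f) (hg : Monotone g) {p : ℝ} (hp : 1 ≤ p) :
    ∫⁻ ω, edist (f ω) (g ω) ^ p ∂ρ = cdfGap p (ρ.map f) (ρ.map g) := by
  rw [lintegral_edist_rpow ρ hf.measurable hg.measurable hp, cdfGap]
  refine lintegral_congr fun z => ?_
  rw [Measure.map_apply hf.measurable measurableSet_Iic,
    Measure.map_apply hg.measurable measurableSet_Iic,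
    Measure.map_apply hf.measurable measurableSet_Iic,
    Measure.map_apply hg.measurable measurableSet_Iic, measure_diff_eq_tsub_of_lowerSets ρ hf hg,
    measure_diff_eq_tsub_of_lowerSets ρ hg hf]
  rfl

theorem cdfGap_le_wasserstein {p : ℝ} (hp : 1 ≤ p) (m₁ m₂ : Measure ℝ) [IsFiniteMeasure m₁] :
    cdfGap p m₁ m₂ ≤ wasserstein p m₁ m₂ ^ p := by
  have hp0 : 0 < p := by linarith
  rw [← ENNReal.rpow_inv_le_iff hp0]
  unfold wasserstein minCouplingCost
  refine le_iInf₂ fun π hπ => ?_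
  have : IsFiniteMeasure π := by
    constructor
    rw [← preimage_univ (f := Prod.fst), ← Measure.map_apply measurable_fst .univ, hπ.1]
    exact measure_lt_top _ _
  rw [← one_div]
  refine ENNReal.rpow_le_rpow ?_ (by positivity)
  have := cdfGap_le_lintegral π measurable_fst measurable_snd hp
  rwa [hπ.1, hπ.2] at this

theorem wasserstein_map_monotone (ρ : Measure ℝ) [IsFiniteMeasure ρ] {f g : ℝ → ℝ}
    (hf : Monotone f) (hg : Monotone g) {p : ℝ} (hp : 1 ≤ p) :
    wasserstein p (ρ.map f) (ρ.map g) = (∫⁻ ω, edist (f ω) (g ω) ^ p ∂ρ) ^ (1 / p) := by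
  have hp0 : 0 < p := by linarith
  apply le_antisymm
  · unfold wasserstein minCouplingCost
    refine iInf₂_le_of_le (ρ.map fun ω => (f ω, g ω)) ⟨?_, ?_⟩ ?_
    · exact Measure.map_map measurable_fst (hf.measurable.prodMk hg.measurable)
    · exact Measure.map_map measurable_snd (hf.measurable.prodMk hg.measurable)
    · exact ENNReal.rpow_le_rpow (lintegral_map_le _ _) (by positivity)
  · rw [lintegral_edist_monotone ρ hf hg hp, one_div, ENNReal.rpow_inv_le_iff hp0]
    exact cdfGap_le_wasserstein hp _ _

/-! ### Empirical measures and the second order distance -/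

/-- The identity kernel on measures of mass at most one. -/
noncomputable def subprobKernel : Kernel (Measure ℝ) ℝ :=
  Kernel.piecewise (s := {m : Measure ℝ | m univ ≤ 1})
    (measurableSet_le (Measure.measurable_coe .univ) measurable_const)
    ⟨fun m => m, measurable_id⟩ 0

theorem subprobKernel_apply {m : Measure ℝ} (h : m univ ≤ 1) : subprobKernel m = m := by
  unfold subprobKernel
  rw [Kernel.piecewise_apply, if_pos (by exact h)]
  rfl

instance : IsFiniteKernel subprobKernel := by
  refine ⟨1, ENNReal.one_lt_top, fun m => ?_⟩
  unfold subprobKernel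
  rw [Kernel.piecewise_apply]
  split_ifs with h
  · exact h
  · simp

theorem measurable_subprobKernel_Iic :
    Measurable fun q : Measure ℝ × ℝ => subprobKernel q.1 (Iic q.2) := by
  have h : MeasurableSet {r : (Measure ℝ × ℝ) × ℝ | r.2 ≤ r.1.2} :=
    measurableSet_le (by fun_prop) (by fun_prop)
  exact Kernel.measurable_kernel_prodMk_left
    (κ := subprobKernel.comap (Prod.fst : Measure ℝ × ℝ → Measure ℝ) measurable_fst) h

/-- Jensen's inequality for `cdfGap`. -/
theorem cdfGap_join_le {p : ℝ} (π : Measure (Measure ℝ × Measure ℝ)) [SFinite π]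
    (h₁ : ∀ᵐ m ∂π, m.1 univ ≤ 1) (h₂ : ∀ᵐ m ∂π, m.2 univ ≤ 1) :
    cdfGap p (π.map Prod.fst).join (π.map Prod.snd).join ≤ ∫⁻ m, cdfGap p m.1 m.2 ∂π := by
  have hsub := measurable_subprobKernel_Iic
  have e1 : ∀ s, (π.map Prod.fst).join (Iic s) = ∫⁻ m, subprobKernel m.1 (Iic s) ∂π := by
    intro s
    rw [Measure.join_apply measurableSet_Iic,
      lintegral_map (Measure.measurable_coe measurableSet_Iic) measurable_fst]
    refine lintegral_congr_ae ?_
    filter_upwards [h₁] with m hm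
    rw [subprobKernel_apply hm]
  have e2 : ∀ s, (π.map Prod.snd).join (Iic s) = ∫⁻ m, subprobKernel m.2 (Iic s) ∂π := by
    intro s
    rw [Measure.join_apply measurableSet_Iic,
      lintegral_map (Measure.measurable_coe measurableSet_Iic) measurable_snd]
    refine lintegral_congr_ae ?_
    filter_upwards [h₂] with m hm
    rw [subprobKernel_apply hm]
  have e3 : ∫⁻ m, cdfGap p m.1 m.2 ∂π
      = ∫⁻ m, cdfGap p (subprobKernel m.1) (subprobKernel m.2) ∂π := by
    refine lintegral_congr_ae ?_
    filter_upwards [h₁, h₂] with m hm1 hm2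
    rw [subprobKernel_apply hm1, subprobKernel_apply hm2]
  have m1 : ∀ {f : (Measure ℝ × Measure ℝ) × ℝ × ℝ → Measure ℝ × ℝ}, Measurable f →
      Measurable fun q => subprobKernel (f q).1 (Iic (f q).2) := fun hf => hsub.comp hf
  have n1 : Measurable fun q : (Measure ℝ × Measure ℝ) × ℝ × ℝ => subprobKernel q.1.1 (Iic q.2.2) :=
    m1 (f := fun q => (q.1.1, q.2.2)) (by fun_prop)
  have n2 : Measurable fun q : (Measure ℝ × Measure ℝ) × ℝ × ℝ => subprobKernel q.1.2 (Iic q.2.2) :=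
    m1 (f := fun q => (q.1.2, q.2.2)) (by fun_prop)
  have n3 : Measurable fun q : (Measure ℝ × Measure ℝ) × ℝ × ℝ =>
      subprobKernel q.1.1 (Iic (q.2.2 - q.2.1)) :=
    m1 (f := fun q => (q.1.1, q.2.2 - q.2.1)) (by fun_prop)
  have n4 : Measurable fun q : (Measure ℝ × Measure ℝ) × ℝ × ℝ =>
      subprobKernel q.1.2 (Iic (q.2.2 - q.2.1)) :=
    m1 (f := fun q => (q.1.2, q.2.2 - q.2.1)) (by fun_prop)
  rw [e3]
  unfold cdfGap
  rw [lintegral_lintegral_swap (((n4.sub n1).add (n3.sub n2)).aemeasurable)]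
  refine lintegral_mono fun z => ?_
  rw [e1, e1, e2, e2]
  have c : ∀ {f : (Measure ℝ × Measure ℝ) × ℝ × ℝ → ℝ≥0∞}, Measurable f →
      Measurable fun m => f (m, z) := fun hf => hf.comp (by fun_prop)
  refine le_trans ?_ (lintegral_add_left ((c n4).sub (c n1)) _).ge
  exact add_le_add (lintegral_sub_le _ _ (c n1)) (lintegral_sub_le _ _ (c n2))

/-- The empirical measure of a finite sample. -/
noncomputable def sampleMeasure (k : ℕ) (x : Fin k → ℝ) : Measure ℝ :=
  (k : ℝ≥0∞)⁻¹ • ∑ i, Measure.dirac (x i)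

/-- The law of the empirical measure of an i.i.d. sample of size `k` from `m`. -/
noncomputable def empiricalLaw (k : ℕ) (m : Measure ℝ) : Measure (Measure ℝ) :=
  (Measure.pi fun _ : Fin k => m).map (sampleMeasure k)

theorem empiricalMeasure_eq_sampleMeasure (k : ℕ) (x : ℕ → ℝ) :
    empiricalMeasure k x = sampleMeasure k fun i => x (i + 1) := by
  unfold empiricalMeasure sampleMeasure
  congr 1
  rw [Fin.sum_univ_eq_sum_range (fun i => Measure.dirac (x (i + 1))) k, Finset.range_eq_Ico,
    Finset.sum_Ico_add' (fun i => Measure.dirac (x i))]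
  rfl

theorem measurable_sampleMeasure (k : ℕ) : Measurable (sampleMeasure k) := by
  refine Measure.measurable_of_measurable_coe _ fun s hs => ?_
  simp only [sampleMeasure, Measure.smul_apply, Measure.finsetSum_apply, smul_eq_mul]
  refine Measurable.const_mul (Finset.measurable_sum _ fun i _ => ?_) _
  exact (Measure.measurable_coe hs).comp (Measure.measurable_dirac.comp (measurable_pi_apply i))

theorem lintegral_sampleMeasure (k : ℕ) (x : Fin k → ℝ) (f : ℝ → ℝ≥0∞) :
    ∫⁻ y, f y ∂sampleMeasure k x = (k : ℝ≥0∞)⁻¹ * ∑ i, f (x i) := by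
  unfold sampleMeasure
  rw [lintegral_smul_measure, lintegral_finsetSum_measure]
  simp

theorem isProbabilityMeasure_sampleMeasure {k : ℕ} (hk : 1 ≤ k) (x : Fin k → ℝ) :
    IsProbabilityMeasure (sampleMeasure k x) := by
  constructor
  have h := lintegral_sampleMeasure k x fun _ => 1
  simp only [lintegral_const, one_mul, Finset.sum_const, Finset.card_univ, Fintype.card_fin,
    nsmul_eq_mul, mul_one] at h
  rw [h, ENNReal.inv_mul_cancel (by simp; omega) (by simp)]

theorem wasserstein_sampleMeasure_le {p : ℝ} (hp : 1 ≤ p) (k : ℕ) (x y : Fin k → ℝ) :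
    wasserstein p (sampleMeasure k x) (sampleMeasure k y) ^ p
      ≤ (k : ℝ≥0∞)⁻¹ * ∑ i, edist (x i) (y i) ^ p := by
  have hp0 : 0 < p := by linarith
  rw [← ENNReal.le_rpow_inv_iff hp0]
  unfold wasserstein minCouplingCost
  refine iInf₂_le_of_le ((k : ℝ≥0∞)⁻¹ • ∑ i, Measure.dirac (x i, y i)) ⟨?_, ?_⟩ ?_
  · simp only [Measure.map_smul, sampleMeasure]
    rw [← Measure.mapₗ_apply_of_measurable measurable_fst, map_sum]
    simp [Measure.mapₗ_apply_of_measurable measurable_fst, Measure.map_dirac' measurable_fst]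
  · simp only [Measure.map_smul, sampleMeasure]
    rw [← Measure.mapₗ_apply_of_measurable measurable_snd, map_sum]
    simp [Measure.mapₗ_apply_of_measurable measurable_snd, Measure.map_dirac' measurable_snd]
  · rw [one_div, lintegral_smul_measure, lintegral_finsetSum_measure]
    simp

theorem lintegral_pi_average {k : ℕ} (hk : 1 ≤ k) (m : Measure ℝ) [IsProbabilityMeasure m]
    {f : ℝ → ℝ≥0∞} (hf : Measurable f) :
    ∫⁻ x, (k : ℝ≥0∞)⁻¹ * ∑ i, f (x i) ∂(Measure.pi fun _ : Fin k => m) = ∫⁻ y, f y ∂m := by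
  rw [lintegral_const_mul _ (by fun_prop), lintegral_finsetSum _ (by fun_prop)]
  have h : ∀ i : Fin k, ∫⁻ x, f (x i) ∂(Measure.pi fun _ : Fin k => m) = ∫⁻ y, f y ∂m :=
    fun i => (measurePreserving_eval (fun _ : Fin k => m) i).lintegral_comp hf
  simp only [h, Finset.sum_const, Finset.card_univ, Fintype.card_fin, nsmul_eq_mul]
  rw [← mul_assoc, ENNReal.inv_mul_cancel (by simp; omega) (by simp), one_mul]

theorem lintegral_lintegral_empiricalLaw {k : ℕ} (hk : 1 ≤ k) (m : Measure ℝ)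
    [IsProbabilityMeasure m] {f : ℝ → ℝ≥0∞} (hf : Measurable f) :
    ∫⁻ M, ∫⁻ x, f x ∂M ∂empiricalLaw k m = ∫⁻ y, f y ∂m := by
  unfold empiricalLaw
  rw [lintegral_map (Measure.measurable_lintegral hf) (measurable_sampleMeasure k)]
  simp_rw [lintegral_sampleMeasure]
  exact lintegral_pi_average hk m hf

theorem join_empiricalLaw {k : ℕ} (hk : 1 ≤ k) (m : Measure ℝ) [IsProbabilityMeasure m] :
    (empiricalLaw k m).join = m := by
  ext s hs
  have h := lintegral_lintegral_empiricalLaw hk m (f := s.indicator 1)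
    (measurable_one.indicator hs)
  simp only [lintegral_indicator_one hs] at h
  rw [Measure.join_apply hs, h]

theorem ae_empiricalLaw {k : ℕ} (m : Measure ℝ) {s : Set (Measure ℝ)} (hs : MeasurableSet s)
    (h : ∀ᵐ x ∂(Measure.pi fun _ : Fin k => m), sampleMeasure k x ∈ s) :
    ∀ᵐ M ∂empiricalLaw k m, M ∈ s :=
  (ae_map_iff (measurable_sampleMeasure k).aemeasurable hs).mpr h

instance (k : ℕ) (m : Measure ℝ) [IsProbabilityMeasure m] :
    IsProbabilityMeasure (empiricalLaw k m) :=
  Measure.isProbabilityMeasure_map (measurable_sampleMeasure k).aemeasurable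

theorem ae_empiricalLaw_univ {k : ℕ} (hk : 1 ≤ k) (m : Measure ℝ) :
    ∀ᵐ M ∂empiricalLaw k m, M univ = 1 :=
  ae_empiricalLaw (s := {M | M univ = 1}) m
    (measurableSet_eq_fun (Measure.measurable_coe .univ) measurable_const)
    (ae_of_all _ fun x => (isProbabilityMeasure_sampleMeasure hk x).measure_univ)

theorem empiricalLaw_map (k : ℕ) (ρ : Measure ℝ) [IsProbabilityMeasure ρ] {f : ℝ → ℝ}
    (hf : Measurable f) :
    empiricalLaw k (ρ.map f)
      = (Measure.pi fun _ : Fin k => ρ).map fun y => sampleMeasure k fun i => f (y i) := by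
  unfold empiricalLaw
  have : IsProbabilityMeasure (ρ.map f) := Measure.isProbabilityMeasure_map hf.aemeasurable
  rw [← Measure.pi_map_pi (fun _ => hf.aemeasurable),
    Measure.map_map (measurable_sampleMeasure k) (by fun_prop)]
  rfl

theorem memWasserstein₂_empiricalLaw {p : ℝ} {k : ℕ} (hk : 1 ≤ k) {m : Measure ℝ}
    (hm : MemWasserstein p m) : MemWasserstein₂ p (empiricalLaw k m) := by
  have := hm.isProbability
  have hmeas : Measurable fun x : ℝ => ‖x‖ₑ ^ p := by fun_prop
  have hmom : ∫⁻ M, ∫⁻ x, ‖x‖ₑ ^ p ∂M ∂empiricalLaw k m < ∞ := by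
    rw [lintegral_lintegral_empiricalLaw hk m hmeas]
    exact hm.moment
  have hneg : ∀ᵐ M ∂empiricalLaw k m, M (Iio 0) = 0 := by
    have h := lintegral_lintegral_empiricalLaw hk m (f := (Iio (0 : ℝ)).indicator 1)
      (measurable_one.indicator measurableSet_Iio)
    simp only [lintegral_indicator_one measurableSet_Iio] at h
    rw [hm.nonneg, lintegral_eq_zero_iff (Measure.measurable_coe measurableSet_Iio)] at h
    exact h
  refine ⟨inferInstance, ?_, hmom⟩
  filter_upwards [ae_empiricalLaw_univ hk m, hneg,
    ae_lt_top (Measure.measurable_lintegral hmeas) hmom.ne] with M h1 h2 h3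
  exact ⟨⟨h1⟩, h2, h3⟩

theorem wasserstein₂_empiricalLaw {p : ℝ} (hp : 1 ≤ p) {k : ℕ} (hk : 1 ≤ k) (ρ : Measure ℝ)
    [IsProbabilityMeasure ρ] {f g : ℝ → ℝ} (hf : Monotone f) (hg : Monotone g) :
    wasserstein₂ p (empiricalLaw k (ρ.map f)) (empiricalLaw k (ρ.map g))
      = (∫⁻ ω, edist (f ω) (g ω) ^ p ∂ρ) ^ (1 / p) := by
  have hp0 : 0 < p := by linarith
  have hfm := hf.measurable
  have hgm := hg.measurable
  have hF : Measurable fun y : Fin k → ℝ => sampleMeasure k fun i => f (y i) :=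
    (measurable_sampleMeasure k).comp (by fun_prop)
  have hG : Measurable fun y : Fin k → ℝ => sampleMeasure k fun i => g (y i) :=
    (measurable_sampleMeasure k).comp (by fun_prop)
  apply le_antisymm
  · unfold wasserstein₂ minCouplingCost
    refine iInf₂_le_of_le ((Measure.pi fun _ : Fin k => ρ).map fun y =>
      (sampleMeasure k fun i => f (y i), sampleMeasure k fun i => g (y i))) ⟨?_, ?_⟩ ?_
    · rw [empiricalLaw_map k ρ hfm]
      exact Measure.map_map measurable_fst (hF.prodMk hG)
    · rw [empiricalLaw_map k ρ hgm]
      exact Measure.map_map measurable_snd (hF.prodMk hG)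
    · refine ENNReal.rpow_le_rpow ((lintegral_map_le _ _).trans ?_) (by positivity)
      rw [← lintegral_pi_average hk ρ (f := fun y => edist (f y) (g y) ^ p) (by fun_prop)]
      exact lintegral_mono fun y => wasserstein_sampleMeasure_le hp k _ _
  · have : IsProbabilityMeasure (ρ.map f) := Measure.isProbabilityMeasure_map hfm.aemeasurable
    have : IsProbabilityMeasure (ρ.map g) := Measure.isProbabilityMeasure_map hgm.aemeasurable
    rw [lintegral_edist_monotone ρ hf hg hp]
    unfold wasserstein₂ minCouplingCost
    refine le_iInf₂ fun π hπ => ENNReal.rpow_le_rpow ?_ (by positivity)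
    have : IsFiniteMeasure π := by
      constructor
      rw [← preimage_univ (f := Prod.fst), ← Measure.map_apply measurable_fst .univ, hπ.1]
      exact measure_lt_top _ _
    have h1 : ∀ᵐ m ∂π, m.1 univ = 1 :=
      ae_of_ae_map measurable_fst.aemeasurable (hπ.1 ▸ ae_empiricalLaw_univ hk _)
    have h2 : ∀ᵐ m ∂π, m.2 univ = 1 :=
      ae_of_ae_map measurable_snd.aemeasurable (hπ.2 ▸ ae_empiricalLaw_univ hk _)
    have h := cdfGap_join_le (p := p) π (h1.mono fun m hm => hm.le) (h2.mono fun m hm => hm.le)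
    rw [hπ.1, hπ.2, join_empiricalLaw hk, join_empiricalLaw hk] at h
    refine h.trans (lintegral_mono_ae ?_)
    filter_upwards [h1] with m hm
    have : IsFiniteMeasure m.1 := ⟨hm ▸ ENNReal.one_lt_top⟩
    exact cdfGap_le_wasserstein hp _ _

theorem map_empiricalMeasure_eq {Ω : Type*} [MeasurableSpace Ω] (P : Measure Ω)
    [IsProbabilityMeasure P] {X : ℕ → Ω → ℝ} (hX : ∀ i, Measurable (X i)) {m : Measure ℝ}
    (hlaw : ∀ i, HasLaw (X i) m P) (hind : iIndepFun X P) (k : ℕ) :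
    P.map (fun ω => empiricalMeasure k fun i => X i ω) = empiricalLaw k m := by
  simp_rw [empiricalMeasure_eq_sampleMeasure]
  have h : iIndepFun (fun i : Fin k => X (i + 1)) P :=
    hind.precomp (g := fun i : Fin k => (i : ℕ) + 1) fun i j hij => by
      simpa [Fin.ext_iff] using hij
  have h2 := (iIndepFun_iff_map_fun_eq_pi_map fun i => (hX _).aemeasurable).mp h
  simp only [(hlaw _).map_eq] at h2
  rw [empiricalLaw, ← h2, Measure.map_map (measurable_sampleMeasure k) (by fun_prop)]
  rfl

/-! ### The unit Pareto law -/

instance : IsProbabilityMeasure (paretoMeasure 1 1) :=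
  isProbabilityMeasure_paretoMeasure one_pos one_pos

theorem lintegral_pareto {f : ℝ → ℝ≥0∞} (hf : Measurable f) :
    ∫⁻ z, f z ∂paretoMeasure 1 1 = ∫⁻ z in Ioi (1 : ℝ), f z * ENNReal.ofReal (1 / z ^ 2) := by
  unfold paretoMeasure
  have hm : Measurable (paretoPDF 1 1) := (measurable_paretoPDFReal 1 1).ennreal_ofReal
  rw [lintegral_withDensity_eq_lintegral_mul _ hm hf, ← lintegral_indicator measurableSet_Ioi]
  refine lintegral_congr_ae ?_
  filter_upwards [Measure.ae_ne volume (1 : ℝ)] with z hz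
  simp only [Pi.mul_apply]
  rcases lt_or_gt_of_ne hz with h | h
  · rw [indicator_of_notMem (by simpa using h.le), paretoPDF_of_lt h, zero_mul]
  · rw [indicator_of_mem (by simpa using h), paretoPDF_of_le h.le, mul_comm]
    congr 2
    have hz0 : 0 < z := by linarith
    rw [Real.rpow_neg hz0.le]
    norm_num

theorem pareto_Ioi (b : ℝ) : paretoMeasure 1 1 (Ioi b) = ENNReal.ofReal (1 / max b 1) := by
  have h := lintegral_pareto (f := (Ioi b).indicator 1) (measurable_one.indicator measurableSet_Ioi)
  rw [lintegral_indicator_one measurableSet_Ioi] at h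
  have hb : 0 < max b 1 := by positivity
  have e : ∀ z, (Ioi b).indicator 1 z * ENNReal.ofReal (1 / z ^ 2)
      = (Ioi b).indicator (fun z => ENNReal.ofReal (z ^ (-2 : ℝ))) z := by
    intro z
    have : (z : ℝ) ^ (-2 : ℝ) = 1 / z ^ 2 := by
      rw [show (-2 : ℝ) = ((-2 : ℤ) : ℝ) by norm_num, Real.rpow_intCast, zpow_neg, one_div]
      norm_cast
    by_cases hz : z ∈ Ioi b
    · simp only [indicator_of_mem hz, Pi.one_apply, one_mul, this]
    · simp only [indicator_of_notMem hz, zero_mul]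
  simp_rw [e] at h
  rw [setLIntegral_indicator measurableSet_Ioi, Ioi_inter_Ioi] at h
  rw [h, ← ofReal_integral_eq_lintegral_ofReal (integrableOn_Ioi_rpow_of_lt (by norm_num) hb),
    integral_Ioi_rpow_of_lt (by norm_num) hb]
  · congr 1
    norm_num
    rw [Real.rpow_neg_one]
  · filter_upwards [ae_restrict_mem measurableSet_Ioi] with z hz
    exact Real.rpow_nonneg (hb.le.trans (le_of_lt hz)) _

theorem ae_pareto_one_lt : ∀ᵐ z ∂paretoMeasure 1 1, 1 < z := by
  have h : (paretoMeasure 1 1) (Ioi 1) = 1 := by rw [pareto_Ioi]; simp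
  exact (mem_ae_iff_prob_eq_one measurableSet_Ioi).mpr h

theorem measure_ext_of_Ioi {m₁ m₂ : Measure ℝ} [IsFiniteMeasure m₁] (h0 : m₁ univ = m₂ univ)
    (h : ∀ b, m₁ (Ioi b) = m₂ (Ioi b)) : m₁ = m₂ := by
  have : IsFiniteMeasure m₂ := ⟨h0 ▸ measure_lt_top m₁ univ⟩
  refine Measure.ext_of_Iic _ _ fun b => ?_
  rw [← compl_Ioi, measure_compl measurableSet_Ioi (measure_ne_top _ _),
    measure_compl measurableSet_Ioi (measure_ne_top _ _), h0, h]

theorem pareto_restrict_Ioi {t : ℝ} (ht : 1 ≤ t) :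
    (paretoMeasure 1 1).restrict (Ioi t)
      = ENNReal.ofReal (1 / t) • (paretoMeasure 1 1).map (fun z => t * z) := by
  have ht0 : 0 < t := by linarith
  have hm : Measurable fun z : ℝ => t * z := by fun_prop
  refine measure_ext_of_Ioi ?_ fun b => ?_
  · simp only [Measure.restrict_apply_univ, Measure.smul_apply, smul_eq_mul]
    rw [Measure.map_apply hm .univ, preimage_univ, measure_univ, mul_one, pareto_Ioi,
      max_eq_left ht]
  · rw [Measure.restrict_apply measurableSet_Ioi, Ioi_inter_Ioi, Measure.smul_apply,
      Measure.map_apply hm measurableSet_Ioi, smul_eq_mul]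
    have : (fun z => t * z) ⁻¹' Ioi b = Ioi (b / t) := by
      ext z
      simp only [mem_preimage, mem_Ioi]
      rw [div_lt_iff₀ ht0, mul_comm]
    rw [this, pareto_Ioi, pareto_Ioi, ← ENNReal.ofReal_mul (by positivity)]
    congr 1
    rw [max_assoc, max_eq_left ht, one_div_mul_one_div, mul_max_of_nonneg _ _ ht0.le]
    congr 2
    · field_simp
    · simp

theorem map_cond_pareto {Ω E : Type*} [MeasurableSpace Ω] [MeasurableSpace E] (P : Measure Ω)
    [IsProbabilityMeasure P]
    {Z : Ω → ℝ} (hZ : Measurable Z) (hlaw : HasLaw Z (paretoMeasure 1 1) P) {t : ℝ} (ht : 1 ≤ t)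
    {f : ℝ → E} (hf : Measurable f) :
    (cond P {ω | t < Z ω}).map (fun ω => f (Z ω))
      = (paretoMeasure 1 1).map fun z => f (t * z) := by
  have ht0 : 0 < t := by linarith
  have e : {ω | t < Z ω} = Z ⁻¹' Ioi t := rfl
  have h1 : P (Z ⁻¹' Ioi t) = ENNReal.ofReal (1 / t) := by
    rw [← Measure.map_apply hZ measurableSet_Ioi, hlaw.map_eq, pareto_Ioi, max_eq_left ht]
  have h2 : (fun ω => f (Z ω)) = f ∘ Z := rfl
  have hpos : 0 < ENNReal.ofReal (1 / t) := ENNReal.ofReal_pos.mpr (by positivity)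
  rw [e, ProbabilityTheory.cond, h2, ← Measure.map_map hf hZ, Measure.map_smul, ← Measure.restrict_map hZ
    measurableSet_Ioi, hlaw.map_eq, pareto_restrict_Ioi ht, h1, smul_smul,
    ENNReal.inv_mul_cancel hpos.ne' ENNReal.ofReal_ne_top, one_smul, Measure.map_map hf (by fun_prop)]
  rfl

theorem lintegral_pareto_rpow_lt_top {p β C : ℝ} (hp : 1 ≤ p) (hC : 0 ≤ C) (hβ : p * β < 1)
    {f : ℝ → ℝ} (h : ∀ z, 1 ≤ z → |f z| ≤ C * z ^ β) :
    ∫⁻ z, ‖f z‖ₑ ^ p ∂paretoMeasure 1 1 < ∞ := by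
  have hp0 : 0 ≤ p := by linarith
  have hle : ∫⁻ z, ‖f z‖ₑ ^ p ∂paretoMeasure 1 1
      ≤ ∫⁻ z, ENNReal.ofReal (C * z ^ β) ^ p ∂paretoMeasure 1 1 := by
    refine lintegral_mono_ae ?_
    filter_upwards [ae_pareto_one_lt] with z hz
    rw [Real.enorm_eq_ofReal_abs]
    exact ENNReal.rpow_le_rpow (ENNReal.ofReal_le_ofReal (h z hz.le)) hp0
  refine hle.trans_lt ?_
  rw [lintegral_pareto (by fun_prop)]
  have e : ∀ z ∈ Ioi (1 : ℝ), ENNReal.ofReal (C * z ^ β) ^ p * ENNReal.ofReal (1 / z ^ 2)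
      = ENNReal.ofReal (C ^ p * z ^ (p * β - 2)) := by
    intro z hz
    have hz0 : 0 < z := lt_trans one_pos hz
    have hzβ : 0 ≤ z ^ β := Real.rpow_nonneg hz0.le _
    rw [ENNReal.ofReal_rpow_of_nonneg (by positivity) hp0,
      ← ENNReal.ofReal_mul (by positivity), Real.mul_rpow hC hzβ, ← Real.rpow_mul hz0.le,
      Real.rpow_sub hz0, mul_comm β p]
    congr 1
    norm_num
    ring
  rw [setLIntegral_congr_fun measurableSet_Ioi e, ← ofReal_integral_eq_lintegral_ofReal]
  · exact ENNReal.ofReal_lt_top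
  · exact (integrableOn_Ioi_rpow_of_lt (by linarith) one_pos).const_mul _
  · filter_upwards [ae_restrict_mem measurableSet_Ioi] with z hz
    have := Real.rpow_nonneg (zero_le_one.trans (le_of_lt hz)) (p * β - 2)
    have := Real.rpow_nonneg hC p
    positivity

/-! ### The Box-Cox transform and the Generalized Pareto law -/

theorem boxCox_one (γ : ℝ) : boxCox γ 1 = 0 := by
  unfold boxCox
  split_ifs <;> simp

theorem boxCox_strictMonoOn (γ : ℝ) : StrictMonoOn (boxCox γ) (Ioi 0) := by
  intro x hx y hy hxy
  simp only [mem_Ioi] at hx hy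
  unfold boxCox
  split_ifs with h
  · exact Real.log_lt_log hx hxy
  · rcases lt_or_gt_of_ne h with hn | hpos
    · have := Real.rpow_lt_rpow_of_neg hx hxy hn
      exact (div_lt_div_right_of_neg hn).mpr (by linarith)
    · have := Real.rpow_lt_rpow hx.le hxy hpos
      gcongr

theorem boxCox_nonneg (γ : ℝ) {x : ℝ} (hx : 1 ≤ x) : 0 ≤ boxCox γ x := by
  rw [← boxCox_one γ]
  exact (boxCox_strictMonoOn γ).monotoneOn (mem_Ioi.mpr one_pos)
    (mem_Ioi.mpr (by linarith)) hx

theorem boxCox_pos (γ : ℝ) {x : ℝ} (hx : 1 < x) : 0 < boxCox γ x := by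
  rw [← boxCox_one γ]
  exact boxCox_strictMonoOn γ (mem_Ioi.mpr one_pos) (mem_Ioi.mpr (by linarith)) hx

theorem boxCox_mul (γ : ℝ) {x y : ℝ} (hx : 0 < x) (hy : 0 < y) :
    boxCox γ (x * y) = boxCox γ x + x ^ γ * boxCox γ y := by
  unfold boxCox
  split_ifs with h
  · rw [h, Real.rpow_zero, one_mul, Real.log_mul hx.ne' hy.ne']
  · rw [Real.mul_rpow hx.le hy.le]
    field_simp
    ring

theorem monotone_boxCox_max (γ : ℝ) : Monotone fun z => boxCox γ (max z 1) := fun x y h =>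
  (boxCox_strictMonoOn γ).monotoneOn (mem_Ioi.mpr (by positivity)) (mem_Ioi.mpr (by positivity))
    (max_le_max h le_rfl)

theorem pareto_boxCox_gt (γ : ℝ) {x : ℝ} (hx : 0 ≤ x) :
    paretoMeasure 1 1 {z | x < boxCox γ (max z 1)} = ENNReal.ofReal (gpdTail γ x) := by
  have key : ∀ b, 1 ≤ b → boxCox γ b = x → 1 / b = gpdTail γ x →
      paretoMeasure 1 1 {z | x < boxCox γ (max z 1)} = ENNReal.ofReal (gpdTail γ x) := by
    intro b hb hbx htail
    have : {z | x < boxCox γ (max z 1)} = Ioi b := by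
      ext z
      simp only [mem_ofPred_eq, mem_Ioi]
      rw [← hbx, (boxCox_strictMonoOn γ).lt_iff_lt (mem_Ioi.mpr (by linarith))
        (mem_Ioi.mpr (by positivity)), lt_max_iff]
      exact ⟨fun h => h.resolve_right (by linarith), Or.inl⟩
    rw [this, pareto_Ioi, max_eq_left hb, htail]
  by_cases h0 : γ = 0
  · refine key (Real.exp x) (Real.one_le_exp hx) ?_ ?_
    · simp [boxCox, h0]
    · simp [gpdTail, h0, Real.exp_neg]
  by_cases h1 : 0 < 1 + γ * x
  · refine key ((1 + γ * x) ^ (1 / γ)) ?_ ?_ ?_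
    · rcases lt_or_gt_of_ne h0 with hn | hpos
      · exact Real.one_le_rpow_of_pos_of_le_one_of_nonpos h1
          (by nlinarith) (one_div_neg.mpr hn).le
      · exact Real.one_le_rpow (by nlinarith) (by positivity)
    · rw [boxCox, if_neg h0, ← Real.rpow_mul h1.le, one_div_mul_cancel h0, Real.rpow_one]
      field_simp
      ring
    · rw [gpdTail, if_neg h0, max_eq_left h1.le, one_div, ← Real.rpow_neg h1.le, neg_div]
  · have hn : γ < 0 := by
      rcases lt_or_gt_of_ne h0 with hn | hpos
      · exact hn
      · exact absurd (by positivity) h1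
    have htail : gpdTail γ x = 0 := by
      rw [gpdTail, if_neg h0, max_eq_right (not_lt.mp h1), Real.zero_rpow]
      exact div_ne_zero (by norm_num) h0
    have hempty : {z | x < boxCox γ (max z 1)} = ∅ := by
      ext z
      simp only [mem_ofPred_eq, mem_empty_iff_false, iff_false, not_lt]
      rw [boxCox, if_neg h0, div_le_iff_of_neg hn]
      have : 0 ≤ (max z 1) ^ γ := Real.rpow_nonneg (by positivity) _
      linarith
    rw [hempty, htail]
    simp

theorem map_boxCox_pareto (γ : ℝ) :
    (paretoMeasure 1 1).map (fun z => boxCox γ (max z 1)) = gpd γ := by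
  have hm := (monotone_boxCox_max γ).measurable
  have : IsProbabilityMeasure ((paretoMeasure 1 1).map fun z => boxCox γ (max z 1)) :=
    Measure.isProbabilityMeasure_map hm.aemeasurable
  refine measure_ext_of_Ioi (by simp) fun b => ?_
  rw [Measure.map_apply hm measurableSet_Ioi]
  have hg : gpd γ (Ioi b) = ENNReal.ofReal (1 - gpdCDF γ b) := by
    rw [← compl_Iic, prob_compl_eq_one_sub measurableSet_Iic, ← cdf_gpd, ← ofReal_cdf,
      ENNReal.ofReal_sub _ (cdf_nonneg _ _), ENNReal.ofReal_one]
  rw [hg, gpdCDF_eq]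
  dsimp only
  rcases lt_or_ge b 0 with hb | hb
  · have : (fun z => boxCox γ (max z 1)) ⁻¹' Ioi b = univ := by
      ext z
      simp only [mem_preimage, mem_Ioi, mem_univ, iff_true]
      exact hb.trans_le (boxCox_nonneg γ (le_max_right z 1))
    rw [this, measure_univ, max_eq_right hb.le]
    simp [gpdTail]
  · rw [max_eq_left hb, sub_sub_cancel]
    exact pareto_boxCox_gt γ hb

theorem memWasserstein_map_pareto {p β C : ℝ} (hp : 1 ≤ p) (hC : 0 ≤ C) (hβ : p * β < 1)
    {f : ℝ → ℝ} (hf : Measurable f) (h0 : ∀ z, 1 ≤ z → 0 ≤ f z)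
    (h : ∀ z, 1 ≤ z → f z ≤ C * z ^ β) :
    MemWasserstein p ((paretoMeasure 1 1).map f) := by
  refine ⟨Measure.isProbabilityMeasure_map hf.aemeasurable, ?_, ?_⟩
  · rw [Measure.map_apply hf measurableSet_Iio]
    have : ∀ᵐ z ∂paretoMeasure 1 1, ¬ f z < 0 := by
      filter_upwards [ae_pareto_one_lt] with z hz
      exact not_lt.mpr (h0 z hz.le)
    simp only [ae_iff, not_not] at this
    exact this
  · rw [lintegral_map (by fun_prop) hf]
    refine lintegral_pareto_rpow_lt_top hp hC hβ fun z hz => ?_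
    rw [abs_of_nonneg (h0 z hz)]
    exact h z hz

/-! ### Normalized excesses of the tail quantile function -/

/-- The normalized excess `(U (t z) - U t) / a t`, frozen for `z ≤ 1`. -/
noncomputable def excess (U a : ℝ → ℝ) (t z : ℝ) : ℝ := (U (t * max z 1) - U t) / a t

theorem monotone_excess {U a : ℝ → ℝ} (hU : MonotoneOn U (Ioi 1)) {t : ℝ} (ht : 1 < t)
    (hat : 0 < a t) : Monotone (excess U a t) := by
  intro x y hxy
  unfold excess
  have h : ∀ z : ℝ, 1 < t * max z 1 := fun z => by nlinarith [le_max_right z 1]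
  have := hU (mem_Ioi.mpr (h x)) (mem_Ioi.mpr (h y))
    (mul_le_mul_of_nonneg_left (max_le_max hxy le_rfl) (by linarith))
  gcongr

theorem excess_nonneg {U a : ℝ → ℝ} (hU : MonotoneOn U (Ioi 1)) {t : ℝ} (ht : 1 < t)
    (hat : 0 < a t) (z : ℝ) : 0 ≤ excess U a t z := by
  unfold excess
  have := hU (mem_Ioi.mpr ht) (mem_Ioi.mpr (by nlinarith [le_max_right z 1] : 1 < t * max z 1))
    (by nlinarith [le_max_right z 1])
  exact div_nonneg (by linarith) hat.le

theorem APrime_eq_lintegral {U a : ℝ → ℝ} (hU : MonotoneOn U (Ioi 1)) (γ : ℝ) {p t : ℝ}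
    (hp : 1 ≤ p) (ht : 1 < t) (hat : 0 < a t) :
    APrime U a γ p t
      = (∫⁻ z, edist (excess U a t z) (boxCox γ (max z 1)) ^ p ∂paretoMeasure 1 1) ^ (1 / p) := by
  have h1 := (monotone_excess hU ht hat).measurable
  have h2 := (monotone_boxCox_max γ).measurable
  unfold APrime
  rw [lintegral_pareto (by fun_prop)]
  congr 1
  refine setLIntegral_congr_fun measurableSet_Ioi fun z hz => ?_
  have hz1 : max z 1 = z := max_eq_left (le_of_lt hz)
  simp only [excess, hz1]
  rw [edist_dist, Real.dist_eq, ENNReal.ofReal_rpow_of_nonneg (abs_nonneg _) (by linarith),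
    ← ENNReal.ofReal_mul (by positivity), mul_one_div, mul_comm z t]

theorem wasserstein_excess {U a : ℝ → ℝ} (hU : MonotoneOn U (Ioi 1)) (γ : ℝ) {p t : ℝ}
    (hp : 1 ≤ p) (ht : 1 < t) (hat : 0 < a t) :
    wasserstein p ((paretoMeasure 1 1).map (excess U a t)) (gpd γ) = APrime U a γ p t := by
  rw [← map_boxCox_pareto, wasserstein_map_monotone _ (monotone_excess hU ht hat)
    (monotone_boxCox_max γ) hp, APrime_eq_lintegral hU γ hp ht hat]

theorem wasserstein₂_excess {U a : ℝ → ℝ} (hU : MonotoneOn U (Ioi 1)) (γ : ℝ) {p t : ℝ}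
    (hp : 1 ≤ p) {k : ℕ} (hk : 1 ≤ k) (ht : 1 < t) (hat : 0 < a t) :
    wasserstein₂ p (empiricalLaw k ((paretoMeasure 1 1).map (excess U a t)))
      (empiricalLaw k (gpd γ)) = APrime U a γ p t := by
  rw [← map_boxCox_pareto, wasserstein₂_empiricalLaw hp hk _ (monotone_excess hU ht hat)
    (monotone_boxCox_max γ), APrime_eq_lintegral hU γ hp ht hat]

/-! ### The tail quantile function -/

theorem nonempty_le_cdf (μ : Measure ℝ) {u : ℝ} (hu : u < 1) : {x | u ≤ cdf μ x}.Nonempty := by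
  obtain ⟨x, hx⟩ := ((tendsto_cdf_atTop μ).eventually (lt_mem_nhds hu)).exists
  exact ⟨x, le_of_lt hx⟩

theorem bddBelow_le_cdf (μ : Measure ℝ) {u : ℝ} (hu : 0 < u) : BddBelow {x | u ≤ cdf μ x} := by
  obtain ⟨b, hb⟩ := ((tendsto_cdf_atBot μ).eventually (gt_mem_nhds hu)).exists
  exact ⟨b, fun x hx => le_of_lt ((monotone_cdf μ).reflect_lt (lt_of_lt_of_le hb hx))⟩

theorem monotoneOn_tailQuantile (μ : Measure ℝ) : MonotoneOn (tailQuantile μ) (Ioi 1) := by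
  intro s hs t ht hst
  simp only [mem_Ioi] at hs ht
  have h1 : 1 - 1 / s ≤ 1 - 1 / t := by
    have := one_div_le_one_div_of_le (by linarith) hst
    linarith
  have h2 : 0 < 1 - 1 / s := by
    rw [sub_pos, div_lt_one (by linarith)]; exact hs
  have h3 : 1 - 1 / t < 1 := by
    have : 0 < 1 / t := by positivity
    linarith
  exact csInf_le_csInf (bddBelow_le_cdf μ h2) (nonempty_le_cdf μ h3) fun x hx => h1.trans hx

theorem measurable_tailQuantile (μ : Measure ℝ) : Measurable (tailQuantile μ) := by
  have hz : ∀ t, t ≤ 1 → t ≠ 0 → tailQuantile μ t = 0 := by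
    intro t ht h0
    unfold tailQuantile quantile
    rcases lt_or_gt_of_ne h0 with h | h
    · have : {x | 1 - 1 / t ≤ cdf μ x} = ∅ := by
        ext x
        simp only [mem_ofPred_eq, mem_empty_iff_false, iff_false, not_le]
        have := one_div_neg.mpr h
        linarith [cdf_le_one μ x]
      rw [this, Real.sInf_empty]
    · have : {x | 1 - 1 / t ≤ cdf μ x} = univ := by
        ext x
        simp only [mem_ofPred_eq, mem_univ, iff_true]
        have := one_le_one_div h ht
        linarith [cdf_nonneg μ x]
      rw [this, Real.sInf_univ]
  refine measurable_of_restrict_of_restrict_compl (s := Ioi 1) measurableSet_Ioi ?_ ?_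
  · refine Monotone.measurable fun s t hst => ?_
    exact monotoneOn_tailQuantile μ s.2 t.2 hst
  · have h : Measurable fun t : ℝ => if t = 0 then tailQuantile μ 0 else 0 :=
      Measurable.ite (measurableSet_singleton 0) measurable_const measurable_const
    convert h.comp (measurable_subtype_coe (p := (· ∈ (Ioi (1 : ℝ))ᶜ))) using 1
    ext t
    simp only [domRestrict_apply, Function.comp_apply]
    split_ifs with h0
    · rw [h0]
    · exact hz t (not_lt.mp t.2) h0

theorem measurable_boxCox (γ : ℝ) : Measurable (boxCox γ) := by
  unfold boxCox
  split_ifs <;> fun_prop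

/-! ### First order growth -/

/-- The normalized increment `(U (t x) - U t) / a t`. -/
noncomputable def incr (U a : ℝ → ℝ) (t x : ℝ) : ℝ := (U (t * x) - U t) / a t

theorem incr_mul {U a : ℝ → ℝ} {t x : ℝ} (y : ℝ) (hax : a (t * x) ≠ 0) :
    incr U a t (x * y) = incr U a t x + a (t * x) / a t * incr U a (t * x) y := by
  unfold incr
  rw [div_mul_div_comm, mul_comm (a (t * x)), mul_div_mul_right _ _ hax, ← add_div]
  congr 1
  rw [mul_assoc]
  ring

theorem tendsto_mul_const_right {x : ℝ} (hx : 0 < x) :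
    Tendsto (fun t : ℝ => t * x) atTop atTop := tendsto_id.atTop_mul_const hx

theorem FirstOrder.tendsto_incr {U a : ℝ → ℝ} {γ : ℝ} (h : FirstOrder U a γ) {x : ℝ}
    (hx : 0 < x) : Tendsto (fun t => incr U a t x) atTop (𝓝 (boxCox γ x)) := h x hx

theorem FirstOrder.tendsto_scale {U a : ℝ → ℝ} {γ : ℝ} (ha : ∀ t, 1 < t → 0 < a t)
    (h : FirstOrder U a γ) {x : ℝ} (hx : 0 < x) :
    Tendsto (fun t => a (t * x) / a t) atTop (𝓝 (x ^ γ)) := by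
  have h2 : 0 < boxCox γ 2 := boxCox_pos γ (by norm_num)
  have hlim := ((h.tendsto_incr (x := x * 2) (by positivity)).sub (h.tendsto_incr hx)).div
    ((h.tendsto_incr (x := 2) (by norm_num)).comp (tendsto_mul_const_right hx)) h2.ne'
  have e : (boxCox γ (x * 2) - boxCox γ x) / boxCox γ 2 = x ^ γ := by
    rw [boxCox_mul γ hx (by norm_num)]
    field_simp
    ring
  rw [e] at hlim
  refine hlim.congr' ?_
  filter_upwards [(tendsto_mul_const_right hx).eventually_gt_atTop 1,
    ((h.tendsto_incr (x := 2) (by norm_num)).comp (tendsto_mul_const_right hx)).eventually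
      (lt_mem_nhds h2)] with t ht hpos
  simp only [Function.comp_apply] at hpos
  simp only [Pi.div_apply, Function.comp_apply]
  rw [incr_mul 2 (ha _ ht).ne', add_sub_cancel_left, mul_div_assoc, div_self hpos.ne', mul_one]

theorem growth_of_doubling {G : ℝ → ℝ → ℝ} {t₀ K b β : ℝ} (ht₀ : 0 ≤ t₀) (hK : 0 ≤ K)
    (hb : 0 ≤ b) (hβ : 0 ≤ β) (hbβ : b < 2 ^ β)
    (hbase : ∀ t, t₀ ≤ t → ∀ x, 1 ≤ x → x ≤ 2 → G t x ≤ K)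
    (hstep : ∀ t, t₀ ≤ t → ∀ x, 1 ≤ x → G t (2 * x) ≤ K * x ^ β + b * G (2 * t) x) :
    ∃ C, 0 ≤ C ∧ ∀ t, t₀ ≤ t → ∀ x, 1 ≤ x → G t x ≤ C * x ^ β := by
  have hd : 0 < 2 ^ β - b := by linarith
  set C := K + K / (2 ^ β - b) with hC
  have hKd : 0 ≤ K / (2 ^ β - b) := by positivity
  have hC0 : 0 ≤ C := by positivity
  have hCK : K ≤ (2 ^ β - b) * C := by
    have : (2 ^ β - b) * (K / (2 ^ β - b)) = K := by field_simp
    rw [hC, mul_add, this]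
    nlinarith [mul_nonneg hd.le hK]
  refine ⟨C, hC0, ?_⟩
  have main : ∀ j : ℕ, ∀ t, t₀ ≤ t → ∀ x, 1 ≤ x → x ≤ 2 ^ (j + 1) → G t x ≤ C * x ^ β := by
    intro j
    induction j with
    | zero =>
      intro t ht x hx hx2
      have := Real.one_le_rpow hx hβ
      have := hbase t ht x hx (by simpa using hx2)
      nlinarith
    | succ j ih =>
      intro t ht x hx hxj
      rcases le_total x 2 with hx2 | hx2
      · have := Real.one_le_rpow hx hβ
        have := hbase t ht x hx hx2
        nlinarith
      · have h1 := hstep t ht (x / 2) (by linarith)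
        have h2 := ih (2 * t) (by linarith) (x / 2) (by linarith) (by rw [pow_succ] at hxj; linarith)
        have h3 : x ^ β = 2 ^ β * (x / 2) ^ β := by
          rw [← Real.mul_rpow (by norm_num) (by linarith)]
          congr 1
          ring
        rw [show 2 * (x / 2) = x by ring] at h1
        have h4 : 0 ≤ (x / 2) ^ β := Real.rpow_nonneg (by linarith) _
        have h5 := mul_le_mul_of_nonneg_left h2 hb
        have h6 := mul_le_mul_of_nonneg_right hCK h4
        rw [h3]
        nlinarith
  intro t ht x hx
  obtain ⟨j, hj⟩ := pow_unbounded_of_one_lt x (by norm_num : (1 : ℝ) < 2)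
  exact main j t ht x hx (hj.le.trans (pow_le_pow_right₀ (by norm_num) (Nat.le_succ j)))

theorem incr_mono {U a : ℝ → ℝ} (hU : MonotoneOn U (Ioi 1)) {t x y : ℝ} (ht : 1 < t)
    (hat : 0 < a t) (hx : 1 ≤ x) (hxy : x ≤ y) : incr U a t x ≤ incr U a t y := by
  unfold incr
  have := hU (mem_Ioi.mpr (by nlinarith : 1 < t * x)) (mem_Ioi.mpr (by nlinarith : 1 < t * y))
    (mul_le_mul_of_nonneg_left hxy (by linarith))
  gcongr

theorem incr_one {U a : ℝ → ℝ} (t : ℝ) : incr U a t 1 = 0 := by simp [incr]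

theorem incr_nonneg {U a : ℝ → ℝ} (hU : MonotoneOn U (Ioi 1)) {t x : ℝ} (ht : 1 < t)
    (hat : 0 < a t) (hx : 1 ≤ x) : 0 ≤ incr U a t x :=
  (incr_one (U := U) (a := a) t).symm.trans_le (incr_mono hU ht hat le_rfl hx)

theorem FirstOrder.growth {U a : ℝ → ℝ} {γ β : ℝ} (hU : MonotoneOn U (Ioi 1))
    (ha : ∀ t, 1 < t → 0 < a t) (h : FirstOrder U a γ) (hβ : 0 ≤ β) (hγβ : γ < β) :
    ∃ C t₀, 0 ≤ C ∧ 1 < t₀ ∧ ∀ t, t₀ ≤ t → ∀ x, 1 ≤ x → incr U a t x ≤ C * x ^ β := by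
  obtain ⟨β', h1, h2⟩ := exists_between hγβ
  have hlt : (2 : ℝ) ^ γ < 2 ^ β' := Real.rpow_lt_rpow_of_exponent_lt (by norm_num) h1
  have hlt2 : (2 : ℝ) ^ β' < 2 ^ β := Real.rpow_lt_rpow_of_exponent_lt (by norm_num) h2
  have e1 := (h.tendsto_scale ha (x := 2) (by norm_num)).eventually (gt_mem_nhds hlt)
  have e2 := (h.tendsto_incr (x := 2) (by norm_num)).eventually
    (gt_mem_nhds (lt_add_one (boxCox γ 2)))
  obtain ⟨t₁, ht₁⟩ := eventually_atTop.mp (e1.and (e2.and (eventually_gt_atTop 1)))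
  have hD : 0 < boxCox γ 2 := boxCox_pos γ (by norm_num)
  set t₀ := max t₁ 2
  have hb : ∀ t, t₀ ≤ t → a (t * 2) / a t < 2 ^ β' ∧ incr U a t 2 < boxCox γ 2 + 1 ∧ 1 < t :=
    fun t ht => ht₁ t ((le_max_left _ _).trans ht)
  have ht₀2 : 2 ≤ t₀ := le_max_right _ _
  obtain ⟨C, hC, hG⟩ := growth_of_doubling (G := incr U a) (t₀ := t₀) (K := boxCox γ 2 + 1)
    (b := 2 ^ β') (β := β) (by linarith) (by linarith) (by positivity) hβ hlt2
    (fun t ht x hx hx2 => (incr_mono hU (hb t ht).2.2 (ha t (hb t ht).2.2) hx hx2).trans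
      (hb t ht).2.1.le)
    (fun t ht x hx => by
      obtain ⟨c1, c2, c3⟩ := hb t ht
      have c4 : 1 < t * 2 := by linarith
      rw [incr_mul x (ha _ c4).ne', mul_comm 2 t]
      have := Real.one_le_rpow hx hβ
      have c5 := incr_nonneg hU c4 (ha _ c4) hx
      have := mul_le_mul_of_nonneg_right c1.le c5
      nlinarith)
  exact ⟨C, t₀, hC, by linarith, hG⟩

theorem FirstOrder.growth_boxCox {U a : ℝ → ℝ} {γ C t₀ β : ℝ} (h : FirstOrder U a γ)
    (hg : ∀ t, t₀ ≤ t → ∀ x, 1 ≤ x → incr U a t x ≤ C * x ^ β) {x : ℝ} (hx : 1 ≤ x) :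
    boxCox γ x ≤ C * x ^ β :=
  le_of_tendsto (h.tendsto_incr (by linarith))
    ((eventually_ge_atTop t₀).mono fun t ht => hg t ht x hx)

theorem FirstOrder.growth_all {U a : ℝ → ℝ} {γ β : ℝ} (hU : MonotoneOn U (Ioi 1))
    (ha : ∀ t, 1 < t → 0 < a t) (h : FirstOrder U a γ) (hβ : 0 ≤ β) (hγβ : γ < β)
    {t : ℝ} (ht : 1 < t) :
    ∃ C, 0 ≤ C ∧ ∀ x, 1 ≤ x → incr U a t x ≤ C * x ^ β := by
  obtain ⟨C, t₀, hC, ht₀, hg⟩ := h.growth hU ha hβ hγβ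
  set s := max t t₀
  have hs : 1 < s := ht.trans_le (le_max_left _ _)
  have hat := ha t ht
  have has := ha s hs
  have hUst : U t ≤ U s := hU (mem_Ioi.mpr ht) (mem_Ioi.mpr hs) (le_max_left _ _)
  refine ⟨a s * C / a t + (U s - U t) / a t,
    add_nonneg (by positivity) (div_nonneg (by linarith) hat.le), fun x hx => ?_⟩
  have h1 := hg s (le_max_right _ _) x hx
  rw [incr, div_le_iff₀ has] at h1
  have h2 : U (t * x) ≤ U (s * x) :=
    hU (mem_Ioi.mpr (by nlinarith)) (mem_Ioi.mpr (by nlinarith))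
      (mul_le_mul_of_nonneg_right (le_max_left _ _) (by linarith))
  have h3 := Real.one_le_rpow hx hβ
  rw [incr, div_le_iff₀ hat, ← add_div, div_mul_eq_mul_div, div_mul_cancel₀ _ hat.ne']
  nlinarith [mul_le_mul_of_nonneg_left h3 (sub_nonneg.mpr hUst)]

/-! ### Uniformity in regular variation -/

theorem tendsto_volume_diff {s : Set ℝ} (hs : MeasurableSet s) (hfin : volume s ≠ ∞)
    {E : ℕ → Set ℝ} (hE : ∀ N, MeasurableSet (E N)) (hmono : Monotone E)
    (hcov : ∀ x ∈ s, ∃ N, x ∈ E N) : Tendsto (fun N => volume (s \ E N)) atTop (𝓝 0) := by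
  have h := tendsto_measure_iInter_atTop (μ := volume) (s := fun N => s \ E N)
    (fun N => (hs.diff (hE N)).nullMeasurableSet)
    (fun N M hNM => sdiff_subset_sdiff_right (hmono hNM))
    ⟨0, ne_top_of_le_ne_top hfin (measure_mono sdiff_subset)⟩
  have h0 : ⋂ N, s \ E N = ∅ := by
    ext x
    simp only [mem_iInter, Set.mem_sdiff, mem_empty_iff_false, iff_false, not_forall]
    by_cases hx : x ∈ s
    · obtain ⟨N, hN⟩ := hcov x hx
      exact ⟨N, fun h => h.2 hN⟩
    · exact ⟨0, fun h => hx h.1⟩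
  rwa [h0, measure_empty] at h

theorem exists_common_dilate {E F : ℕ → Set ℝ} (hE : ∀ N, MeasurableSet (E N))
    (hF : ∀ N, MeasurableSet (F N)) (hEm : Monotone E) (hFm : Monotone F)
    (hEc : ∀ x ∈ Icc (1 : ℝ) 2, ∃ N, x ∈ E N) (hFc : ∀ y ∈ Icc (1 / 2 : ℝ) 4, ∃ N, y ∈ F N) :
    ∃ N₀, ∀ N, N₀ ≤ N → ∀ u ∈ Icc (1 / 2 : ℝ) 2, ∃ x ∈ Icc (1 : ℝ) 2, x ∈ E N ∧ u * x ∈ F N := by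
  have t1 := tendsto_volume_diff measurableSet_Icc (by simp) hE hEm hEc
  have t2 := tendsto_volume_diff measurableSet_Icc (by simp) hF hFm hFc
  have hq : (0 : ℝ≥0∞) < ENNReal.ofReal (1 / 4) := by simp
  obtain ⟨N₀, hN₀⟩ := eventually_atTop.mp
    ((t1.eventually (gt_mem_nhds hq)).and (t2.eventually (gt_mem_nhds hq)))
  refine ⟨N₀, fun N hN u hu => ?_⟩
  by_contra! hcon
  obtain ⟨b1, b2⟩ := hN₀ N hN
  have hu0 : 0 < u := by linarith [hu.1]
  have hsub : Icc (1 : ℝ) 2 ⊆ (Icc 1 2 \ E N) ∪ (fun x => u * x) ⁻¹' (Icc (1 / 2) 4 \ F N) := by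
    intro x hx
    by_cases hxE : x ∈ E N
    · refine Or.inr ⟨⟨?_, ?_⟩, hcon x hx hxE⟩
      · nlinarith [hu.1, hx.1]
      · nlinarith [hu.1, hu.2, hx.1, hx.2]
    · exact Or.inl ⟨hx, hxE⟩
  have h1 := (measure_mono (μ := volume) hsub).trans (measure_union_le _ _)
  rw [Real.volume_preimage_mul_left hu0.ne', Real.volume_Icc] at h1
  have h2 : ENNReal.ofReal |u⁻¹| ≤ ENNReal.ofReal 2 := by
    apply ENNReal.ofReal_le_ofReal
    rw [abs_of_pos (by positivity), inv_le_comm₀ hu0 (by norm_num)]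
    linarith [hu.1]
  have h3 : ENNReal.ofReal (2 - 1) ≤ ENNReal.ofReal (1 / 4) + ENNReal.ofReal 2 * ENNReal.ofReal (1 / 4) :=
    h1.trans (add_le_add b1.le (mul_le_mul' h2 b2.le))
  rw [← ENNReal.ofReal_mul (by norm_num), ← ENNReal.ofReal_add (by norm_num) (by norm_num),
    ENNReal.ofReal_le_ofReal_iff (by norm_num)] at h3
  norm_num at h3

theorem tendsto_additive_uniform {f : ℝ → ℝ} {ρ : ℝ} (hf : Measurable f)
    (h : ∀ x, 0 < x → Tendsto (fun t => f (t * x) - f t) atTop (𝓝 (ρ * Real.log x))) :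
    Tendsto (fun q : ℝ × ℝ => f (q.1 * q.2) - f q.1) (atTop ×ˢ 𝓝 1) (𝓝 0) := by
  refine tendsto_of_seq_tendsto fun q hq => ?_
  obtain ⟨hs, hu⟩ := tendsto_prod_iff'.mp hq
  set s := fun n => (q n).1
  set u := fun n => (q n).2
  have hsu : Tendsto (fun n => s n * u n) atTop atTop := hs.atTop_mul_pos one_pos hu
  have hlog : Tendsto (fun n => ρ * Real.log (u n)) atTop (𝓝 0) := by
    have := ((Real.continuousAt_log one_ne_zero).tendsto.comp hu).const_mul ρ
    simpa using this
  have hmeas : ∀ (σ : ℕ → ℝ) (ε : ℝ) (N : ℕ), MeasurableSet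
      {x : ℝ | ∀ n, N ≤ n → |f (σ n * x) - f (σ n) - ρ * Real.log x| ≤ ε} := by
    intro σ ε N
    simp only [ofPred_forall]
    refine MeasurableSet.iInter fun n => MeasurableSet.iInter fun _ => ?_
    exact measurableSet_le (by fun_prop) measurable_const
  have hcov : ∀ (σ : ℕ → ℝ), Tendsto σ atTop atTop → ∀ ε, 0 < ε → ∀ x : ℝ, 0 < x →
      ∃ N, x ∈ {x : ℝ | ∀ n, N ≤ n → |f (σ n * x) - f (σ n) - ρ * Real.log x| ≤ ε} := by
    intro σ hσ ε hε x hx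
    have := Metric.tendsto_atTop.mp ((h x hx).comp hσ) ε hε
    obtain ⟨N, hN⟩ := this
    exact ⟨N, fun n hn => (hN n hn).le⟩
  have hmono : ∀ (σ : ℕ → ℝ) (ε : ℝ), Monotone fun N : ℕ =>
      {x : ℝ | ∀ n, N ≤ n → |f (σ n * x) - f (σ n) - ρ * Real.log x| ≤ ε} :=
    fun σ ε N M hNM x hx n hn => hx n (hNM.trans hn)
  rw [Metric.tendsto_atTop]
  intro ε hε
  obtain ⟨N₀, hN₀⟩ := exists_common_dilate (hmeas s (ε / 4)) (hmeas (fun n => s n * u n) (ε / 4))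
    (hmono _ _) (hmono _ _) (fun x hx => hcov _ hs _ (by positivity) x (by linarith [hx.1]))
    (fun x hx => hcov _ hsu _ (by positivity) x (by linarith [hx.1]))
  obtain ⟨N₁, hN₁⟩ := Metric.tendsto_atTop.mp hlog (ε / 4) (by positivity)
  obtain ⟨N₂, hN₂⟩ := eventually_atTop.mp
    (hu.eventually (Icc_mem_nhds (by norm_num : (1 / 2 : ℝ) < 1) (by norm_num : (1 : ℝ) < 2)))
  refine ⟨max N₀ (max N₁ N₂), fun n hn => ?_⟩
  have hn0 : N₀ ≤ n := (le_max_left _ _).trans hn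
  have hn1 : N₁ ≤ n := ((le_max_left _ _).trans (le_max_right _ _)).trans hn
  have hn2 : N₂ ≤ n := ((le_max_right _ _).trans (le_max_right _ _)).trans hn
  have hun := hN₂ n hn2
  have hu0 : 0 < u n := by linarith [hun.1]
  have hinv : (u n)⁻¹ ∈ Icc (1 / 2 : ℝ) 2 := by
    constructor
    · rw [one_div]; exact inv_anti₀ hu0 hun.2
    · rw [inv_le_comm₀ hu0 (by norm_num)]; linarith [hun.1]
  obtain ⟨x, hx, hxE, hxF⟩ := hN₀ N₀ le_rfl _ hinv
  have hx0 : 0 < x := by linarith [hx.1]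
  have e1 := hxE n hn0
  have e2 := hxF n hn0
  have e3 := hN₁ n hn1
  have e4 : s n * u n * ((u n)⁻¹ * x) = s n * x := by field_simp
  rw [e4, Real.log_mul (by positivity) hx0.ne', Real.log_inv] at e2
  rw [Real.dist_eq, sub_zero] at e3 ⊢
  rw [abs_le] at e1 e2
  rw [abs_lt] at e3
  rw [mul_add] at e2
  change |f (s n * u n) - f (s n)| < ε
  rw [abs_lt]
  constructor <;> linarith [e1.1, e1.2, e2.1, e2.2, e3.1, e3.2]

theorem RegularlyVarying.eventually_ne {A : ℝ → ℝ} {ρ : ℝ} (h : RegularlyVarying A ρ) :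
    ∀ᶠ t in atTop, A t ≠ 0 := by
  rcases h.sign with h | h
  · exact h.mono fun t ht => ht.ne'
  · exact h.mono fun t ht => ht.ne

theorem RegularlyVarying.tendsto_uniform {A : ℝ → ℝ} {ρ : ℝ} (h : RegularlyVarying A ρ) :
    Tendsto (fun q : ℝ × ℝ => |A (q.1 * q.2)| / |A q.1|) (atTop ×ˢ 𝓝 1) (𝓝 1) := by
  have hA := h.measurable
  have hlim : Tendsto (fun q : ℝ × ℝ => Real.log (A (q.1 * q.2)) - Real.log (A q.1))
      (atTop ×ˢ 𝓝 1) (𝓝 0) := by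
    refine tendsto_additive_uniform (f := fun t => Real.log (A t)) (ρ := ρ) (by fun_prop)
      fun x hx => ?_
    have hxρ : x ^ ρ ≠ 0 := (Real.rpow_pos_of_pos hx ρ).ne'
    have := (Real.continuousAt_log hxρ).tendsto.comp (h.tendsto x hx)
    rw [Real.log_rpow hx] at this
    refine this.congr' ?_
    filter_upwards [h.eventually_ne, (tendsto_mul_const_right hx).eventually h.eventually_ne]
      with t h1 h2
    simp only [Function.comp_apply]
    rw [Real.log_div h2 h1]
  have hexp := (Real.continuous_exp.tendsto 0).comp hlim
  rw [Real.exp_zero] at hexp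
  refine hexp.congr' ?_
  have hmul : Tendsto (fun q : ℝ × ℝ => q.1 * q.2) (atTop ×ˢ 𝓝 1) atTop :=
    tendsto_fst.atTop_mul_pos one_pos tendsto_snd
  filter_upwards [tendsto_fst.eventually h.eventually_ne, hmul.eventually h.eventually_ne]
    with q h1 h2
  simp only [Function.comp_apply]
  rw [Real.exp_sub, Real.exp_log_eq_abs h2, Real.exp_log_eq_abs h1]

/-! ### Second order growth -/

/-- The normalized second order remainder. -/
noncomputable def remainder (U a A : ℝ → ℝ) (γ t x : ℝ) : ℝ :=
  (incr U a t x - boxCox γ x) / A t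

/-- The normalized second order remainder of the scale function. -/
noncomputable def scaleRemainder (a A : ℝ → ℝ) (γ t x : ℝ) : ℝ :=
  (a (t * x) / a t - x ^ γ) / A t

theorem remainder_mul {U a A : ℝ → ℝ} {γ t x y : ℝ} (hx : 0 < x) (hy : 0 < y)
    (hax : a (t * x) ≠ 0) (hA : A (t * x) ≠ 0) :
    remainder U a A γ t (x * y) = remainder U a A γ t x
      + scaleRemainder a A γ t x * incr U a (t * x) y
      + x ^ γ * (A (t * x) / A t) * remainder U a A γ (t * x) y := by
  unfold remainder scaleRemainder
  rw [incr_mul y hax, boxCox_mul γ hx hy]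
  field_simp
  ring

section

variable {U a A : ℝ → ℝ} {γ ρ : ℝ}

theorem SecondOrder.tendsto_remainder (h : SecondOrder U a A γ ρ) {x : ℝ} (hx : 0 < x) :
    Tendsto (fun t => remainder U a A γ t x) atTop (𝓝 (psi γ ρ x)) := h.tendsto x hx

theorem SecondOrder.tendsto_scaleRemainder (h : SecondOrder U a A γ ρ)
    (ha : ∀ t, 1 < t → 0 < a t) (hF : FirstOrder U a γ) {x : ℝ} (hx : 0 < x) :
    ∃ l, Tendsto (fun t => scaleRemainder a A γ t x) atTop (𝓝 l) := by
  have h2 : 0 < boxCox γ 2 := boxCox_pos γ (by norm_num)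
  have hmul := tendsto_mul_const_right hx
  have i2 := (hF.tendsto_incr (x := 2) (by norm_num)).comp hmul
  have hlim := (((h.tendsto_remainder (x := x * 2) (by positivity)).sub
    (h.tendsto_remainder hx)).sub (((h.regularlyVarying.tendsto x hx).const_mul (x ^ γ)).mul
      ((h.tendsto_remainder (x := 2) (by norm_num)).comp hmul))).div i2 h2.ne'
  refine ⟨_, hlim.congr' ?_⟩
  filter_upwards [hmul.eventually_gt_atTop 1, hmul.eventually h.regularlyVarying.eventually_ne,
    i2.eventually (lt_mem_nhds h2)] with t h1 h3 h4
  simp only [Function.comp_apply] at h4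
  simp only [Pi.div_apply, Function.comp_apply]
  rw [remainder_mul hx (by norm_num) (ha _ h1).ne' h3, div_eq_iff h4.ne']
  ring

theorem exists_abs_le_of_tendsto {v : ℕ → ℝ} {l : ℝ} (h : Tendsto v atTop (𝓝 l)) :
    ∃ N : ℕ, ∀ M, N ≤ M → ∀ n, M ≤ n → |v n| ≤ M := by
  obtain ⟨N, hN⟩ := eventually_atTop.mp (h.abs.eventually (gt_mem_nhds (lt_add_one |l|)))
  obtain ⟨K, hK⟩ := exists_nat_gt (|l| + 1)
  refine ⟨max N K, fun M hM n hn => ?_⟩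
  have h1 := hN n ((le_max_left _ _).trans (hM.trans hn))
  have h2 : (K : ℝ) ≤ M := by exact_mod_cast (le_max_right _ _).trans hM
  linarith

theorem measurable_remainder_div (hU : Measurable U) (ha : Measurable a) (hA : Measurable A)
    (σ : ℝ) : Measurable fun x => remainder U a A γ (σ / x) x := by
  have := measurable_boxCox γ
  unfold remainder incr
  fun_prop

theorem SecondOrder.locally_bounded (h : SecondOrder U a A γ ρ) (hU : MonotoneOn U (Ioi 1))
    (hUm : Measurable U) (ham : Measurable a) (ha : ∀ t, 1 < t → 0 < a t)
    (hF : FirstOrder U a γ) :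
    ∃ K, 0 ≤ K ∧ ∀ᶠ t in atTop, ∀ x, 1 ≤ x → x ≤ 2 → |remainder U a A γ t x| ≤ K := by
  by_contra! hcon
  have hAm := h.regularlyVarying.measurable
  have hex : ∀ n : ℕ, ∃ t x : ℝ, n ≤ t ∧ 1 ≤ x ∧ x ≤ 2 ∧
      (n : ℝ) < |remainder U a A γ t x| := by
    intro n
    obtain ⟨t, ht, x, h1, h2, h3⟩ := frequently_atTop.mp (hcon n n.cast_nonneg) n
    exact ⟨t, x, ht, h1, h2, h3⟩
  choose s u hs hu1 hu2 hbig using hex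
  have hs' : Tendsto s atTop atTop := tendsto_atTop_mono hs tendsto_natCast_atTop_atTop
  have hsu : Tendsto (fun n => s n * u n) atTop atTop := by
    refine tendsto_atTop_mono' _ ?_ hs'
    filter_upwards [hs'.eventually_ge_atTop 0] with n hn
    nlinarith [hu1 n]
  set E : ℕ → Set ℝ := fun N => {x | ∀ n, N ≤ n → |remainder U a A γ (s n / x) x| ≤ N ∧
    |scaleRemainder a A γ (s n / x) x| ≤ N ∧ |A (s n * x⁻¹) / A (s n)| ≤ N} with hE
  set F : ℕ → Set ℝ := fun N => {y | ∀ n, N ≤ n → |remainder U a A γ (s n * u n / y) y| ≤ N}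
    with hFdef
  have hEmeas : ∀ N, MeasurableSet (E N) := by
    intro N
    simp only [hE, ofPred_forall]
    refine MeasurableSet.iInter fun n => MeasurableSet.iInter fun _ => ?_
    have m1 : Measurable fun x => |remainder U a A γ (s n / x) x| :=
      (measurable_remainder_div hUm ham hAm (s n)).norm
    have m2 : Measurable fun x => |scaleRemainder a A γ (s n / x) x| := by
      unfold scaleRemainder
      fun_prop
    have m3 : Measurable fun x => |A (s n * x⁻¹) / A (s n)| := by fun_prop
    exact (measurableSet_le m1 measurable_const).inter
      ((measurableSet_le m2 measurable_const).inter (measurableSet_le m3 measurable_const))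
  have hFmeas : ∀ N, MeasurableSet (F N) := by
    intro N
    simp only [hFdef, ofPred_forall]
    refine MeasurableSet.iInter fun n => MeasurableSet.iInter fun _ => ?_
    exact measurableSet_le (measurable_remainder_div hUm ham hAm (s n * u n)).norm
      measurable_const
  have hEmono : Monotone E := by
    intro N M hNM x hx n hn
    have hNM' : (N : ℝ) ≤ M := by exact_mod_cast hNM
    obtain ⟨h1, h2, h3⟩ := hx n (hNM.trans hn)
    exact ⟨h1.trans hNM', h2.trans hNM', h3.trans hNM'⟩
  have hFmono : Monotone F := by
    intro N M hNM x hx n hn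
    have hNM' : (N : ℝ) ≤ M := by exact_mod_cast hNM
    exact (hx n (hNM.trans hn)).trans hNM'
  have hEcov : ∀ x ∈ Icc (1 : ℝ) 2, ∃ N, x ∈ E N := by
    intro x hx
    have hx0 : 0 < x := by linarith [hx.1]
    have hsx : Tendsto (fun n => s n / x) atTop atTop := hs'.atTop_div_const hx0
    obtain ⟨N1, hN1⟩ := exists_abs_le_of_tendsto ((h.tendsto_remainder hx0).comp hsx)
    obtain ⟨l, hl⟩ := h.tendsto_scaleRemainder ha hF hx0
    obtain ⟨N2, hN2⟩ := exists_abs_le_of_tendsto (hl.comp hsx)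
    obtain ⟨N3, hN3⟩ := exists_abs_le_of_tendsto
      ((h.regularlyVarying.tendsto x⁻¹ (by positivity)).comp hs')
    refine ⟨max N1 (max N2 N3), fun n hn => ⟨hN1 _ (le_max_left _ _) n hn,
      hN2 _ ((le_max_left _ _).trans (le_max_right _ _)) n hn,
      hN3 _ ((le_max_right _ _).trans (le_max_right _ _)) n hn⟩⟩
  have hFcov : ∀ y ∈ Icc (1 / 2 : ℝ) 4, ∃ N, y ∈ F N := by
    intro y hy
    have hy0 : 0 < y := by linarith [hy.1]
    obtain ⟨N, hN⟩ := exists_abs_le_of_tendsto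
      ((h.tendsto_remainder hy0).comp (hsu.atTop_div_const hy0))
    exact ⟨N, fun n hn => hN N le_rfl n hn⟩
  obtain ⟨N, hN⟩ := exists_common_dilate hEmeas hFmeas hEmono hFmono hEcov hFcov
  have hinc := hF.tendsto_incr (x := 2) (by norm_num)
  set H := boxCox γ 2 + 1
  have hH0 : 0 < H := by have := boxCox_pos γ (x := 2) (by norm_num); positivity
  set B := 2 ^ |γ| * (N * (N + N + N * H)) with hB
  obtain ⟨n₁, hn₁⟩ := exists_nat_gt B
  obtain ⟨T, hT⟩ := eventually_atTop.mp h.regularlyVarying.eventually_ne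
  obtain ⟨n, hn, c1, c2, c3⟩ := (((eventually_ge_atTop (max N n₁)).and
    ((hs'.eventually (hinc.eventually (gt_mem_nhds (lt_add_one (boxCox γ 2))))).and
      ((hs'.eventually_gt_atTop 2).and (hs'.eventually_ge_atTop (max T (2 * T))))))).exists
  obtain ⟨x, hx, hxE, hxF⟩ := hN N le_rfl (u n) ⟨by linarith [hu1 n], hu2 n⟩
  have hx0 : 0 < x := by linarith [hx.1]
  have hu0 : 0 < u n := by linarith [hu1 n]
  obtain ⟨d1, d2, d3⟩ := hxE n ((le_max_left _ _).trans hn)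
  have d4 := hxF n ((le_max_left _ _).trans hn)
  have e1 : s n * u n / (u n * x) = s n / x := by field_simp
  have e2 : s n / x * x = s n := by field_simp
  rw [e1] at d4
  set t := s n / x with ht
  have hid := remainder_mul (U := U) (a := a) (A := A) (γ := γ) (t := t) hx0 hu0
    (by rw [e2]; exact (ha _ (by linarith)).ne') (by rw [e2]; exact hT _ ((le_max_left _ _).trans c3))
  rw [e2, mul_comm x (u n)] at hid
  have hincr : |incr U a (s n) (u n)| ≤ H := by
    rw [abs_of_nonneg (incr_nonneg hU (by linarith) (ha _ (by linarith)) (hu1 n))]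
    exact (incr_mono hU (by linarith) (ha _ (by linarith)) (hu1 n) (hu2 n)).trans c1.le
  have hxγ : 0 < x ^ γ := Real.rpow_pos_of_pos hx0 γ
  rw [← div_eq_mul_inv, ← ht] at d3
  have hAt : A t ≠ 0 := by
    refine hT t ?_
    rw [ht, le_div_iff₀ hx0]
    rcases le_total T 0 with hT0 | hT0
    · nlinarith
    · nlinarith [hx.2, (le_max_right T (2 * T)).trans c3]
  have hAs : A (s n) ≠ 0 := hT _ ((le_max_left _ _).trans c3)
  have hsolve : remainder U a A γ (s n) (u n) = x ^ (-γ) * (A t / A (s n) *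
      (remainder U a A γ t (u n * x) - remainder U a A γ t x
        - scaleRemainder a A γ t x * incr U a (s n) (u n))) := by
    rw [hid, Real.rpow_neg hx0.le]
    field_simp
    ring
  have hxb : x ^ (-γ) ≤ 2 ^ |γ| := by
    calc x ^ (-γ) ≤ x ^ |γ| := Real.rpow_le_rpow_of_exponent_le hx.1 (neg_le_abs γ)
      _ ≤ 2 ^ |γ| := Real.rpow_le_rpow hx0.le hx.2 (abs_nonneg _)
  have hfin : |remainder U a A γ (s n) (u n)| ≤ B := by
    rw [hsolve, abs_mul, abs_mul, abs_of_pos (Real.rpow_pos_of_pos hx0 _), hB]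
    have hN0 : (0 : ℝ) ≤ N := N.cast_nonneg
    refine mul_le_mul hxb (mul_le_mul d3 ?_ (abs_nonneg _) hN0) (by positivity) (by positivity)
    refine (abs_sub _ _).trans (add_le_add ((abs_sub _ _).trans (add_le_add d4 d1)) ?_)
    rw [abs_mul]
    exact mul_le_mul d2 hincr (abs_nonneg _) hN0
  have : (n₁ : ℝ) ≤ n := by exact_mod_cast (le_max_right _ _).trans hn
  linarith [hbig n]

end

section

variable {U a A : ℝ → ℝ} {γ ρ : ℝ}

theorem SecondOrder.growth (h : SecondOrder U a A γ ρ) (hU : MonotoneOn U (Ioi 1))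
    (hUm : Measurable U) (ham : Measurable a) (ha : ∀ t, 1 < t → 0 < a t)
    (hF : FirstOrder U a γ) {β : ℝ} (hβ : 0 ≤ β) (hγβ : γ < β) :
    ∃ C t₀, 0 ≤ C ∧ ∀ t, t₀ ≤ t → ∀ x, 1 ≤ x → |remainder U a A γ t x| ≤ C * x ^ β := by
  obtain ⟨C₁, t₁, hC₁, ht₁, hg⟩ := hF.growth hU ha hβ hγβ
  obtain ⟨K, hK, hloc⟩ := h.locally_bounded hU hUm ham ha hF
  obtain ⟨l, hl⟩ := h.tendsto_scaleRemainder ha hF (x := 2) (by norm_num)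
  have hlt : (2 : ℝ) ^ γ < 2 ^ β := Real.rpow_lt_rpow_of_exponent_lt (by norm_num) hγβ
  obtain ⟨b, hb1, hb2⟩ := exists_between hlt
  have hpos : (0 : ℝ) < 2 ^ γ := by positivity
  have hρ : |(2 : ℝ) ^ γ * 2 ^ ρ| < b := by
    rw [abs_of_pos (by positivity)]
    have : (2 : ℝ) ^ ρ ≤ 1 := Real.rpow_le_one_of_one_le_of_nonpos (by norm_num) h.nonpos
    nlinarith
  have e1 := ((h.regularlyVarying.tendsto 2 (by norm_num)).const_mul ((2 : ℝ) ^ γ)).abs.eventually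
    (gt_mem_nhds hρ)
  have e2 := hl.abs.eventually (gt_mem_nhds (lt_add_one |l|))
  have hmul := tendsto_mul_const_right (x := 2) (by norm_num)
  obtain ⟨t₂, ht₂⟩ := eventually_atTop.mp (hloc.and (e1.and (e2.and
    ((eventually_gt_atTop 1).and (hmul.eventually h.regularlyVarying.eventually_ne)))))
  set t₀ := max t₁ t₂
  obtain ⟨C, hC, hG⟩ := growth_of_doubling (G := fun t x => |remainder U a A γ t x|) (t₀ := t₀)
    (K := K + (|l| + 1) * C₁) (b := b) (β := β)
    (by linarith [le_max_left t₁ t₂]) (by positivity) (hpos.le.trans hb1.le) hβ hb2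
    (fun t ht x hx hx2 => by
      have := (ht₂ t ((le_max_right _ _).trans ht)).1 x hx hx2
      have : 0 ≤ (|l| + 1) * C₁ := by positivity
      linarith)
    (fun t ht x hx => by
      obtain ⟨c1, c2, c3, c4, c5⟩ := ht₂ t ((le_max_right _ _).trans ht)
      have ht1 : t₁ ≤ t * 2 := by linarith [(le_max_left t₁ t₂).trans ht]
      have c6 : 1 < t * 2 := by linarith
      have c7 := incr_nonneg hU c6 (ha _ c6) hx
      have c8 := hg _ ht1 x hx
      have hxβ := Real.one_le_rpow hx hβ
      rw [remainder_mul (by norm_num) (by linarith) (ha _ c6).ne' c5, mul_comm 2 t]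
      refine (abs_add_le _ _).trans (add_le_add ((abs_add_le _ _).trans ?_) ?_)
      · rw [abs_mul, abs_of_nonneg c7]
        have d1 := c1 2 (by norm_num) le_rfl
        have d2 := mul_le_mul c3.le c8 c7 (by positivity)
        nlinarith
      · rw [abs_mul]
        exact mul_le_mul_of_nonneg_right c2.le (abs_nonneg _))
  exact ⟨C, t₀, hC, hG⟩

/-! ### The second order limit function -/

theorem integral_rpow_eq_boxCox {s : ℝ} (hs : 0 < s) :
    ∫ u in (1 : ℝ)..s, u ^ (ρ - 1) = boxCox ρ s := by
  have h0 : (0 : ℝ) ∉ uIcc 1 s := by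
    rw [mem_uIcc]
    rintro (h | h) <;> linarith [h.1, h.2]
  unfold boxCox
  split_ifs with h
  · simp only [h, zero_sub, Real.rpow_neg_one]
    rw [integral_inv h0, div_one]
  · rw [integral_rpow (Or.inr ⟨fun hh => h (by linarith), h0⟩), sub_add_cancel, Real.one_rpow]

theorem continuousOn_boxCox : ContinuousOn (boxCox γ) (Ioi 0) := by
  unfold boxCox
  split_ifs
  · exact Real.continuousOn_log.mono fun x hx => (ne_of_gt hx)
  · intro x hx
    exact (((Real.continuousAt_rpow_const x γ (Or.inl (ne_of_gt hx))).sub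
      continuousAt_const).div_const γ).continuousWithinAt

theorem psi_pos {x : ℝ} (hx : 1 < x) : 0 < psi γ ρ x := by
  have e : psi γ ρ x = ∫ s in (1 : ℝ)..x, s ^ (γ - 1) * boxCox ρ s := by
    unfold psi
    refine intervalIntegral.integral_congr fun s hs => ?_
    rw [uIcc_of_le hx.le] at hs
    rw [integral_rpow_eq_boxCox (by linarith [hs.1])]
  rw [e]
  refine intervalIntegral.intervalIntegral_pos_of_pos_on ?_ (fun s hs => ?_) hx
  · refine ContinuousOn.intervalIntegrable ?_
    rw [uIcc_of_le hx.le]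
    have hsub : Icc 1 x ⊆ Ioi 0 := fun s hs => lt_of_lt_of_le one_pos hs.1
    refine ContinuousOn.mul (fun s hs => ?_) (continuousOn_boxCox.mono hsub)
    exact (Real.continuousAt_rpow_const s _ (Or.inl (ne_of_gt (hsub hs)))).continuousWithinAt
  · exact mul_pos (Real.rpow_pos_of_pos (by linarith [hs.1]) _) (boxCox_pos ρ hs.1)

/-! ### Dominated convergence -/

theorem integrableOn_envelope {C p β : ℝ} (hβ : p * β < 1) :
    IntegrableOn (fun z : ℝ => C ^ p * z ^ (p * β - 2)) (Ioi 1) :=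
  (integrableOn_Ioi_rpow_of_lt (by linarith) one_pos).const_mul _

theorem rpow_div_sq_le {C p β z y : ℝ} (hp : 0 ≤ p) (hC : 0 ≤ C) (hz : 1 < z) (hy : 0 ≤ y)
    (h : y ≤ C * z ^ β) : y ^ p / z ^ 2 ≤ C ^ p * z ^ (p * β - 2) := by
  have hz0 : 0 < z := by linarith
  have h1 := Real.rpow_le_rpow hy h hp
  rw [Real.mul_rpow hC (Real.rpow_nonneg hz0.le _), ← Real.rpow_mul hz0.le, mul_comm β p] at h1
  rw [Real.rpow_sub hz0, ← mul_div_assoc]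
  have : z ^ (2 : ℝ) = z ^ 2 := by norm_cast
  rw [this]
  gcongr

theorem tendsto_lintegral_envelope {G : ℝ → ℝ → ℝ} {g : ℝ → ℝ} {C t₀ p β : ℝ} (hp : 0 < p)
    (hC : 0 ≤ C) (hβ : p * β < 1) (hG : ∀ t, Measurable (G t))
    (hbound : ∀ t, t₀ ≤ t → ∀ z, 1 ≤ z → |G t z| ≤ C * z ^ β)
    (hlim : ∀ z, 1 < z → Tendsto (fun t => G t z) atTop (𝓝 (g z))) :
    Tendsto (fun t => ∫⁻ z in Ioi (1 : ℝ), ENNReal.ofReal (|G t z| ^ p / z ^ 2)) atTop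
      (𝓝 (∫⁻ z in Ioi (1 : ℝ), ENNReal.ofReal (|g z| ^ p / z ^ 2))) := by
  refine tendsto_lintegral_filter_of_dominated_convergence
    (fun z => ENNReal.ofReal (C ^ p * z ^ (p * β - 2))) ?_ ?_ ?_ ?_
  · exact Eventually.of_forall fun t => by have := hG t; fun_prop
  · filter_upwards [eventually_ge_atTop t₀] with t ht
    filter_upwards [ae_restrict_mem measurableSet_Ioi] with z hz
    exact ENNReal.ofReal_le_ofReal
      (rpow_div_sq_le hp.le hC hz (abs_nonneg _) (hbound t ht z (le_of_lt hz)))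
  · exact (integrableOn_envelope hβ).lintegral_lt_top.ne
  · filter_upwards [ae_restrict_mem measurableSet_Ioi] with z hz
    refine ENNReal.tendsto_ofReal (Tendsto.div_const ?_ _)
    exact ((Real.continuousAt_rpow_const _ p (Or.inr hp.le)).tendsto).comp (hlim z hz).abs

theorem exists_growth_exponent {p : ℝ} (hp : 1 ≤ p) (hpγ : p * max γ 0 < 1) :
    ∃ β, 0 ≤ β ∧ γ < β ∧ p * β < 1 := by
  have hp0 : 0 < p := by linarith
  have : max γ 0 < 1 / p := by rw [lt_div_iff₀ hp0]; linarith
  obtain ⟨β, h1, h2⟩ := exists_between this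
  rw [lt_div_iff₀ hp0] at h2
  exact ⟨β, (le_max_right _ _).trans h1.le, (le_max_left _ _).trans_lt h1, by linarith⟩

theorem APrime_eq_incr (γ p t : ℝ) : APrime U a γ p t
    = (∫⁻ z in Ioi (1 : ℝ), ENNReal.ofReal (|incr U a t z - boxCox γ z| ^ p / z ^ 2)) ^ (1 / p) := by
  simp only [APrime, incr, mul_comm]

theorem measurable_incr (hUm : Measurable U) (t : ℝ) : Measurable (incr U a t) := by
  unfold incr
  fun_prop

theorem FirstOrder.abs_sub_le {C t₀ β : ℝ} (hU : MonotoneOn U (Ioi 1))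
    (ha : ∀ t, 1 < t → 0 < a t) (hF : FirstOrder U a γ) (ht₀ : 1 < t₀)
    (hg : ∀ t, t₀ ≤ t → ∀ x, 1 ≤ x → incr U a t x ≤ C * x ^ β) {t z : ℝ} (ht : t₀ ≤ t)
    (hz : 1 ≤ z) : |incr U a t z - boxCox γ z| ≤ C * z ^ β := by
  have h1 := incr_nonneg hU (ht₀.trans_le ht) (ha _ (ht₀.trans_le ht)) hz
  have h2 := boxCox_nonneg γ hz
  have h3 := hg t ht z hz
  have h4 := hF.growth_boxCox hg hz
  rw [abs_le]
  constructor <;> linarith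

theorem FirstOrder.tendsto_APrime (hU : MonotoneOn U (Ioi 1)) (hUm : Measurable U)
    (ha : ∀ t, 1 < t → 0 < a t) (hF : FirstOrder U a γ) {p : ℝ} (hp : 1 ≤ p)
    (hpγ : p * max γ 0 < 1) : Tendsto (APrime U a γ p) atTop (𝓝 0) := by
  have hp0 : 0 < p := by linarith
  obtain ⟨β, hβ, hγβ, hpβ⟩ := exists_growth_exponent hp hpγ
  obtain ⟨C, t₀, hC, ht₀, hg⟩ := hF.growth hU ha hβ hγβ
  have hm := measurable_boxCox γ
  have h := tendsto_lintegral_envelope (G := fun t z => incr U a t z - boxCox γ z) (g := fun _ => 0)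
    hp0 hC hpβ (fun t => (measurable_incr hUm t).sub hm)
    (fun t ht z hz => hF.abs_sub_le hU ha ht₀ hg ht hz)
    (fun z hz => by
      have := (hF.tendsto_incr (x := z) (by linarith)).sub_const (boxCox γ z)
      rwa [sub_self] at this)
  simp only [abs_zero, Real.zero_rpow hp0.ne', zero_div, ENNReal.ofReal_zero, lintegral_zero] at h
  have h2 := ((ENNReal.continuous_rpow_const (y := 1 / p)).tendsto 0).comp h
  rw [ENNReal.zero_rpow_of_pos (by positivity)] at h2
  exact h2.congr fun t => (APrime_eq_incr γ p t).symm

theorem FirstOrder.APrime_lt_top (hU : MonotoneOn U (Ioi 1))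
    (ha : ∀ t, 1 < t → 0 < a t) (hF : FirstOrder U a γ) {p : ℝ} (hp : 1 ≤ p)
    (hpγ : p * max γ 0 < 1) {t : ℝ} (ht : 1 < t) : APrime U a γ p t < ∞ := by
  have hp0 : 0 < p := by linarith
  obtain ⟨β, hβ, hγβ, hpβ⟩ := exists_growth_exponent hp hpγ
  obtain ⟨C₁, t₀, hC₁, ht₀, hg⟩ := hF.growth hU ha hβ hγβ
  obtain ⟨C, hC, hgt⟩ := hF.growth_all hU ha hβ hγβ ht
  rw [APrime_eq_incr]
  refine ENNReal.rpow_lt_top_of_nonneg (by positivity) (ne_of_lt ?_)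
  refine lt_of_le_of_lt ?_ (integrableOn_envelope (C := C + C₁) hpβ).lintegral_lt_top
  refine lintegral_mono_ae ?_
  filter_upwards [ae_restrict_mem measurableSet_Ioi] with z hz
  refine ENNReal.ofReal_le_ofReal
    (rpow_div_sq_le hp0.le (by positivity) hz (abs_nonneg _) ?_)
  have hz1 : 1 ≤ z := le_of_lt hz
  have h1 := incr_nonneg hU ht (ha _ ht) hz1
  have h2 := boxCox_nonneg γ hz1
  have h3 := hgt z hz1
  have h4 := hF.growth_boxCox hg hz1
  rw [abs_le]
  constructor <;> linarith

theorem FirstOrder.memWasserstein_excess (hU : MonotoneOn U (Ioi 1))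
    (ha : ∀ t, 1 < t → 0 < a t) (hF : FirstOrder U a γ) {p : ℝ} (hp : 1 ≤ p)
    (hpγ : p * max γ 0 < 1) {t : ℝ} (ht : 1 < t) :
    MemWasserstein p ((paretoMeasure 1 1).map (excess U a t)) := by
  obtain ⟨β, hβ, hγβ, hpβ⟩ := exists_growth_exponent hp hpγ
  obtain ⟨C, hC, hgt⟩ := hF.growth_all hU ha hβ hγβ ht
  refine memWasserstein_map_pareto hp hC hpβ (monotone_excess hU ht (ha t ht)).measurable
    (fun z _ => excess_nonneg hU ht (ha t ht) z) fun z hz => ?_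
  rw [excess, max_eq_left hz]
  exact hgt z hz

theorem FirstOrder.memWasserstein_gpd (hU : MonotoneOn U (Ioi 1))
    (ha : ∀ t, 1 < t → 0 < a t) (hF : FirstOrder U a γ) {p : ℝ} (hp : 1 ≤ p)
    (hpγ : p * max γ 0 < 1) : MemWasserstein p (gpd γ) := by
  obtain ⟨β, hβ, hγβ, hpβ⟩ := exists_growth_exponent hp hpγ
  obtain ⟨C, t₀, hC, ht₀, hg⟩ := hF.growth hU ha hβ hγβ
  rw [← map_boxCox_pareto]
  refine memWasserstein_map_pareto hp hC hpβ (monotone_boxCox_max γ).measurable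
    (fun z _ => boxCox_nonneg γ (le_max_right z 1)) fun z hz => ?_
  rw [max_eq_left hz]
  exact hF.growth_boxCox hg hz

theorem SecondOrder.rate (h : SecondOrder U a A γ ρ) (hU : MonotoneOn U (Ioi 1))
    (hUm : Measurable U) (ham : Measurable a) (ha : ∀ t, 1 < t → 0 < a t)
    (hF : FirstOrder U a γ) {p : ℝ} (hp : 1 ≤ p) (hpγ : p * max γ 0 < 1) :
    IntegrableOn (fun x => psi γ ρ x ^ p / x ^ 2) (Ioi 1) ∧ 0 < cPrime γ ρ p ∧
      Tendsto (fun t => (APrime U a γ p t).toReal / |A t|) atTop (𝓝 (cPrime γ ρ p)) := by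
  have hp0 : 0 < p := by linarith
  obtain ⟨β, hβ, hγβ, hpβ⟩ := exists_growth_exponent hp hpγ
  obtain ⟨C, t₀, hC, hg⟩ := h.growth hU hUm ham ha hF hβ hγβ
  have hm := measurable_boxCox γ
  have hAm := h.regularlyVarying.measurable
  have hrm : ∀ t, Measurable (remainder U a A γ t) := fun t =>
    ((measurable_incr hUm t).sub hm).div_const _
  have hlim := tendsto_lintegral_envelope (G := remainder U a A γ) (g := psi γ ρ) hp0 hC hpβ hrm hg
    (fun z hz => h.tendsto_remainder (by linarith))
  have hpsi_le : ∀ z, 1 ≤ z → |psi γ ρ z| ≤ C * z ^ β := fun z hz =>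
    le_of_tendsto (h.tendsto_remainder (by linarith)).abs
      ((eventually_ge_atTop t₀).mono fun t ht => hg t ht z hz)
  have hpsi_m : AEMeasurable (psi γ ρ) (volume.restrict (Ioi 1)) := by
    refine aemeasurable_of_tendsto_metrizable_ae' (f := fun (n : ℕ) => remainder U a A γ n)
      (fun n => (hrm _).aemeasurable) ?_
    filter_upwards [ae_restrict_mem measurableSet_Ioi] with z hz
    exact (h.tendsto_remainder (lt_trans one_pos hz)).comp tendsto_natCast_atTop_atTop
  have hint : IntegrableOn (fun x => psi γ ρ x ^ p / x ^ 2) (Ioi 1) := by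
    refine Integrable.mono' (integrableOn_envelope (C := C) hpβ) ?_ ?_
    · exact AEMeasurable.aestronglyMeasurable (by fun_prop)
    · filter_upwards [ae_restrict_mem measurableSet_Ioi] with z hz
      have h0 := (psi_pos (γ := γ) (ρ := ρ) hz).le
      have h1 := hpsi_le z (le_of_lt hz)
      rw [abs_of_nonneg h0] at h1
      rw [Real.norm_of_nonneg (div_nonneg (Real.rpow_nonneg h0 _) (sq_nonneg _))]
      exact rpow_div_sq_le hp0.le hC hz h0 h1
  have hnn : 0 ≤ᵐ[volume.restrict (Ioi 1)] fun x => psi γ ρ x ^ p / x ^ 2 := by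
    filter_upwards [ae_restrict_mem measurableSet_Ioi] with z hz
    exact div_nonneg (Real.rpow_nonneg (psi_pos hz).le _) (sq_nonneg _)
  have hIeq : ∫⁻ z in Ioi (1 : ℝ), ENNReal.ofReal (|psi γ ρ z| ^ p / z ^ 2)
      = ENNReal.ofReal (∫ x in Ioi (1 : ℝ), psi γ ρ x ^ p / x ^ 2) := by
    rw [ofReal_integral_eq_lintegral_ofReal hint hnn]
    refine setLIntegral_congr_fun measurableSet_Ioi fun z hz => ?_
    rw [abs_of_pos (psi_pos hz)]
  have hIpos : 0 < ∫ x in Ioi (1 : ℝ), psi γ ρ x ^ p / x ^ 2 := by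
    rw [setIntegral_pos_iff_support_of_nonneg_ae hnn hint]
    have : Function.support (fun x => psi γ ρ x ^ p / x ^ 2) ∩ Ioi 1 = Ioi 1 := by
      refine inter_eq_right.mpr fun z hz => ?_
      have hz0 : 0 < z := lt_trans one_pos hz
      have h1 := Real.rpow_pos_of_pos (psi_pos (γ := γ) (ρ := ρ) hz) p
      exact (div_pos h1 (by positivity)).ne'
    rw [this]
    simp
  refine ⟨hint, Real.rpow_pos_of_pos hIpos _, ?_⟩
  rw [hIeq] at hlim
  have h2 := ((ENNReal.continuous_rpow_const (y := 1 / p)).tendsto _).comp hlim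
  have h3 := (ENNReal.tendsto_toReal
    (ENNReal.rpow_ne_top_of_nonneg (by positivity) ENNReal.ofReal_ne_top)).comp h2
  rw [← ENNReal.toReal_rpow, ENNReal.toReal_ofReal hIpos.le] at h3
  refine h3.congr' ?_
  filter_upwards [h.regularlyVarying.eventually_ne] with t ht
  have hA0 : 0 < |A t| := abs_pos.mpr ht
  simp only [Function.comp_apply]
  rw [eq_div_iff hA0.ne', APrime_eq_incr]
  have e : ∀ z ∈ Ioi (1 : ℝ), ENNReal.ofReal (|incr U a t z - boxCox γ z| ^ p / z ^ 2)
      = ENNReal.ofReal (|A t| ^ p) * ENNReal.ofReal (|remainder U a A γ t z| ^ p / z ^ 2) := by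
    intro z hz
    rw [← ENNReal.ofReal_mul (by positivity), ← mul_div_assoc,
      ← Real.mul_rpow hA0.le (abs_nonneg _), ← abs_mul, remainder, mul_div_cancel₀ _ ht]
  rw [setLIntegral_congr_fun measurableSet_Ioi e, lintegral_const_mul' _ _ ENNReal.ofReal_ne_top,
    ENNReal.mul_rpow_of_nonneg _ _ (by positivity), ENNReal.toReal_mul,
    ENNReal.ofReal_rpow_of_nonneg (by positivity) (by positivity), ← Real.rpow_mul hA0.le,
    mul_one_div_cancel hp0.ne', Real.rpow_one, ENNReal.toReal_ofReal hA0.le, mul_comm]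

end

/-! ### Order statistics of an i.i.d. sample -/

theorem pi_map_comp_equiv {ι ι' : Type*} [Fintype ι] [Fintype ι'] (ρ : Measure ℝ)
    [IsProbabilityMeasure ρ] (e : ι' ≃ ι) :
    (Measure.pi fun _ : ι => ρ).map (fun w => w ∘ e) = Measure.pi fun _ : ι' => ρ := by
  refine (Measure.pi_eq fun s hs => ?_).symm
  have hm : Measurable fun w : ι → ℝ => w ∘ e := by fun_prop
  rw [Measure.map_apply hm (MeasurableSet.univ_pi hs)]
  have : (fun w : ι → ℝ => w ∘ e) ⁻¹' univ.pi s = univ.pi fun i => s (e.symm i) := by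
    ext w
    simp only [mem_preimage, mem_univ_pi, Function.comp_apply]
    exact ⟨fun h i => by simpa using h (e.symm i), fun h i => by simpa using h (e i)⟩
  rw [this, Measure.pi_pi]
  exact Equiv.prod_comp e.symm fun i => ρ (s i)

theorem ae_injective_pi {ι : Type*} [Fintype ι] (ρ : Measure ℝ) [IsProbabilityMeasure ρ]
    (hρ : ∀ x, ρ {x} = 0) : ∀ᵐ w ∂(Measure.pi fun _ : ι => ρ), Function.Injective w := by
  have h : ∀ i j : ι, i ≠ j → ∀ᵐ w ∂(Measure.pi fun _ : ι => ρ), w i ≠ w j := by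
    intro i j hij
    have hind : iIndepFun (fun (i : ι) (w : ι → ℝ) => w i) (Measure.pi fun _ : ι => ρ) :=
      iIndepFun_pi (X := fun _ => id) fun _ => aemeasurable_id
    have hpair := (indepFun_iff_map_prod_eq_prod_map_map (measurable_pi_apply i).aemeasurable
      (measurable_pi_apply j).aemeasurable).mp (hind.indepFun hij)
    have hi : ∀ i : ι, (Measure.pi fun _ : ι => ρ).map (fun w => w i) = ρ := fun i =>
      (measurePreserving_eval (fun _ : ι => ρ) i).map_eq
    rw [hi, hi] at hpair
    have hd : (ρ.prod ρ) {q : ℝ × ℝ | q.1 = q.2} = 0 := by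
      rw [Measure.measure_prod_null (measurableSet_eq_fun measurable_fst measurable_snd)]
      refine ae_of_all _ fun x => ?_
      have : Prod.mk x ⁻¹' {q : ℝ × ℝ | q.1 = q.2} = {x} := by
        ext y
        simp [eq_comm]
      dsimp only
      rw [this]
      exact hρ x
    rw [← hpair, Measure.map_apply (by fun_prop)
      (measurableSet_eq_fun measurable_fst measurable_snd)] at hd
    simp only [ae_iff, not_not, ne_eq]
    exact hd
  have h' : ∀ᵐ w ∂(Measure.pi fun _ : ι => ρ), ∀ i j : ι, i ≠ j → w i ≠ w j := by
    rw [ae_all_iff]; intro i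
    rw [ae_all_iff]; intro j
    by_cases hij : i = j
    · simp [hij]
    · filter_upwards [h i j hij] with w hw _ using hw
  filter_upwards [h'] with w hw i j hij
  by_contra hne
  exact hw i j hne hij

variable {n : ℕ}

/-- The vectors whose `m`-th entry lies above the previous and below the next ones. -/
def pivotSet (m : Fin n) : Set (Fin n → ℝ) :=
  {w | ∀ i, (i < m → w i < w m) ∧ (m < i → w m < w i)}

theorem measurableSet_pivotSet (m : Fin n) : MeasurableSet (pivotSet m) := by
  unfold pivotSet
  simp only [ofPred_forall]
  refine MeasurableSet.iInter fun i => ?_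
  have h1 : MeasurableSet {w : Fin n → ℝ | i < m → w i < w m} := by
    by_cases h : i < m
    · simpa [h] using measurableSet_lt (measurable_pi_apply i) (measurable_pi_apply m)
    · simp [h]
  have h2 : MeasurableSet {w : Fin n → ℝ | m < i → w m < w i} := by
    by_cases h : m < i
    · simpa [h] using measurableSet_lt (measurable_pi_apply m) (measurable_pi_apply i)
    · simp [h]
  exact h1.inter h2

/-- The number of permutations that fix `m` and preserve the indices below and above `m`. -/
noncomputable def pivotCount (m : Fin n) : ℕ := by
  classical
  exact (Finset.univ.filter fun τ : Equiv.Perm (Fin n) =>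
    ∀ i, (i < m → τ i < τ m) ∧ (m < i → τ m < τ i)).card

theorem pivotCount_pos (m : Fin n) : 0 < pivotCount m := by
  classical
  exact Finset.card_pos.mpr ⟨1, by simp⟩

theorem strictMono_comp_sort {w : Fin n → ℝ} (hw : Function.Injective w) :
    StrictMono (w ∘ Tuple.sort w) :=
  (Tuple.monotone_sort w).strictMono_of_injective (hw.comp (Tuple.sort w).injective)

theorem sum_indicator_pivotSet (m : Fin n) {w : Fin n → ℝ} (hw : Function.Injective w) :
    ∑ σ : Equiv.Perm (Fin n), (pivotSet m).indicator (1 : (Fin n → ℝ) → ℝ≥0∞) (w ∘ σ)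
      = pivotCount m := by
  classical
  have hs := strictMono_comp_sort hw
  rw [← Equiv.sum_comp (Equiv.mulLeft (Tuple.sort w))]
  have e : ∀ τ : Equiv.Perm (Fin n),
      (pivotSet m).indicator (1 : (Fin n → ℝ) → ℝ≥0∞) (w ∘ (Equiv.mulLeft (Tuple.sort w) τ))
        = if ∀ i, (i < m → τ i < τ m) ∧ (m < i → τ m < τ i) then 1 else 0 := by
    intro τ
    have hiff : (w ∘ (Equiv.mulLeft (Tuple.sort w) τ)) ∈ pivotSet m
        ↔ ∀ i, (i < m → τ i < τ m) ∧ (m < i → τ m < τ i) := by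
      have hl : ∀ i j, w ((Equiv.mulLeft (Tuple.sort w) τ) i) < w ((Equiv.mulLeft (Tuple.sort w) τ) j)
          ↔ τ i < τ j := fun i j => hs.lt_iff_lt (a := τ i) (b := τ j)
      simp only [pivotSet, mem_ofPred_eq, Function.comp_apply, hl]
    by_cases h : ∀ i, (i < m → τ i < τ m) ∧ (m < i → τ m < τ i)
    · rw [if_pos h, indicator_of_mem (hiff.mpr h)]
      rfl
    · rw [if_neg h, indicator_of_notMem (fun hh => h (hiff.mp hh))]
  simp_rw [e]
  rw [Finset.sum_ite, Finset.sum_const_zero, add_zero, Finset.sum_const, nsmul_eq_mul, mul_one]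
  rfl

theorem pivotCount_mul_lintegral (m : Fin n) (ρ : Measure ℝ) [IsProbabilityMeasure ρ]
    (hρ : ∀ x, ρ {x} = 0) {F : (Fin n → ℝ) → ℝ≥0∞} (hF : Measurable F)
    (hsymm : ∀ (σ : Equiv.Perm (Fin n)) w, F (w ∘ σ) = F w) :
    pivotCount m * ∫⁻ w, F w ∂(Measure.pi fun _ : Fin n => ρ)
      = Fintype.card (Equiv.Perm (Fin n)) *
        ∫⁻ w, (pivotSet m).indicator F w ∂(Measure.pi fun _ : Fin n => ρ) := by
  have hFi : Measurable ((pivotSet m).indicator F) := hF.indicator (measurableSet_pivotSet m)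
  rw [← lintegral_const_mul _ hF]
  have h1 : ∫⁻ w, pivotCount m * F w ∂(Measure.pi fun _ : Fin n => ρ)
      = ∫⁻ w, ∑ σ : Equiv.Perm (Fin n), (pivotSet m).indicator F (w ∘ σ)
          ∂(Measure.pi fun _ : Fin n => ρ) := by
    refine lintegral_congr_ae ?_
    filter_upwards [ae_injective_pi ρ hρ] with w hw
    rw [← sum_indicator_pivotSet m hw, Finset.sum_mul]
    refine Finset.sum_congr rfl fun σ _ => ?_
    by_cases h : w ∘ σ ∈ pivotSet m
    · rw [indicator_of_mem h, indicator_of_mem h, hsymm, Pi.one_apply, one_mul]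
    · rw [indicator_of_notMem h, indicator_of_notMem h, zero_mul]
  have hcomp : ∀ σ : Equiv.Perm (Fin n), Measurable fun w : Fin n → ℝ => w ∘ σ := by
    intro σ; fun_prop
  have hFσ : ∀ σ : Equiv.Perm (Fin n), Measurable fun w => (pivotSet m).indicator F (w ∘ σ) :=
    fun σ => hFi.comp (hcomp σ)
  rw [h1, lintegral_finsetSum _ fun σ _ => hFσ σ]
  have h2 : ∀ σ : Equiv.Perm (Fin n), ∫⁻ w, (pivotSet m).indicator F (w ∘ σ)
      ∂(Measure.pi fun _ : Fin n => ρ) = ∫⁻ w, (pivotSet m).indicator F w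
      ∂(Measure.pi fun _ : Fin n => ρ) := by
    intro σ
    rw [← lintegral_map hFi (hcomp σ), pi_map_comp_equiv]
  simp only [h2, Finset.sum_const, Finset.card_univ, nsmul_eq_mul]

theorem lintegral_eq_of_pivotSet (m : Fin n) (ρ : Measure ℝ) [IsProbabilityMeasure ρ]
    (hρ : ∀ x, ρ {x} = 0) {F G : (Fin n → ℝ) → ℝ≥0∞} (hF : Measurable F) (hG : Measurable G)
    (hFs : ∀ (σ : Equiv.Perm (Fin n)) w, F (w ∘ σ) = F w)
    (hGs : ∀ (σ : Equiv.Perm (Fin n)) w, G (w ∘ σ) = G w)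
    (h : ∫⁻ w, (pivotSet m).indicator F w ∂(Measure.pi fun _ : Fin n => ρ)
      = ∫⁻ w, (pivotSet m).indicator G w ∂(Measure.pi fun _ : Fin n => ρ)) :
    ∫⁻ w, F w ∂(Measure.pi fun _ : Fin n => ρ) = ∫⁻ w, G w ∂(Measure.pi fun _ : Fin n => ρ) := by
  have h1 := pivotCount_mul_lintegral m ρ hρ hF hFs
  rw [h, ← pivotCount_mul_lintegral m ρ hρ hG hGs] at h1
  exact (ENNReal.mul_right_inj (by simpa using (pivotCount_pos m).ne') (by simp)).mp h1

/-! ### Sorted vectors -/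

theorem sorted_comp_perm (w : Fin n → ℝ) (σ : Equiv.Perm (Fin n)) (j : Fin n) :
    (w ∘ σ) (Tuple.sort (w ∘ σ) j) = w (Tuple.sort w j) :=
  congrFun (Tuple.comp_perm_comp_sort_eq_comp_sort (f := w) (σ := σ)) j

theorem sorted_le_iff (w : Fin n → ℝ) (j : Fin n) (c : ℝ) :
    w (Tuple.sort w j) ≤ c ↔ (j : ℕ) < (Finset.univ.filter fun i => w i ≤ c).card := by
  have h := Tuple.lt_card_le_iff_apply_le_of_monotone (f := w ∘ Tuple.sort w) (j := j) (a := c)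
    (Tuple.monotone_sort w)
  rw [Function.comp_apply] at h
  rw [← h]
  have : (Finset.univ.filter fun i => (w ∘ Tuple.sort w) i ≤ c).card
      = (Finset.univ.filter fun i => w i ≤ c).card := by
    refine Finset.card_equiv (Tuple.sort w) fun i => ?_
    simp
  rw [← this]

theorem measurable_sorted (j : Fin n) : Measurable fun w : Fin n → ℝ => w (Tuple.sort w j) := by
  refine measurable_of_Iic fun c => ?_
  have e : (fun w : Fin n → ℝ => w (Tuple.sort w j)) ⁻¹' Iic c
      = {w | ((j : ℕ) : ℝ) < ∑ i, if w i ≤ c then (1 : ℝ) else 0} := by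
    ext w
    simp only [mem_preimage, mem_Iic, mem_ofPred_eq, Finset.sum_boole]
    rw [sorted_le_iff]
    exact Nat.cast_lt.symm
  rw [e]
  refine measurableSet_lt measurable_const (Finset.measurable_sum _ fun i _ => ?_)
  exact Measurable.ite (measurableSet_le (measurable_pi_apply i) measurable_const)
    measurable_const measurable_const

theorem sort_pivot {m : Fin n} {w : Fin n → ℝ} (hw : Function.Injective w) (hE : w ∈ pivotSet m) :
    Tuple.sort w m = m ∧ ∀ i, m < Tuple.sort w i ↔ m < i := by
  set τ := Tuple.sort w
  have hs : StrictMono (w ∘ τ) := strictMono_comp_sort hw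
  have hlt : ∀ i, w i < w m ↔ i < m := by
    intro i
    constructor
    · intro h
      by_contra hcon
      rcases eq_or_lt_of_le (not_lt.mp hcon) with h' | h'
      · rw [h'] at h; exact lt_irrefl _ h
      · exact lt_asymm h ((hE i).2 h')
    · exact (hE i).1
  have hr : ∀ i, τ i < m ↔ i < τ.symm m := by
    intro i
    rw [← hlt, ← hs.lt_iff_lt]
    simp
  have hcard : (Finset.univ.filter fun i => i < τ.symm m).card
      = (Finset.univ.filter fun i => i < m).card :=
    Finset.card_equiv τ fun i => by simp [hr]
  have hm : τ.symm m = m := by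
    have e : ∀ j : Fin n, (Finset.univ.filter fun i => i < j).card = j := by
      intro j
      rw [Finset.filter_gt_eq_Iio, Fin.card_Iio]
    rw [e, e] at hcard
    exact Fin.ext hcard
  have hτm : τ m = m := by
    rw [← hm, Equiv.apply_symm_apply, hm]
  refine ⟨hτm, fun i => ?_⟩
  have h1 : τ i < m ↔ i < m := by rw [hr, hm]
  have h2 : τ i = m ↔ i = m := by
    constructor
    · intro h
      rw [← hm, ← h, Equiv.symm_apply_apply]
    · rintro rfl; exact hτm
  rw [← not_le, ← not_le, le_iff_lt_or_eq, le_iff_lt_or_eq, h1, h2]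

/-- The empirical measure, normalized by `k`, of the values of `g t` at the entries above the `m`-th
order statistic `t`. -/
noncomputable def upperMeasure (g : ℝ → ℝ → ℝ) (k : ℕ) (m : Fin n) (w : Fin n → ℝ) : Measure ℝ :=
  (k : ℝ≥0∞)⁻¹ • ∑ j ∈ Finset.univ.filter (m < ·),
    Measure.dirac (g (w (Tuple.sort w m)) (w (Tuple.sort w j)))

theorem upperMeasure_comp_perm (g : ℝ → ℝ → ℝ) (k : ℕ) (m : Fin n) (σ : Equiv.Perm (Fin n))
    (w : Fin n → ℝ) : upperMeasure g k m (w ∘ σ) = upperMeasure g k m w := by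
  simp only [upperMeasure, sorted_comp_perm]

theorem upperMeasure_pivot (g : ℝ → ℝ → ℝ) (k : ℕ) {m : Fin n} {w : Fin n → ℝ}
    (hw : Function.Injective w) (hE : w ∈ pivotSet m) :
    upperMeasure g k m w
      = (k : ℝ≥0∞)⁻¹ • ∑ j ∈ Finset.univ.filter (m < ·), Measure.dirac (g (w m) (w j)) := by
  obtain ⟨h1, h2⟩ := sort_pivot hw hE
  unfold upperMeasure
  rw [h1]
  congr 1
  exact Finset.sum_equiv (Tuple.sort w) (fun i => by simp [h2]) fun i _ => rfl

theorem measurable_smul_sum_dirac {α ι : Type*} [MeasurableSpace α] (c : ℝ≥0∞) (s : Finset ι)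
    {f : ι → α → ℝ} (hf : ∀ i, Measurable (f i)) :
    Measurable fun x => c • ∑ i ∈ s, Measure.dirac (f i x) := by
  refine Measure.measurable_of_measurable_coe _ fun B hB => ?_
  simp only [Measure.smul_apply, Measure.finsetSum_apply, smul_eq_mul]
  refine Measurable.const_mul (Finset.measurable_sum _ fun i _ => ?_) _
  exact (Measure.measurable_coe hB).comp (Measure.measurable_dirac.comp (hf i))

theorem measurable_upperMeasure {g : ℝ → ℝ → ℝ} (hg : Measurable (Function.uncurry g)) (k : ℕ)
    (m : Fin n) : Measurable (upperMeasure g k m) :=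
  measurable_smul_sum_dirac _ _ fun j =>
    hg.comp ((measurable_sorted m).prodMk (measurable_sorted j))

/-! ### The conditional law of the normalized exceedances -/

theorem pareto_singleton (x : ℝ) : paretoMeasure 1 1 {x} = 0 :=
  withDensity_absolutelyContinuous _ _ (measure_singleton x)

theorem pareto_restrict_Ioi_max {t : ℝ} (ht : 1 ≤ t) :
    (paretoMeasure 1 1).restrict (Ioi t)
      = ENNReal.ofReal (1 / t) • (paretoMeasure 1 1).map (fun z => t * max z 1) := by
  rw [pareto_restrict_Ioi ht]
  congr 1
  refine Measure.map_congr ?_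
  filter_upwards [ae_pareto_one_lt] with z hz
  rw [max_eq_left hz.le]

theorem pi_pareto_restrict {ι : Type*} [Fintype ι] {t : ℝ} (ht : 1 ≤ t) :
    (Measure.pi fun _ : ι => paretoMeasure 1 1).restrict (univ.pi fun _ => Ioi t)
      = (Measure.pi fun _ : ι => paretoMeasure 1 1) (univ.pi fun _ => Ioi t) •
        (Measure.pi fun _ : ι => paretoMeasure 1 1).map (fun v i => t * max (v i) 1) := by
  have hm : Measurable fun z : ℝ => t * max z 1 := by fun_prop
  have : IsProbabilityMeasure ((paretoMeasure 1 1).map fun z => t * max z 1) :=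
    Measure.isProbabilityMeasure_map hm.aemeasurable
  have hmap := Measure.pi_map_pi (μ := fun _ : ι => paretoMeasure 1 1)
    (f := fun _ z => t * max z 1) fun _ => hm.aemeasurable
  rw [Measure.restrict_pi_pi, hmap]
  refine Measure.pi_eq fun s hs => ?_
  rw [Measure.smul_apply, Measure.pi_pi, Measure.pi_pi, smul_eq_mul, ← Finset.prod_mul_distrib]
  refine Finset.prod_congr rfl fun i _ => ?_
  rw [pareto_restrict_Ioi_max ht, pareto_Ioi, max_eq_left ht]
  rfl

theorem map_pi_smul_sum_dirac {ι : Type*} [Fintype ι] {k : ℕ} (hk : Fintype.card ι = k)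
    (ρ : Measure ℝ) [IsProbabilityMeasure ρ] {f : ℝ → ℝ} (hf : Measurable f) :
    (Measure.pi fun _ : ι => ρ).map (fun v => (k : ℝ≥0∞)⁻¹ • ∑ j, Measure.dirac (f (v j)))
      = empiricalLaw k (ρ.map f) := by
  have e : Fin k ≃ ι := (Fintype.equivFinOfCardEq hk).symm
  have hm : Measurable fun y : Fin k → ℝ => sampleMeasure k fun i => f (y i) :=
    (measurable_sampleMeasure k).comp (by fun_prop)
  rw [empiricalLaw_map k ρ hf, ← pi_map_comp_equiv ρ e, Measure.map_map hm (by fun_prop)]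
  congr 1
  funext v
  simp only [sampleMeasure, Function.comp_apply]
  congr 1
  exact (Equiv.sum_comp e fun j => Measure.dirac (f (v j))).symm

section

variable {U a : ℝ → ℝ}

theorem measurable_excess (hU : Measurable U) (t : ℝ) : Measurable (excess U a t) := by
  unfold excess
  fun_prop

theorem lintegral_upper_block {ι : Type*} [Fintype ι] {k : ℕ} (hk : Fintype.card ι = k)
    (hU : Measurable U) {t : ℝ} (ht : 1 ≤ t) {ψ : Measure ℝ → ℝ≥0∞} (hψ : Measurable ψ) :
    ∫⁻ v, (univ.pi fun _ : ι => Ioi t).indicator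
        (fun v => ψ ((k : ℝ≥0∞)⁻¹ • ∑ j, Measure.dirac ((U (v j) - U t) / a t))) v
        ∂(Measure.pi fun _ : ι => paretoMeasure 1 1)
      = (Measure.pi fun _ : ι => paretoMeasure 1 1) (univ.pi fun _ => Ioi t) *
        ∫⁻ M, ψ M ∂empiricalLaw k ((paretoMeasure 1 1).map (excess U a t)) := by
  have hbox : MeasurableSet (univ.pi fun _ : ι => Ioi t) :=
    MeasurableSet.univ_pi fun _ => measurableSet_Ioi
  have h1 : Measurable fun v : ι → ℝ =>
      (k : ℝ≥0∞)⁻¹ • ∑ j, Measure.dirac ((U (v j) - U t) / a t) :=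
    measurable_smul_sum_dirac _ _ fun j => by fun_prop
  have h2 : Measurable fun v : ι → ℝ =>
      (k : ℝ≥0∞)⁻¹ • ∑ j, Measure.dirac (excess U a t (v j)) :=
    measurable_smul_sum_dirac _ _ fun j => (measurable_excess hU t).comp (measurable_pi_apply j)
  have h3 : Measurable fun v : ι → ℝ =>
      ψ ((k : ℝ≥0∞)⁻¹ • ∑ j, Measure.dirac ((U (v j) - U t) / a t)) := hψ.comp h1
  rw [lintegral_indicator hbox, pi_pareto_restrict ht, lintegral_smul_measure, smul_eq_mul,
    lintegral_map h3 (by fun_prop),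
    ← map_pi_smul_sum_dirac hk _ (measurable_excess hU t), lintegral_map hψ h2]
  rfl

/-- The kernel `t ↦` law of the empirical measure of `k` normalized excesses over `U t`. -/
noncomputable def excessKernel (U a : ℝ → ℝ) (k : ℕ) : Kernel ℝ (Measure ℝ) :=
  (Kernel.id ×ₖ Kernel.const ℝ (Measure.pi fun _ : Fin k => paretoMeasure 1 1)).map
    fun q => sampleMeasure k fun i => excess U a q.1 (q.2 i)

theorem measurable_sampleMeasure_excess (hU : Measurable U) (ha : Measurable a) (k : ℕ) :
    Measurable fun q : ℝ × (Fin k → ℝ) => sampleMeasure k fun i => excess U a q.1 (q.2 i) := by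
  refine (measurable_sampleMeasure k).comp (measurable_pi_iff.mpr fun i => ?_)
  unfold excess
  fun_prop

theorem excessKernel_apply (hU : Measurable U) (ha : Measurable a) (k : ℕ) (t : ℝ) :
    excessKernel U a k t = empiricalLaw k ((paretoMeasure 1 1).map (excess U a t)) := by
  have hm := measurable_sampleMeasure_excess hU ha k
  rw [excessKernel, Kernel.map_apply _ hm, Kernel.prod_apply, Kernel.id_apply,
    Kernel.const_apply, Measure.dirac_prod, Measure.map_map hm (by fun_prop),
    empiricalLaw_map k _ (measurable_excess hU t)]
  rfl

theorem isMarkovKernel_excessKernel (hU : Measurable U) (ha : Measurable a) (k : ℕ) :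
    IsMarkovKernel (excessKernel U a k) :=
  Kernel.IsMarkovKernel.map _ (measurable_sampleMeasure_excess hU ha k)

theorem lintegral_pivot_block {n k : ℕ} {m : Fin n} (hk : n = m + 1 + k) (hU : Measurable U)
    (ha : Measurable a) {φ : ℝ × Measure ℝ → ℝ≥0∞} (hφ : Measurable φ) :
    ∫⁻ w, (pivotSet m).indicator (fun w => φ (w m, (k : ℝ≥0∞)⁻¹ •
        ∑ j ∈ Finset.univ.filter (m < ·), Measure.dirac ((U (w j) - U (w m)) / a (w m)))) w
        ∂(Measure.pi fun _ : Fin n => paretoMeasure 1 1)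
      = ∫⁻ w, (pivotSet m).indicator (fun w => ∫⁻ M, φ (w m, M) ∂excessKernel U a k (w m)) w
        ∂(Measure.pi fun _ : Fin n => paretoMeasure 1 1) := by
  have := isMarkovKernel_excessKernel hU ha k
  have hK : Measurable fun t => ∫⁻ M, φ (t, M) ∂excessKernel U a k t :=
    Measurable.lintegral_kernel_prod_right' (κ := excessKernel U a k) hφ
  have hF : Measurable fun w : Fin n → ℝ => φ (w m, (k : ℝ≥0∞)⁻¹ •
      ∑ j ∈ Finset.univ.filter (m < ·), Measure.dirac ((U (w j) - U (w m)) / a (w m))) :=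
    hφ.comp ((measurable_pi_apply m).prodMk (measurable_smul_sum_dirac _ _ fun j => by fun_prop))
  have hE := measurableSet_pivotSet m
  have hFi := hF.indicator hE
  have hKi := (hK.comp (measurable_pi_apply m)).indicator hE
  set e := (MeasurableEquiv.piEquivPiSubtypeProd (fun _ : Fin n => ℝ) (· ≤ m)).symm with he
  have hpres : MeasurePreserving e _ (Measure.pi fun _ : Fin n => paretoMeasure 1 1) :=
    (measurePreserving_piEquivPiSubtypeProd (fun _ : Fin n => paretoMeasure 1 1) (· ≤ m)).symm _
  refine (hpres.lintegral_comp hFi).symm.trans (Eq.trans ?_ (hpres.lintegral_comp hKi))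
  refine (lintegral_prod _ (hFi.comp e.measurable).aemeasurable).trans (Eq.trans ?_
    (lintegral_prod _ (hKi.comp e.measurable).aemeasurable).symm)
  have hcard : Fintype.card {i : Fin n // ¬ i ≤ m} = k := by
    have h1 := Fintype.card_subtype_compl (fun i : Fin n => i ≤ m)
    have h2 : Fintype.card {i : Fin n // i ≤ m} = m + 1 := by
      rw [Fintype.card_subtype, Finset.filter_ge_eq_Iic, Fin.card_Iic]
    rw [h1, h2, Fintype.card_fin]
    omega
  have hae : ∀ᵐ u ∂(Measure.pi fun _ : {i : Fin n // i ≤ m} => paretoMeasure 1 1),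
      1 < u ⟨m, le_rfl⟩ :=
    (measurePreserving_eval (fun _ : {i : Fin n // i ≤ m} => paretoMeasure 1 1)
      ⟨m, le_rfl⟩).quasiMeasurePreserving.ae ae_pareto_one_lt
  refine lintegral_congr_ae ?_
  filter_upwards [hae] with u hu
  have hle : ∀ v i (h : i ≤ m), e (u, v) i = u ⟨i, h⟩ := fun v i h => dif_pos h
  have hgt : ∀ v i (h : ¬ i ≤ m), e (u, v) i = v ⟨i, h⟩ := fun v i h => dif_neg h
  set t := u ⟨m, le_rfl⟩ with ht
  by_cases hlow : ∀ i, (h : i < m) → u ⟨i, h.le⟩ < t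
  · have hmem : ∀ v, e (u, v) ∈ pivotSet m
        ↔ v ∈ univ.pi fun _ : {i : Fin n // ¬ i ≤ m} => Ioi t := by
      intro v
      simp only [pivotSet, mem_ofPred_eq, mem_univ_pi, mem_Ioi, hle v m le_rfl]
      constructor
      · intro h i
        have := (h i).2 (not_le.mp i.2)
        rwa [hgt v i i.2] at this
      · intro h i
        refine ⟨fun hi => ?_, fun hi => ?_⟩
        · rw [hle v i hi.le]; exact hlow i hi
        · rw [hgt v i (not_le.mpr hi)]; exact h ⟨i, not_le.mpr hi⟩
    have e1 : ∀ v, (pivotSet m).indicator (fun w => φ (w m, (k : ℝ≥0∞)⁻¹ •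
          ∑ j ∈ Finset.univ.filter (m < ·), Measure.dirac ((U (w j) - U (w m)) / a (w m)))) (e (u, v))
        = (univ.pi fun _ : {i : Fin n // ¬ i ≤ m} => Ioi t).indicator
          (fun v => φ (t, (k : ℝ≥0∞)⁻¹ • ∑ j, Measure.dirac ((U (v j) - U t) / a t))) v := by
      intro v
      by_cases hv : e (u, v) ∈ pivotSet m
      · rw [indicator_of_mem hv, indicator_of_mem ((hmem v).mp hv), hle v m le_rfl]
        congr 3
        rw [Finset.sum_subtype (p := fun i => ¬ i ≤ m) _ (fun x => by simp)]
        refine Finset.sum_congr rfl fun j _ => ?_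
        rw [hgt v j j.2]
      · rw [indicator_of_notMem hv, indicator_of_notMem fun h => hv ((hmem v).mpr h)]
    have e2 : ∀ v, (pivotSet m).indicator
          (fun w : Fin n → ℝ => ∫⁻ M, φ (w m, M) ∂excessKernel U a k (w m)) (e (u, v))
        = (univ.pi fun _ : {i : Fin n // ¬ i ≤ m} => Ioi t).indicator
          (fun _ => ∫⁻ M, φ (t, M) ∂excessKernel U a k t) v := by
      intro v
      by_cases hv : e (u, v) ∈ pivotSet m
      · rw [indicator_of_mem hv, indicator_of_mem ((hmem v).mp hv), hle v m le_rfl]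
      · rw [indicator_of_notMem hv, indicator_of_notMem fun h => hv ((hmem v).mpr h)]
    have hbox : MeasurableSet (univ.pi fun _ : {i : Fin n // ¬ i ≤ m} => Ioi t) :=
      MeasurableSet.univ_pi fun _ => measurableSet_Ioi
    refine (lintegral_congr e1).trans (Eq.trans ?_ (lintegral_congr e2).symm)
    rw [lintegral_upper_block (a := a) hcard hU hu.le (ψ := fun M => φ (t, M))
      (hφ.comp measurable_prodMk_left), lintegral_indicator_const hbox, excessKernel_apply hU ha,
      mul_comm]
  · push Not at hlow
    obtain ⟨i, hi, hui⟩ := hlow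
    have hnot : ∀ v, e (u, v) ∉ pivotSet m := by
      intro v hv
      have := (hv i).1 hi
      rw [hle v i hi.le, hle v m le_rfl] at this
      exact absurd this (not_lt.mpr hui)
    refine lintegral_congr fun v => ?_
    exact (indicator_of_notMem (hnot v) _).trans (indicator_of_notMem (hnot v) _).symm

theorem lintegral_upperMeasure {n k : ℕ} {m : Fin n} (hk : n = m + 1 + k) (hU : Measurable U)
    (ha : Measurable a) {φ : ℝ × Measure ℝ → ℝ≥0∞} (hφ : Measurable φ) :
    ∫⁻ w, φ (w (Tuple.sort w m), upperMeasure (fun t z => (U z - U t) / a t) k m w)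
        ∂(Measure.pi fun _ : Fin n => paretoMeasure 1 1)
      = ∫⁻ w, ∫⁻ M, φ (w (Tuple.sort w m), M) ∂excessKernel U a k (w (Tuple.sort w m))
        ∂(Measure.pi fun _ : Fin n => paretoMeasure 1 1) := by
  have := isMarkovKernel_excessKernel hU ha k
  have hK : Measurable fun t => ∫⁻ M, φ (t, M) ∂excessKernel U a k t :=
    Measurable.lintegral_kernel_prod_right' (κ := excessKernel U a k) hφ
  have hg : Measurable (Function.uncurry fun t z => (U z - U t) / a t) := by
    unfold Function.uncurry
    fun_prop
  refine lintegral_eq_of_pivotSet m _ pareto_singleton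
    (hφ.comp ((measurable_sorted m).prodMk (measurable_upperMeasure hg k m)))
    (hK.comp (measurable_sorted m)) (fun σ w => ?_) (fun σ w => ?_) ?_
  · rw [upperMeasure_comp_perm, sorted_comp_perm]
  · rw [sorted_comp_perm]
  · refine Eq.trans ?_ ((lintegral_pivot_block hk hU ha hφ).trans ?_)
    · refine lintegral_congr_ae ?_
      filter_upwards [ae_injective_pi _ pareto_singleton] with w hw
      by_cases hE : w ∈ pivotSet m
      · rw [indicator_of_mem hE, indicator_of_mem hE, upperMeasure_pivot _ _ hw hE,
          (sort_pivot hw hE).1]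
      · rw [indicator_of_notMem hE, indicator_of_notMem hE]
    · refine lintegral_congr_ae ?_
      filter_upwards [ae_injective_pi _ pareto_singleton] with w hw
      by_cases hE : w ∈ pivotSet m
      · rw [indicator_of_mem hE, indicator_of_mem hE, (sort_pivot hw hE).1]
      · rw [indicator_of_notMem hE, indicator_of_notMem hE]

theorem orderStat_eq {n j : ℕ} (h1 : 1 ≤ j) (hn : j ≤ n) (v : ℕ → ℝ) :
    orderStat n v j = v (Tuple.sort (fun i : Fin n => v i) ⟨j - 1, by omega⟩) :=
  dif_pos ⟨h1, hn⟩

theorem orderStat_comp (hU : MonotoneOn U (Ioi 1)) {n j : ℕ} (h1 : 1 ≤ j) (hn : j ≤ n)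
    {z : ℕ → ℝ} (hz : ∀ i, i < n → 1 < z i) :
    orderStat n (fun i => U (z i)) j = U (orderStat n z j) := by
  rw [orderStat_eq h1 hn, orderStat_eq h1 hn]
  have hmono : Monotone ((fun i : Fin n => U (z i)) ∘ Tuple.sort fun i : Fin n => z i) := by
    intro i j hij
    exact hU (hz _ (Fin.is_lt _)) (hz _ (Fin.is_lt _)) (Tuple.monotone_sort (fun i : Fin n => z i) hij)
  exact (congrFun (Tuple.comp_sort_eq_comp_iff_monotone.mpr hmono) _).symm

theorem exceedanceMeasure_eq (hU : MonotoneOn U (Ioi 1)) {n k : ℕ} (hkn : k < n)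
    {z : ℕ → ℝ} (hz : ∀ i, i < n → 1 < z i) :
    exceedanceMeasure U a n k z = upperMeasure (fun t z => (U z - U t) / a t) k
      ⟨n - k - 1, by omega⟩ fun i : Fin n => z i := by
  unfold exceedanceMeasure empiricalMeasure upperMeasure
  congr 1
  refine Finset.sum_bij (fun i hi => ⟨n - i, by simp only [Finset.mem_Icc] at hi; omega⟩) ?_ ?_ ?_ ?_
  · intro i hi
    simp only [Finset.mem_Icc] at hi
    simp only [Finset.mem_filter, Finset.mem_univ, true_and, Fin.mk_lt_mk]
    omega
  · intro i hi j hj hij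
    simp only [Finset.mem_Icc] at hi hj
    simp only [Fin.mk.injEq] at hij
    omega
  · intro j hj
    simp only [Finset.mem_filter, Finset.mem_univ, true_and, Fin.lt_def] at hj
    have := j.2
    exact ⟨n - j, by simp only [Finset.mem_Icc]; omega, by ext; simp only; omega⟩
  · intro i hi
    simp only [Finset.mem_Icc] at hi
    dsimp only
    rw [orderStat_comp hU (by omega) (by omega) hz, orderStat_comp hU (by omega) (by omega) hz,
      orderStat_eq (by omega) (by omega), orderStat_eq (by omega) (by omega)]
    have e : n + 1 - i - 1 = n - i := by omega
    simp only [e]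

end

theorem ae_one_lt {Ω : Type*} [MeasurableSpace Ω] {P : Measure Ω} {Z : ℕ → Ω → ℝ}
    (hZ : ∀ i, Measurable (Z i))
    (hlaw : ∀ i, HasLaw (Z i) (paretoMeasure 1 1) P) : ∀ᵐ ω ∂P, ∀ i, 1 < Z i ω := by
  rw [ae_all_iff]
  intro i
  refine ae_of_ae_map (hZ i).aemeasurable (p := fun z => 1 < z) ?_
  rw [(hlaw i).map_eq]
  exact ae_pareto_one_lt

section

variable {U a : ℝ → ℝ} {Ω : Type*} [MeasurableSpace Ω] {P : Measure Ω} [IsProbabilityMeasure P]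
  {Z : ℕ → Ω → ℝ}

theorem map_sample_eq_pi (hZ : ∀ i, Measurable (Z i))
    (hlaw : ∀ i, HasLaw (Z i) (paretoMeasure 1 1) P) (hind : iIndepFun Z P) (n : ℕ) :
    P.map (fun ω (i : Fin n) => Z i ω) = Measure.pi fun _ : Fin n => paretoMeasure 1 1 := by
  have h : iIndepFun (fun i : Fin n => Z i) P :=
    hind.precomp (g := fun i : Fin n => (i : ℕ)) Fin.val_injective
  have h2 := (iIndepFun_iff_map_fun_eq_pi_map fun i => (hZ _).aemeasurable).mp h
  simpa only [(hlaw _).map_eq] using h2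

theorem measurable_orderStat (hZ : ∀ i, Measurable (Z i)) {n j : ℕ} (h1 : 1 ≤ j) (hn : j ≤ n) :
    Measurable fun ω => orderStat n (fun i => Z i ω) j := by
  simp only [orderStat_eq h1 hn]
  exact (measurable_sorted (⟨j - 1, by omega⟩ : Fin n)).comp
    (measurable_pi_iff.mpr fun i : Fin n => hZ i)

theorem isCondLaw_excessKernel (hUm : Measurable U) (ha : Measurable a)
    (hU : MonotoneOn U (Ioi 1)) (hZ : ∀ i, Measurable (Z i))
    (hlaw : ∀ i, HasLaw (Z i) (paretoMeasure 1 1) P) (hind : iIndepFun Z P) {n k : ℕ}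
    (hkn : k < n) :
    IsCondLaw P (fun ω => orderStat n (fun i => Z i ω) (n - k))
      (fun ω => exceedanceMeasure U a n k fun i => Z i ω) (excessKernel U a k) := by
  have hmk := isMarkovKernel_excessKernel hUm ha k
  refine ⟨hmk, ?_⟩
  set m : Fin n := ⟨n - k - 1, by omega⟩ with hm
  set W : Ω → Fin n → ℝ := fun ω i => Z i ω with hW
  have hWm : Measurable W := measurable_pi_iff.mpr fun i => hZ i
  have hg : Measurable (Function.uncurry fun t z => (U z - U t) / a t) := by
    unfold Function.uncurry
    fun_prop
  have hY := measurable_upperMeasure hg k m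
  have hT := measurable_sorted m
  have hTe : (fun ω => orderStat n (fun i => Z i ω) (n - k))
      = fun ω => W ω (Tuple.sort (W ω) m) := by
    funext ω
    exact orderStat_eq (by omega) (by omega) _
  have hYe : (fun ω => (orderStat n (fun i => Z i ω) (n - k),
      exceedanceMeasure U a n k fun i => Z i ω)) =ᵐ[P] fun ω => (W ω (Tuple.sort (W ω) m),
        upperMeasure (fun t z => (U z - U t) / a t) k m (W ω)) := by
    filter_upwards [ae_one_lt hZ hlaw] with ω hω
    rw [exceedanceMeasure_eq hU hkn fun i _ => hω i, orderStat_eq (by omega) (by omega)]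
  rw [Measure.map_congr hYe, hTe]
  have hTW : Measurable fun ω => W ω (Tuple.sort (W ω) m) := hT.comp hWm
  have : IsProbabilityMeasure (P.map fun ω => W ω (Tuple.sort (W ω) m)) :=
    Measure.isProbabilityMeasure_map hTW.aemeasurable
  refine Measure.ext_of_lintegral _ fun φ hφ => ?_
  have hYW : Measurable fun ω => upperMeasure (fun t z => (U z - U t) / a t) k m (W ω) := hY.comp hWm
  rw [lintegral_map hφ (hTW.prodMk hYW), Measure.lintegral_compProd hφ,
    lintegral_map (Measurable.lintegral_kernel_prod_right' (κ := excessKernel U a k) hφ) hTW]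
  have h := lintegral_upperMeasure (k := k) (m := m) (by simp only [hm]; omega) hUm ha hφ
  rw [← map_sample_eq_pi hZ hlaw hind n] at h
  refine ((lintegral_map (hφ.comp (hT.prodMk hY)) hWm).symm.trans h).trans ?_
  exact lintegral_map
    ((Measurable.lintegral_kernel_prod_right' (κ := excessKernel U a k) hφ).comp hT) hWm

end

/-! ### Uniqueness of the conditional law -/

/-- The values of a measure on the half-lines with rational endpoints. -/
noncomputable def ratCDF (m : Measure ℝ) : ℚ → ℝ≥0∞ := fun q => m (Iic (q : ℝ))

theorem measurable_ratCDF : Measurable ratCDF :=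
  measurable_pi_iff.mpr fun _ => Measure.measurable_coe measurableSet_Iic

theorem measurableSpace_real_eq_generateFrom_Iic_rat :
    (inferInstance : MeasurableSpace ℝ) = MeasurableSpace.generateFrom (⋃ q : ℚ, {Iic (q : ℝ)}) := by
  rw [← Real.borel_eq_generateFrom_Iic_rat]
  exact BorelSpace.measurable_eq

theorem eq_of_map_ratCDF_eq {M₁ M₂ : Measure (Measure ℝ)} (h₁ : ∀ᵐ m ∂M₁, m univ = 1)
    (h₂ : ∀ᵐ m ∂M₂, m univ = 1) (h : M₁.map ratCDF = M₂.map ratCDF) : M₁ = M₂ := by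
  let S := {m : Measure ℝ // m univ = 1}
  let mS : MeasurableSpace S := MeasurableSpace.comap (fun m : S => ratCDF m.1) inferInstance
  have hval : @Measurable S (Measure ℝ) mS _ Subtype.val := by
    have : ∀ m : S, IsProbabilityMeasure m.1 := fun m => ⟨m.2⟩
    refine @Measurable.measure_of_isPiSystem_of_isProbabilityMeasure S ℝ mS _ Subtype.val _ _
      measurableSpace_real_eq_generateFrom_Iic_rat Real.isPiSystem_Iic_rat ?_
    intro s hs
    simp only [mem_iUnion, mem_singleton_iff] at hs
    obtain ⟨q, rfl⟩ := hs
    exact (measurable_pi_apply q).comp (comap_measurable fun m : S => ratCDF m.1)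
  ext B hB
  obtain ⟨C, hC, hCB⟩ := hval hB
  have key : ∀ M : Measure (Measure ℝ), (∀ᵐ m ∂M, m univ = 1) → M B = M.map ratCDF C := by
    intro M hM
    rw [Measure.map_apply measurable_ratCDF hC]
    refine measure_congr ?_
    filter_upwards [hM] with m hm
    have := Set.ext_iff.mp hCB ⟨m, hm⟩
    exact propext this.symm
  rw [key M₁ h₁, key M₂ h₂, h]

theorem IsCondLaw.ae_eq {Ω : Type*} [MeasurableSpace Ω] {P : Measure Ω} [IsProbabilityMeasure P]
    {T : Ω → ℝ} {Y : Ω → Measure ℝ} {κ₁ κ₂ : Kernel ℝ (Measure ℝ)}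
    (h₁ : IsCondLaw P T Y κ₁) (h₂ : IsCondLaw P T Y κ₂)
    (hκ : ∀ t, ∀ᵐ m ∂κ₁ t, m univ = 1) : ∀ᵐ t ∂P.map T, κ₁ t = κ₂ t := by
  have i₁ := h₁.isMarkov
  have i₂ := h₂.isMarkov
  have heq : P.map T ⊗ₘ κ₁ = P.map T ⊗ₘ κ₂ := h₁.map_eq.symm.trans h₂.map_eq
  have hS : MeasurableSet {q : ℝ × Measure ℝ | q.2 univ = 1} :=
    measurableSet_eq_fun ((Measure.measurable_coe .univ).comp measurable_snd) measurable_const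
  have hκ₂ : ∀ᵐ t ∂P.map T, ∀ᵐ m ∂κ₂ t, m univ = 1 := by
    refine Measure.ae_ae_of_ae_compProd (p := fun q : ℝ × Measure ℝ => q.2 univ = 1) ?_
    rw [← heq]
    exact (Measure.ae_compProd_iff hS).mpr (ae_of_all _ hκ)
  have hmap : P.map T ⊗ₘ (κ₁.map ratCDF) = P.map T ⊗ₘ (κ₂.map ratCDF) := by
    rw [Measure.compProd_map measurable_ratCDF, Measure.compProd_map measurable_ratCDF, heq]
  have j₁ := Kernel.IsMarkovKernel.map κ₁ measurable_ratCDF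
  have j₂ := Kernel.IsMarkovKernel.map κ₂ measurable_ratCDF
  filter_upwards [Kernel.ae_eq_of_compProd_eq hmap, hκ₂] with t ht ht₂
  rw [Kernel.map_apply _ measurable_ratCDF, Kernel.map_apply _ measurable_ratCDF] at ht
  exact eq_of_map_ratCDF_eq (hκ t) ht₂ ht

/-! ### Intermediate order statistics -/

/-- The number of exceedances over `x` among the first `n` variables. -/
noncomputable def exceedanceCount {Ω : Type*} (Z : ℕ → Ω → ℝ) (n : ℕ) (x : ℝ) (ω : Ω) : ℝ :=
  ∑ i ∈ Finset.range n, (Ioi x).indicator 1 (Z i ω)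

theorem orderStat_le_iff {Ω : Type*} {Z : ℕ → Ω → ℝ} {n k : ℕ} (hkn : k < n) (x : ℝ) (ω : Ω) :
    orderStat n (fun i => Z i ω) (n - k) ≤ x ↔ exceedanceCount Z n x ω ≤ k := by
  rw [orderStat_eq (by omega) (by omega)]
  refine (sorted_le_iff (fun i : Fin n => Z i ω) ⟨n - k - 1, by omega⟩ x).trans ?_
  have hsum : exceedanceCount Z n x ω
      = n - ((Finset.univ.filter fun i : Fin n => Z i ω ≤ x).card : ℝ) := by
    unfold exceedanceCount
    rw [← Fin.sum_univ_eq_sum_range (fun i => (Ioi x).indicator (1 : ℝ → ℝ) (Z i ω))]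
    have h1 : ∀ i : Fin n, (Ioi x).indicator (1 : ℝ → ℝ) (Z i ω)
        = 1 - if Z i ω ≤ x then 1 else 0 := by
      intro i
      by_cases h : Z i ω ≤ x
      · rw [if_pos h, indicator_of_notMem (by simpa using h)]
        simp
      · rw [if_neg h, indicator_of_mem (by simpa using h)]
        simp
    simp only [h1, Finset.sum_sub_distrib, Finset.sum_const, Finset.card_univ, Fintype.card_fin,
      nsmul_eq_mul, mul_one, Finset.sum_boole]
  rw [hsum, sub_le_iff_le_add, ← Nat.cast_add, Nat.cast_le]
  dsimp only
  omega

theorem ae_one_lt_orderStat {Ω : Type*} [MeasurableSpace Ω] {P : Measure Ω}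
    {Z : ℕ → Ω → ℝ} (hZ : ∀ i, Measurable (Z i))
    (hlaw : ∀ i, HasLaw (Z i) (paretoMeasure 1 1) P) {n k : ℕ} (hkn : k < n) :
    ∀ᵐ t ∂P.map (fun ω => orderStat n (fun i => Z i ω) (n - k)), 1 < t := by
  refine (ae_map_iff (measurable_orderStat hZ (by omega) (by omega)).aemeasurable
    measurableSet_Ioi).mpr ?_
  filter_upwards [ae_one_lt hZ hlaw] with ω hω
  rw [orderStat_eq (by omega) (by omega)]
  exact hω _

section

variable {Ω : Type*} [MeasurableSpace Ω] {P : Measure Ω} [IsProbabilityMeasure P]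
  {Z : ℕ → Ω → ℝ}

theorem exceedanceCount_chebyshev (hZ : ∀ i, Measurable (Z i))
    (hlaw : ∀ i, HasLaw (Z i) (paretoMeasure 1 1) P) (hind : iIndepFun Z P) (n : ℕ) {x δ : ℝ}
    (hx : 1 ≤ x) (hδ : 0 < δ) :
    P {ω | δ ≤ |exceedanceCount Z n x ω - n / x|} ≤ ENNReal.ofReal (n / x / δ ^ 2) := by
  have hx0 : 0 < x := by linarith
  set Y : ℕ → Ω → ℝ := fun i ω => (Ioi x).indicator 1 (Z i ω) with hY
  have hind1 : Measurable ((Ioi x).indicator (1 : ℝ → ℝ)) :=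
    measurable_one.indicator measurableSet_Ioi
  have hYm : ∀ i, Measurable (Y i) := fun i => hind1.comp (hZ i)
  have hYb : ∀ i ω, ‖Y i ω‖ ≤ 1 := by
    intro i ω
    refine (norm_indicator_le_norm_self _ _).trans ?_
    simp
  have hYL : ∀ i, MemLp (Y i) 2 P := fun i =>
    MemLp.of_bound (hYm i).aestronglyMeasurable 1 (ae_of_all _ (hYb i))
  have hYint : ∀ i, ∫ ω, Y i ω ∂P = 1 / x := by
    intro i
    have e : Y i = (Z i ⁻¹' Ioi x).indicator 1 := by
      funext ω
      simp [hY, indicator]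
    rw [e, integral_indicator_one ((hZ i) measurableSet_Ioi), measureReal_def,
      ← Measure.map_apply (hZ i) measurableSet_Ioi, (hlaw i).map_eq, pareto_Ioi, max_eq_left hx,
      ENNReal.toReal_ofReal (by positivity)]
  have hvar : ∀ i, variance (Y i) P ≤ 1 / x := by
    intro i
    refine (variance_le_expectation_sq (hYm i).aestronglyMeasurable).trans ?_
    rw [← hYint i]
    refine le_of_eq (integral_congr_ae (ae_of_all _ fun ω => ?_))
    by_cases h : Z i ω ∈ Ioi x
    · simp [hY, indicator_of_mem h]
    · simp [hY, indicator_of_notMem h]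
  have hS : exceedanceCount Z n x = ∑ i ∈ Finset.range n, Y i := by
    funext ω
    simp [exceedanceCount, hY]
  have hSL : MemLp (exceedanceCount Z n x) 2 P := by
    rw [hS]
    exact memLp_finsetSum' _ fun i _ => hYL i
  have hSvar : variance (exceedanceCount Z n x) P ≤ n / x := by
    rw [hS, IndepFun.variance_sum (fun i _ => hYL i)
      fun i _ j _ hij => (hind.indepFun hij).comp hind1 hind1]
    refine (Finset.sum_le_sum fun i _ => hvar i).trans ?_
    simp [div_eq_mul_inv]
  have hSint : ∫ ω, exceedanceCount Z n x ω ∂P = n / x := by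
    simp only [exceedanceCount]
    rw [integral_finsetSum _ fun i _ => (hYL i).integrable (by norm_num)]
    refine (Finset.sum_congr rfl fun i _ => hYint i).trans ?_
    simp [div_eq_mul_inv]
  have h := meas_ge_le_variance_div_sq hSL hδ
  rw [hSint] at h
  refine h.trans (ENNReal.ofReal_le_ofReal ?_)
  gcongr

theorem tendsto_exceedanceCount (hZ : ∀ i, Measurable (Z i))
    (hlaw : ∀ i, HasLaw (Z i) (paretoMeasure 1 1) P) (hind : iIndepFun Z P) {k : ℕ → ℕ}
    (hk : Tendsto k atTop atTop) (hkn : Tendsto (fun n => (k n : ℝ) / n) atTop (𝓝 0)) {c : ℝ}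
    (hc : 0 < c) (hc1 : c ≠ 1) :
    Tendsto (fun n => P {ω | |(k n : ℝ) - k n / c|
      ≤ |exceedanceCount Z n (c * (n / k n)) ω - k n / c|}) atTop (𝓝 0) := by
  have hkR : Tendsto (fun n => (k n : ℝ)) atTop atTop := tendsto_natCast_atTop_atTop.comp hk
  have hd : 1 - 1 / c ≠ 0 := by
    rw [sub_ne_zero, ne_comm, ne_eq, div_eq_one_iff_eq hc.ne']
    exact fun h => hc1 h.symm
  have hlim : Tendsto (fun n => ENNReal.ofReal (1 / c / (1 - 1 / c) ^ 2 / k n)) atTop (𝓝 0) := by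
    rw [← ENNReal.ofReal_zero]
    exact ENNReal.tendsto_ofReal (tendsto_const_nhds.div_atTop hkR)
  refine tendsto_of_tendsto_of_tendsto_of_le_of_le' tendsto_const_nhds hlim
    (Eventually.of_forall fun _ => zero_le) ?_
  filter_upwards [hkR.eventually_gt_atTop 0, eventually_gt_atTop 0,
    hkn.eventually (gt_mem_nhds hc)] with n hk0 hn0 hkc
  have hn : (0 : ℝ) < n := by exact_mod_cast hn0
  have hx : 1 ≤ c * (n / k n) := by
    rw [div_lt_iff₀ hn] at hkc
    rw [← mul_div_assoc, le_div_iff₀ hk0]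
    linarith
  have hδ : 0 < |(k n : ℝ) - k n / c| := by
    have : (k n : ℝ) - k n / c = k n * (1 - 1 / c) := by ring
    rw [this]
    exact abs_pos.mpr (mul_ne_zero hk0.ne' hd)
  have h := exceedanceCount_chebyshev hZ hlaw hind n hx hδ
  have e : (n : ℝ) / (c * (n / k n)) = k n / c := by field_simp
  rw [e] at h
  refine h.trans (ENNReal.ofReal_le_ofReal (le_of_eq ?_))
  rw [sq_abs]
  have : (k n : ℝ) - k n / c = k n * (1 - 1 / c) := by ring
  rw [this]
  field_simp

theorem eventually_lt_of_tendsto_div {k : ℕ → ℕ}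
    (hkn : Tendsto (fun n => (k n : ℝ) / n) atTop (𝓝 0)) : ∀ᶠ n in atTop, k n < n := by
  filter_upwards [hkn.eventually (gt_mem_nhds one_pos), eventually_gt_atTop 0] with n h1 h2
  rw [div_lt_one (by exact_mod_cast h2)] at h1
  exact_mod_cast h1

theorem tendsto_orderStat_div (hZ : ∀ i, Measurable (Z i))
    (hlaw : ∀ i, HasLaw (Z i) (paretoMeasure 1 1) P) (hind : iIndepFun Z P) {k : ℕ → ℕ}
    (hk : Tendsto k atTop atTop) (hkn : Tendsto (fun n => (k n : ℝ) / n) atTop (𝓝 0)) {ε : ℝ}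
    (hε : 0 < ε) (hε1 : ε < 1) :
    Tendsto (fun n => P {ω | ε < |orderStat n (fun i => Z i ω) (n - k n) / (n / k n) - 1|}) atTop
      (𝓝 0) := by
  have h1 := tendsto_exceedanceCount hZ hlaw hind hk hkn (c := 1 + ε) (by linarith) (by linarith)
  have h2 := tendsto_exceedanceCount hZ hlaw hind hk hkn (c := 1 - ε) (by linarith) (by linarith)
  have h3 := h1.add h2
  rw [add_zero] at h3
  refine tendsto_of_tendsto_of_tendsto_of_le_of_le' tendsto_const_nhds h3
    (Eventually.of_forall fun _ => zero_le) ?_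
  filter_upwards [eventually_lt_of_tendsto_div hkn, hk.eventually_gt_atTop 0] with n hlt hk0
  refine (measure_mono fun ω hω => ?_).trans (measure_union_le _ _)
  simp only [mem_ofPred_eq] at hω
  have hkR : (0 : ℝ) < k n := by exact_mod_cast hk0
  have hnR : (0 : ℝ) < n := by exact_mod_cast hk0.trans hlt
  have hq : (0 : ℝ) < n / k n := by positivity
  rw [lt_abs] at hω
  rcases hω with h | h
  · left
    have hgt : ¬ orderStat n (fun i => Z i ω) (n - k n) ≤ (1 + ε) * (n / k n) := by
      rw [not_le, ← lt_div_iff₀ hq]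
      linarith
    rw [orderStat_le_iff hlt, not_le] at hgt
    have h4 : (k n : ℝ) / (1 + ε) ≤ k n := div_le_self hkR.le (by linarith)
    simp only [mem_ofPred_eq]
    rw [abs_of_nonneg (by linarith), abs_of_nonneg (by linarith)]
    linarith
  · right
    have hle : orderStat n (fun i => Z i ω) (n - k n) ≤ (1 - ε) * (n / k n) := by
      rw [← div_le_iff₀ hq]
      linarith
    rw [orderStat_le_iff hlt] at hle
    have h4 : (k n : ℝ) ≤ k n / (1 - ε) := by
      rw [le_div_iff₀ (by linarith)]
      nlinarith
    simp only [mem_ofPred_eq]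
    rw [abs_of_nonpos (by linarith), abs_of_nonpos (by linarith)]
    linarith

end

/-! ### Assembly -/

section

variable {U a A : ℝ → ℝ} {γ ρ p : ℝ}

theorem map_cond_excess {Ω : Type*} [MeasurableSpace Ω] {P : Measure Ω} [IsProbabilityMeasure P]
    {Z : Ω → ℝ} (hUm : Measurable U) (hZ : Measurable Z) (hlaw : HasLaw Z (paretoMeasure 1 1) P)
    {t : ℝ} (ht : 1 ≤ t) :
    (ProbabilityTheory.cond P {ω | t < Z ω}).map (fun ω => (U (Z ω) - U t) / a t)
      = (paretoMeasure 1 1).map (excess U a t) := by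
  rw [map_cond_pareto P hZ hlaw ht (f := fun z => (U z - U t) / a t) (by fun_prop)]
  refine Measure.map_congr ?_
  filter_upwards [ae_pareto_one_lt] with z hz
  rw [excess, max_eq_left hz.le]

theorem SecondOrder.tendsto_APrime_uniform (h : SecondOrder U a A γ ρ)
    (hc : 0 < cPrime γ ρ p)
    (hrate : Tendsto (fun t => (APrime U a γ p t).toReal / |A t|) atTop (𝓝 (cPrime γ ρ p))) :
    Tendsto (fun q : ℝ × ℝ => (APrime U a γ p (q.1 * q.2)).toReal / (cPrime γ ρ p * |A q.1|))
      (atTop ×ˢ 𝓝 1) (𝓝 1) := by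
  have hmul : Tendsto (fun q : ℝ × ℝ => q.1 * q.2) (atTop ×ˢ 𝓝 1) atTop :=
    tendsto_fst.atTop_mul_pos one_pos tendsto_snd
  have h1 := ((hrate.comp hmul).mul h.regularlyVarying.tendsto_uniform).div_const (cPrime γ ρ p)
  rw [mul_one, div_self hc.ne'] at h1
  refine h1.congr' ?_
  filter_upwards [hmul.eventually h.regularlyVarying.eventually_ne] with q hq
  have : |A (q.1 * q.2)| ≠ 0 := abs_ne_zero.mpr hq
  simp only [Function.comp_apply]
  field_simp

theorem excessKernel_props (hUm : Measurable U) (ham : Measurable a) (hU : MonotoneOn U (Ioi 1))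
    (ha : ∀ t, 1 < t → 0 < a t) (hF : FirstOrder U a γ) (hp : 1 ≤ p) (hpγ : p * max γ 0 < 1)
    {k : ℕ} (hk : 1 ≤ k) {t : ℝ} (ht : 1 < t) :
    MemWasserstein₂ p (excessKernel U a k t) ∧
      wasserstein₂ p (excessKernel U a k t) (empiricalLaw k (gpd γ)) = APrime U a γ p t := by
  rw [excessKernel_apply hUm ham]
  exact ⟨memWasserstein₂_empiricalLaw hk (hF.memWasserstein_excess hU ha hp hpγ ht),
    wasserstein₂_excess hU γ hp hk ht (ha t ht)⟩

theorem IsCondLaw.ae_props {Ω : Type*} [MeasurableSpace Ω] {P : Measure Ω}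
    [IsProbabilityMeasure P] {Z : ℕ → Ω → ℝ}
    (hUm : Measurable U) (ham : Measurable a) (hU : MonotoneOn U (Ioi 1))
    (ha : ∀ t, 1 < t → 0 < a t) (hF : FirstOrder U a γ) (hp : 1 ≤ p) (hpγ : p * max γ 0 < 1)
    (hZ : ∀ i, Measurable (Z i)) (hlaw : ∀ i, HasLaw (Z i) (paretoMeasure 1 1) P)
    (hind : iIndepFun Z P) {n k : ℕ} (hk : 1 ≤ k) (hkn : k < n) {κ : Kernel ℝ (Measure ℝ)}
    (hκ : IsCondLaw P (fun ω => orderStat n (fun i => Z i ω) (n - k))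
      (fun ω => exceedanceMeasure U a n k fun i => Z i ω) κ) :
    ∀ᵐ t ∂P.map (fun ω => orderStat n (fun i => Z i ω) (n - k)), MemWasserstein₂ p (κ t) ∧
      wasserstein₂ p (κ t) (empiricalLaw k (gpd γ)) = APrime U a γ p t := by
  have h := (isCondLaw_excessKernel hUm ham hU hZ hlaw hind hkn).ae_eq hκ fun t => by
    rw [excessKernel_apply hUm ham]
    exact ae_empiricalLaw_univ hk _
  filter_upwards [h, ae_one_lt_orderStat hZ hlaw hkn] with t ht ht1
  rw [← ht]
  exact excessKernel_props hUm ham hU ha hF hp hpγ hk ht1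

theorem SecondOrder.tendstoInMeasure {Ω : Type*} [MeasurableSpace Ω] {P : Measure Ω}
    [IsProbabilityMeasure P] {Z : ℕ → Ω → ℝ} (h : SecondOrder U a A γ ρ)
    (hUm : Measurable U) (ham : Measurable a) (hU : MonotoneOn U (Ioi 1))
    (ha : ∀ t, 1 < t → 0 < a t) (hF : FirstOrder U a γ) (hp : 1 ≤ p) (hpγ : p * max γ 0 < 1)
    (hZ : ∀ i, Measurable (Z i)) (hlaw : ∀ i, HasLaw (Z i) (paretoMeasure 1 1) P)
    (hind : iIndepFun Z P) {k : ℕ → ℕ} (hk : Tendsto k atTop atTop)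
    (hkn : Tendsto (fun n => (k n : ℝ) / n) atTop (𝓝 0)) {κ : ℕ → Kernel ℝ (Measure ℝ)}
    (hκ : ∀ᶠ n in atTop, IsCondLaw P (fun ω => orderStat n (fun i => Z i ω) (n - k n))
      (fun ω => exceedanceMeasure U a n (k n) fun i => Z i ω) (κ n)) :
    TendstoInMeasure P
      (fun n ω => (wasserstein₂ p (κ n (orderStat n (fun i => Z i ω) (n - k n)))
        (empiricalLaw (k n) (gpd γ))).toReal / (cPrime γ ρ p * |A (n / k n)|))
      atTop (fun _ => (1 : ℝ)) := by
  obtain ⟨-, hc, hrate⟩ := h.rate hU hUm ham ha hF hp hpγ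
  have hunif := h.tendsto_APrime_uniform hc hrate
  have hkR : Tendsto (fun n => (k n : ℝ)) atTop atTop := tendsto_natCast_atTop_atTop.comp hk
  have hq : Tendsto (fun n : ℕ => (n : ℝ) / k n) atTop atTop := by
    have hpos : ∀ᶠ n : ℕ in atTop, (k n : ℝ) / n ∈ Ioi (0 : ℝ) := by
      filter_upwards [hkR.eventually_gt_atTop 0, eventually_gt_atTop 0] with n h1 h2
      have : (0 : ℝ) < n := by exact_mod_cast h2
      exact div_pos h1 this
    refine (tendsto_inv_nhdsGT_zero.comp (tendsto_nhdsWithin_iff.mpr ⟨hkn, hpos⟩)).congr fun n => ?_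
    simp
  rw [tendstoInMeasure_iff_dist]
  intro ε hε
  obtain ⟨pa, hpa, pb, hpb, hprod⟩ := eventually_prod_iff.mp
    (hunif.eventually (Metric.ball_mem_nhds 1 hε))
  obtain ⟨δ, hδ, hball⟩ := Metric.eventually_nhds_iff.mp hpb
  set δ' := min (δ / 2) (1 / 2)
  have hδ' : 0 < δ' := by positivity
  have hlim := tendsto_orderStat_div hZ hlaw hind hk hkn hδ'
    ((min_le_right _ _).trans_lt (by norm_num))
  refine tendsto_of_tendsto_of_tendsto_of_le_of_le' tendsto_const_nhds hlim
    (Eventually.of_forall fun _ => zero_le) ?_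
  filter_upwards [hκ, eventually_lt_of_tendsto_div hkn, hk.eventually_ge_atTop 1,
    hq.eventually hpa, hq.eventually_gt_atTop 0] with n hκn hlt hk1 hn hn0
  have hae := ae_of_ae_map (measurable_orderStat hZ (by omega) (by omega)).aemeasurable
    (hκn.ae_props hUm ham hU ha hF hp hpγ hZ hlaw hind hk1 hlt)
  refine measure_mono_ae ?_
  filter_upwards [hae] with ω hω hmem
  change ε ≤ _ at hmem
  rw [hω.2] at hmem
  change δ' < _
  by_contra hcon
  rw [not_lt] at hcon
  have hlt' : |orderStat n (fun i => Z i ω) (n - k n) / (n / k n) - 1| < δ :=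
    (hcon.trans (min_le_left _ _)).trans_lt (by linarith)
  have := hprod hn (hball (y := orderStat n (fun i => Z i ω) (n - k n) / (n / k n))
    (by rwa [Real.dist_eq]))
  dsimp only at this
  rw [mul_div_cancel₀ _ hn0.ne'] at this
  exact absurd this (not_lt.mpr hmem)

end

end PoT

theorem mainTheorem7
    -- the distribution `F = cdf μ ∈ D(G_γ)` and its normalizing function `a`
    (μ : Measure ℝ) [IsProbabilityMeasure μ] (γ p : ℝ) (hγ : γ < 1) (hF : InMaxDomain μ γ)
    (a : ℝ → ℝ) (ha_meas : Measurable a) (ha_pos : ∀ t, 1 < t → 0 < a t)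
    (ha : FirstOrder (tailQuantile μ) a γ)
    -- `p ∈ [1, 1 / γ₊)`
    (hp : 1 ≤ p) (hpγ : p * max γ 0 < 1)
    -- i.i.d. standard unit Pareto variables `Z`; the observations are `X = U (Z)`
    {Ω : Type*} [MeasurableSpace Ω] (P : Measure Ω) [IsProbabilityMeasure P]
    (Z : ℕ → Ω → ℝ) (hZ_meas : ∀ i, Measurable (Z i))
    (hZ_law : ∀ i, HasLaw (Z i) (paretoMeasure 1 1) P) (hZ_indep : iIndepFun Z P)
    -- i.i.d. variables `X*` with law `H_γ`
    {Ω' : Type*} [MeasurableSpace Ω'] (P' : Measure Ω') [IsProbabilityMeasure P']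
    (Xs : ℕ → Ω' → ℝ) (hXs_meas : ∀ i, Measurable (Xs i))
    (hXs_law : ∀ i, HasLaw (Xs i) (gpd γ) P') (hXs_indep : iIndepFun Xs P') :
    -- i) `W_p (P_{(X - U t) / a t | Z > t}, H_γ) = A'_p t → 0`
    (MemWasserstein p (gpd γ) ∧
      (∀ i t, 1 < t →
        MemWasserstein p ((cond P {ω | t < Z i ω}).map
          fun ω => (tailQuantile μ (Z i ω) - tailQuantile μ t) / a t) ∧
        wasserstein p ((cond P {ω | t < Z i ω}).map
          fun ω => (tailQuantile μ (Z i ω) - tailQuantile μ t) / a t) (gpd γ)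
          = APrime (tailQuantile μ) a γ p t ∧
        APrime (tailQuantile μ) a γ p t < ∞) ∧
      Tendsto (APrime (tailQuantile μ) a γ p) atTop (𝓝 0)) ∧
    -- i) rate under the second order condition
    (∀ (ρ : ℝ) (A : ℝ → ℝ), SecondOrder (tailQuantile μ) a A γ ρ →
      IntegrableOn (fun x => psi γ ρ x ^ p / x ^ 2) (Ioi 1) ∧ 0 < cPrime γ ρ p ∧
      Asymptotics.IsEquivalent atTop (fun t => (APrime (tailQuantile μ) a γ p t).toReal)
        (fun t => cPrime γ ρ p * |A t|)) ∧
    -- ii) the conditional law of `Π_{n,k}` given `Z_{n-k,n} = t`, in the version that satisfies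
    -- the identity at every `t > 1`, and in an arbitrary version
    (∀ n k : ℕ, 1 ≤ k → k < n →
      MemWasserstein₂ p (P'.map fun ω => empiricalMeasure k fun i => Xs i ω) ∧
      (∃ κ : Kernel ℝ (Measure ℝ),
        IsCondLaw P (fun ω => orderStat n (fun i => Z i ω) (n - k))
          (fun ω => exceedanceMeasure (tailQuantile μ) a n k fun i => Z i ω) κ ∧
        ∀ t, 1 < t → MemWasserstein₂ p (κ t) ∧
          wasserstein₂ p (κ t) (P'.map fun ω => empiricalMeasure k fun i => Xs i ω)
            = APrime (tailQuantile μ) a γ p t) ∧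
      (∀ κ : Kernel ℝ (Measure ℝ),
        IsCondLaw P (fun ω => orderStat n (fun i => Z i ω) (n - k))
          (fun ω => exceedanceMeasure (tailQuantile μ) a n k fun i => Z i ω) κ →
        ∀ᵐ t ∂(P.map fun ω => orderStat n (fun i => Z i ω) (n - k)),
          MemWasserstein₂ p (κ t) ∧
          wasserstein₂ p (κ t) (P'.map fun ω => empiricalMeasure k fun i => Xs i ω)
            = APrime (tailQuantile μ) a γ p t)) ∧
    -- ii) rate in probability along an intermediate sequence
    (∀ (ρ : ℝ) (A : ℝ → ℝ), SecondOrder (tailQuantile μ) a A γ ρ →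
      ∀ k : ℕ → ℕ, Tendsto k atTop atTop →
      Tendsto (fun n => (k n : ℝ) / n) atTop (𝓝 0) →
      ∀ κ : ℕ → Kernel ℝ (Measure ℝ),
      (∀ᶠ n in atTop, IsCondLaw P (fun ω => orderStat n (fun i => Z i ω) (n - k n))
        (fun ω => exceedanceMeasure (tailQuantile μ) a n (k n) fun i => Z i ω) (κ n)) →
      TendstoInMeasure P
        (fun n ω =>
          (wasserstein₂ p (κ n (orderStat n (fun i => Z i ω) (n - k n)))
            (P'.map fun ω' => empiricalMeasure (k n) fun i => Xs i ω')).toReal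
            / (cPrime γ ρ p * |A (n / k n)|))
        atTop (fun _ => (1 : ℝ))) := by
  have hU := monotoneOn_tailQuantile μ
  have hUm := measurable_tailQuantile μ
  have hlawX : ∀ k, P'.map (fun ω => empiricalMeasure k fun i => Xs i ω) = empiricalLaw k (gpd γ) :=
    map_empiricalMeasure_eq P' hXs_meas hXs_law hXs_indep
  have hgpd := ha.memWasserstein_gpd hU ha_pos hp hpγ
  refine ⟨⟨hgpd, fun i t ht => ?_, ha.tendsto_APrime hU hUm ha_pos hp hpγ⟩, fun ρ A hA => ?_,
    fun n k hk hkn => ⟨?_, ?_, fun κ hκ => ?_⟩, fun ρ A hA k hk hkn κ hκ => ?_⟩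
  · rw [map_cond_excess hUm (hZ_meas i) (hZ_law i) ht.le]
    exact ⟨ha.memWasserstein_excess hU ha_pos hp hpγ ht,
      wasserstein_excess hU γ hp ht (ha_pos t ht), ha.APrime_lt_top hU ha_pos hp hpγ ht⟩
  · obtain ⟨hint, hc, hrate⟩ := hA.rate hU hUm ha_meas ha_pos ha hp hpγ
    refine ⟨hint, hc, ?_⟩
    have hne : ∀ᶠ t in atTop, cPrime γ ρ p * |A t| ≠ 0 := by
      filter_upwards [hA.regularlyVarying.eventually_ne] with t ht
      exact mul_ne_zero hc.ne' (abs_ne_zero.mpr ht)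
    rw [Asymptotics.isEquivalent_iff_tendsto_one hne]
    have h := hrate.div_const (cPrime γ ρ p)
    rw [div_self hc.ne'] at h
    refine h.congr fun t => ?_
    simp only [Pi.div_apply]
    rw [div_div, mul_comm]
  · rw [hlawX]
    exact memWasserstein₂_empiricalLaw hk hgpd
  · refine ⟨excessKernel (tailQuantile μ) a k,
      isCondLaw_excessKernel hUm ha_meas hU hZ_meas hZ_law hZ_indep hkn, fun t ht => ?_⟩
    rw [hlawX]
    exact excessKernel_props hUm ha_meas hU ha_pos ha hp hpγ hk ht
  · simp only [hlawX]
    exact hκ.ae_props hUm ha_meas hU ha_pos ha hp hpγ hZ_meas hZ_law hZ_indep hk hkn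
  · simp only [hlawX]
    exact hA.tendstoInMeasure hUm ha_meas hU ha_pos ha hp hpγ hZ_meas hZ_law hZ_indep hk hkn hκ
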